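/- **Setting.** All Hilbert spaces are complex, with inner products linear in the first variable; $\otimes$ denotes the Hilbert space or von Neumann algebraic tensor product and $\odot$ the algebraic one; $\omega_{v,w}(x)=\langle xv,w\rangle$. A von Neumann algebraic quantum group is a von Neumann algebra $M$ with a unital normal $*$-homomorphism $\Delta:M\to M\otimes M$ such that $(\Delta\otimes\iota)\Delta=(\iota\otimes\Delta)\Delta$, for which there exist normal semifinite faithful (n.s.f.) weights $\varphi,\psi$ on $M$ with $\varphi((\omega\otimes\iota)\Delta(a))=\varphi(a)\,\omega(1)$ for all $\omega\in M_*^+$ and $a\in M^+$ with $\varphi(a)<\infty$, and $\psi((\iota\otimes\omega)\Delta(a))=\psi(a)\,\omega(1)$ for all $\omega\in M_*^+$ and $a\in M^+$ with $\psi(a)<\infty$. Let $(M,\Delta_M)$ and $(N,\Delta_N)$ be von Neumann algebraic quantum groups, with $M$ and $N$ acting on Hilbert spaces $H_M$ and $H_N$. Let $\alpha:M\to M\otimes N$ be a unital injective normal $*$-homomorphism with $(\alpha\otimes\iota)\alpha=(\iota\otimes\Delta_N)\alpha$ and $(\Delta_M\otimes\iota)\alpha=(\iota\otimes\alpha)\Delta_M$,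 and put $Q=\{x\in M\mid \alpha(x)=x\otimes 1\}$, a von Neumann subalgebra of $M$. Let $\theta$ be an n.s.f. weight on $Q$ with GNS-construction $(H_\theta,\pi_\theta,\Lambda_\theta)$. Let $K$ be a Hilbert space and $U\in N\otimes B(K)$ a unitary with $(\Delta_N\otimes\iota)(U)=U_{13}U_{23}$. For a Hilbert space $H$ put $$\mathcal P_H=\{X\in B(H)\otimes M\otimes B(K)\mid (\iota\otimes\alpha\otimes\iota)(X)=U_{34}^*\,X_{124}\}.$$ For $X,Y\in\mathcal P_H$ one has $Y^*X\in B(H)\otimes Q\otimes B(K)$, and $$\langle X\otimes v,\,Y\otimes w\rangle=\langle(\iota\otimes\pi_\theta\otimes\iota)(Y^*X)\,v,\,w\rangle$$ defines a positive semidefinite sesquilinear form on $\mathcal P_H\odot(H\otimes H_\theta\otimes K)$. Let $\mathcal K_H$ be the Hilbert space obtained by dividing out the vectors $x$ with $\langle x,x\rangle=0$ and completing, and write $X\mathbin{\dot\otimes}v\in\mathcal K_H$ for the class of $X\otimes v$. Put $\mathcal P=\mathcal P_{\mathbb C}$ and $\mathcal K=\mathcal K_{\mathbb C}$, identifying $\mathbb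 C\otimes H_\theta\otimes K$ with $H_\theta\otimes K$ and $B(\mathbb C)\otimes M\otimes B(K)$ with $M\otimes B(K)$. Then $1_{B(H)}\otimes X\in\mathcal P_H$ for $X\in\mathcal P$, and $(\omega_{v,w}\otimes\iota\otimes\iota)(X)\in\mathcal P$ for $X\in\mathcal P_H$ and $v,w\in H$. **Proposition.** For every Hilbert space $H$ there exists a unique unitary linear transformation $U_H:H\otimes\mathcal K\to\mathcal K_H$ such that $$U_H\bigl(v\otimes(X\mathbin{\dot\otimes}w)\bigr)=(1\otimes X)\mathbin{\dot\otimes}(v\otimes w)\qquad\text{for all } v\in H,\ X\in\mathcal P,\ w\in H_\theta\otimes K .$$ Furthermore, for all $v\in H$, every orthonormal basis $(e_i)_{i\in I}$ of $H$, all $X\in\mathcal P_H$ and $w\in H_\theta\otimes K$, $$\sum_{i\in I}\bigl\|(\omega_{v,e_i}\otimes\iota\otimes\iota)(X)\mathbin{\dot\otimes}w\bigr\|^2<\infty \quad\text{and}\quad U_H^*\bigl(X\mathbin{\dot\otimes}(v\otimes w)\bigr)=\sum_{i\in I}e_i\otimes\bigl((\omega_{v,e_i}\otimes\iota\otimes\iota)(X)\mathbin{\dot\otimes}w\bigr).$$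 -/

import Mathlib

open scoped TensorProduct ComplexOrder

noncomputable section

namespace IndCorep

section HilbertTensor

variable {E F G X E' F' E'' F'' : Type*}
  [NormedAddCommGroup E] [InnerProductSpace ℂ E]
  [NormedAddCommGroup F] [InnerProductSpace ℂ F]
  [NormedAddCommGroup G] [InnerProductSpace ℂ G]
  [NormedAddCommGroup E'] [InnerProductSpace ℂ E']
  [NormedAddCommGroup F'] [InnerProductSpace ℂ F']
  [NormedAddCommGroup E''] [InnerProductSpace ℂ E'']
  [NormedAddCommGroup F''] [InnerProductSpace ℂ F'']
  [NormedAddCommGroup X] [InnerProductSpace ℂ X]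

/-- The Hilbert space tensor product: the completion of the algebraic tensor product. -/
def HTensor (E F : Type*) [NormedAddCommGroup E] [InnerProductSpace ℂ E]
    [NormedAddCommGroup F] [InnerProductSpace ℂ F] : Type _ :=
  UniformSpace.Completion (E ⊗[ℂ] F)

infixr:72 " ⊗ʰ " => HTensor

instance : NormedAddCommGroup (E ⊗ʰ F) :=
  inferInstanceAs (NormedAddCommGroup (UniformSpace.Completion (E ⊗[ℂ] F)))
instance : InnerProductSpace ℂ (E ⊗ʰ F) :=
  inferInstanceAs (InnerProductSpace ℂ (UniformSpace.Completion (E ⊗[ℂ] F)))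
instance : CompleteSpace (E ⊗ʰ F) :=
  inferInstanceAs (CompleteSpace (UniformSpace.Completion (E ⊗[ℂ] F)))

/-- The canonical isometric embedding of the algebraic tensor product. -/
def HTensor.ι : E ⊗[ℂ] F →ₗᵢ[ℂ] E ⊗ʰ F := UniformSpace.Completion.toComplₗᵢ

/-- `leg e f = e ⊗ f`, as a bounded bilinear map. -/
def HTensor.leg : E →L[ℂ] F →L[ℂ] E ⊗ʰ F :=
  (ContinuousLinearMap.compL ℂ F (E ⊗[ℂ] F) (E ⊗ʰ F) HTensor.ι.toContinuousLinearMap) ∘L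
    (TensorProduct.mkL ℂ E F)

/-- The elementary tensor `e ⊗ f`. -/
def htmul (e : E) (f : F) : E ⊗ʰ F := HTensor.leg e f

infixr:73 " ⊗ᵥ " => htmul

namespace HTensor

lemma leg_apply (e : E) (f : F) : leg e f = e ⊗ᵥ f := rfl

lemma ι_tmul (e : E) (f : F) : ι (e ⊗ₜ[ℂ] f) = e ⊗ᵥ f := rfl

lemma denseRange_ι : DenseRange (ι : E ⊗[ℂ] F →ₗᵢ[ℂ] E ⊗ʰ F) :=
  UniformSpace.Completion.denseRange_coe

@[simp] lemma inner_htmul (e e' : E) (f f' : F) :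
    inner ℂ (e ⊗ᵥ f) (e' ⊗ᵥ f') = inner ℂ e e' * inner ℂ f f' := by
  rw [← ι_tmul, ← ι_tmul, LinearIsometry.inner_map_map, TensorProduct.inner_tmul]

lemma htmul_add (e : E) (f f' : F) : e ⊗ᵥ (f + f') = e ⊗ᵥ f + e ⊗ᵥ f' := map_add (leg e) f f'
lemma add_htmul (e e' : E) (f : F) : (e + e') ⊗ᵥ f = e ⊗ᵥ f + e' ⊗ᵥ f := by
  simp [← leg_apply]
lemma htmul_smul (c : ℂ) (e : E) (f : F) : e ⊗ᵥ (c • f) = c • (e ⊗ᵥ f) := map_smul (leg e) c f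
lemma smul_htmul (c : ℂ) (e : E) (f : F) : (c • e) ⊗ᵥ f = c • (e ⊗ᵥ f) := by
  simp [← leg_apply]

/-- Elementary tensors span a dense subspace. -/
lemma dense_span :
    (Submodule.span ℂ (Set.range fun p : E × F => p.1 ⊗ᵥ p.2)).topologicalClosure = ⊤ := by
  set S := Submodule.span ℂ (Set.range fun p : E × F => p.1 ⊗ᵥ p.2)
  rw [eq_top_iff]
  intro x _
  refine denseRange_ι.induction_on (p := fun x => x ∈ S.topologicalClosure) x
    S.isClosed_topologicalClosure ?_
  intro a
  refine S.le_topologicalClosure ?_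
  induction a with
  | zero => simp
  | add x y hx hy => rw [map_add]; exact S.add_mem hx hy
  | tmul e f => exact Submodule.subset_span ⟨(e, f), rfl⟩

lemma ext_clm {Y : Type*} [NormedAddCommGroup Y] [NormedSpace ℂ Y] {S T : E ⊗ʰ F →L[ℂ] Y}
    (h : ∀ e f, S (e ⊗ᵥ f) = T (e ⊗ᵥ f)) : S = T := by
  have h1 : (S ∘L ι.toContinuousLinearMap).toLinearMap = (T ∘L ι.toContinuousLinearMap).toLinearMap :=
    TensorProduct.ext' fun e f => h e f
  ext x
  refine congrFun (denseRange_ι.equalizer S.continuous T.continuous ?_) x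
  funext y
  exact congrArg (fun L : E ⊗[ℂ] F →ₗ[ℂ] Y => L y) h1

lemma ext_op {S T : E ⊗ʰ F →L[ℂ] E' ⊗ʰ F'}
    (h : ∀ e f e' f', inner ℂ (e' ⊗ᵥ f') (S (e ⊗ᵥ f)) = inner ℂ (e' ⊗ᵥ f') (T (e ⊗ᵥ f))) :
    S = T := by
  apply ext_clm
  intro e f
  have : innerSL ℂ (S (e ⊗ᵥ f)) = innerSL ℂ (T (e ⊗ᵥ f)) := by
    apply ext_clm
    intro e' f'
    have := congrArg (starRingEnd ℂ) (h e f e' f')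
    simpa using this
  exact (innerSL_inj).1 this

/-- Tensor product of bounded operators. -/
def map (f : E →L[ℂ] E') (g : F →L[ℂ] F') : E ⊗ʰ F →L[ℂ] E' ⊗ʰ F' :=
  (TensorProduct.mapL f g).completion

@[simp] lemma map_htmul (f : E →L[ℂ] E') (g : F →L[ℂ] F') (x : E) (y : F) :
    map f g (x ⊗ᵥ y) = f x ⊗ᵥ g y := by
  exact UniformSpace.Completion.map_coe (TensorProduct.mapL f g).uniformContinuous (x ⊗ₜ y)

lemma map_comp (f : E' →L[ℂ] E'') (g : F' →L[ℂ] F'') (f' : E →L[ℂ] E') (g' : F →L[ℂ] F') :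
    map f g ∘L map f' g' = map (f ∘L f') (g ∘L g') := ext_clm fun _ _ => by simp

lemma map_one_one : map (1 : E →L[ℂ] E) (1 : F →L[ℂ] F) = 1 := ext_clm fun _ _ => by simp

lemma adjoint_map [CompleteSpace E] [CompleteSpace F] [CompleteSpace E'] [CompleteSpace F']
    (f : E →L[ℂ] E') (g : F →L[ℂ] F') :
    ContinuousLinearMap.adjoint (map f g)
      = map (ContinuousLinearMap.adjoint f) (ContinuousLinearMap.adjoint g) := by
  apply ext_op
  intro e f e' f'
  simp [ContinuousLinearMap.adjoint_inner_right]

/-- Isometric extension of an inner-product-multiplicative bilinear map. -/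
def liftI [CompleteSpace X] (B : E →ₗ[ℂ] F →ₗ[ℂ] X)
    (hB : ∀ e f e' f', inner ℂ (B e f) (B e' f') = inner ℂ e e' * inner ℂ f f') :
    E ⊗ʰ F →ₗᵢ[ℂ] X :=
  let L0 : E ⊗[ℂ] F →ₗᵢ[ℂ] X := (TensorProduct.lift B).isometryOfInner (by
    intro x y
    induction x with
    | zero => simp
    | add x x' hx hx' => simp only [map_add, inner_add_left, hx, hx']
    | tmul e f =>
      induction y with
      | zero => simp
      | add y y' hy hy' => simp only [map_add, inner_add_right, hy, hy']
      | tmul e' f' => simp [hB])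
  { (L0.toContinuousLinearMap.extend (ι : E ⊗[ℂ] F →ₗᵢ[ℂ] E ⊗ʰ F).toContinuousLinearMap).toLinearMap
    with
    norm_map' := by
      intro x
      refine denseRange_ι.induction_on (p := fun x => ‖(L0.toContinuousLinearMap.extend (ι : E ⊗[ℂ] F →ₗᵢ[ℂ] E ⊗ʰ F).toContinuousLinearMap) x‖ = ‖x‖) x ?_ ?_
      · exact isClosed_eq (by fun_prop) (by fun_prop)
      · intro a
        have := ContinuousLinearMap.extend_eq L0.toContinuousLinearMap (e := (ι : E ⊗[ℂ] F →ₗᵢ[ℂ] E ⊗ʰ F).toContinuousLinearMap) denseRange_ι ι.isometry.isUniformInducing a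
        simp at this
        simp [this] }


lemma liftI_htmul [CompleteSpace X] (B : E →ₗ[ℂ] F →ₗ[ℂ] X)
    (hB : ∀ e f e' f', inner ℂ (B e f) (B e' f') = inner ℂ e e' * inner ℂ f f') (e : E) (f : F) :
    liftI B hB (e ⊗ᵥ f) = B e f :=
  ContinuousLinearMap.extend_eq _ (e := (ι : E ⊗[ℂ] F →ₗᵢ[ℂ] E ⊗ʰ F).toContinuousLinearMap)
    denseRange_ι ι.isometry.isUniformInducing (e ⊗ₜ f)

/-- A Hilbert space isomorphism `E ⊗ F ≃ X` from a bilinear map with total range. -/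
def liftEquiv [CompleteSpace X] (B : E →ₗ[ℂ] F →ₗ[ℂ] X)
    (hB : ∀ e f e' f', inner ℂ (B e f) (B e' f') = inner ℂ e e' * inner ℂ f f')
    (hd : (Submodule.span ℂ (Set.range fun p : E × F => B p.1 p.2)).topologicalClosure = ⊤) :
    E ⊗ʰ F ≃ₗᵢ[ℂ] X :=
  LinearIsometryEquiv.ofSurjective (liftI B hB) (by
    have hc : IsClosed ((LinearMap.range (liftI B hB).toLinearMap : Submodule ℂ X) : Set X) := by
      rw [LinearMap.coe_range]
      exact (liftI B hB).isometry.isClosedEmbedding.isClosed_range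
    have : (⊤ : Submodule ℂ X) ≤ LinearMap.range (liftI B hB).toLinearMap := by
      rw [← hd]
      refine Submodule.topologicalClosure_minimal _ (Submodule.span_le.2 ?_) hc
      rintro _ ⟨p, rfl⟩
      exact ⟨p.1 ⊗ᵥ p.2, liftI_htmul B hB _ _⟩
    intro x
    exact this (Submodule.mem_top (x := x)))

lemma liftEquiv_htmul [CompleteSpace X] (B : E →ₗ[ℂ] F →ₗ[ℂ] X)
    (hB : ∀ e f e' f', inner ℂ (B e f) (B e' f') = inner ℂ e e' * inner ℂ f f')
    (hd : (Submodule.span ℂ (Set.range fun p : E × F => B p.1 p.2)).topologicalClosure = ⊤)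
    (e : E) (f : F) : liftEquiv B hB hd (e ⊗ᵥ f) = B e f :=
  liftI_htmul B hB e f

variable (E F G) in
/-- The flip `E ⊗ F ≃ F ⊗ E`. -/
def comm : E ⊗ʰ F ≃ₗᵢ[ℂ] F ⊗ʰ E :=
  liftEquiv (LinearMap.mk₂ ℂ (fun e f => f ⊗ᵥ e)
      (fun _ _ _ => htmul_add _ _ _) (fun _ _ _ => htmul_smul _ _ _)
      (fun _ _ _ => add_htmul _ _ _) (fun _ _ _ => smul_htmul _ _ _))
    (fun _ _ _ _ => by simp [mul_comm])
    (by
      rw [← dense_span (E := F) (F := E)]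
      congr 2
      ext x
      exact ⟨fun ⟨p, h⟩ => ⟨p.swap, h⟩, fun ⟨p, h⟩ => ⟨p.swap, h⟩⟩)

@[simp] lemma comm_htmul (e : E) (f : F) : comm E F (e ⊗ᵥ f) = f ⊗ᵥ e := liftEquiv_htmul ..

variable (E F G) in
/-- The associativity isomorphism `(E ⊗ F) ⊗ G ≃ E ⊗ (F ⊗ G)`. -/
def assoc : (E ⊗ʰ F) ⊗ʰ G ≃ₗᵢ[ℂ] E ⊗ʰ (F ⊗ʰ G) :=
  liftEquiv (LinearMap.mk₂ ℂ
      (fun t g => map (1 : E →L[ℂ] E) ((leg (E := F) (F := G)).flip g) t)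
      (fun _ _ _ => map_add _ _ _) (fun _ _ _ => map_smul _ _ _)
      (fun t g g' => by
        rw [← add_apply]
        congr 1
        apply ext_clm
        intro e f
        simp [htmul_add])
      (fun c t g => by
        rw [← smul_apply]
        congr 1
        apply ext_clm
        intro e f
        simp [htmul_smul]))
    (by
      intro t g t' g'
      simp only [LinearMap.mk₂_apply]
      have key : ContinuousLinearMap.adjoint
            (map (1 : E →L[ℂ] E) ((leg (E := F) (F := G)).flip g))
          ∘L map (1 : E →L[ℂ] E) ((leg (E := F) (F := G)).flip g')
          = (inner ℂ g g') • (1 : E ⊗ʰ F →L[ℂ] E ⊗ʰ F) := by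
        apply ext_op
        intro e f e' f'
        simp [ContinuousLinearMap.adjoint_inner_right, leg_apply, inner_smul_right]
        ring
      have h2 := congrArg (fun L => inner ℂ t (L t')) key
      simpa [ContinuousLinearMap.adjoint_inner_right, inner_smul_right, mul_comm] using h2)
    (by
      set V := (Submodule.span ℂ (Set.range fun p : (E ⊗ʰ F) × G => LinearMap.mk₂ ℂ
        (fun t g => map (1 : E →L[ℂ] E) ((leg (E := F) (F := G)).flip g) t) _ _ _ _ p.1 p.2))
      have h1 : ∀ (e : E) (s : F ⊗ʰ G), e ⊗ᵥ s ∈ V.topologicalClosure := by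
        intro e
        have : (⊤ : Submodule ℂ (F ⊗ʰ G)) ≤
            V.topologicalClosure.comap (leg (F := F ⊗ʰ G) e).toLinearMap := by
          rw [← dense_span (E := F) (F := G)]
          refine Submodule.topologicalClosure_minimal _ (Submodule.span_le.2 ?_)
            (V.isClosed_topologicalClosure.preimage (leg (F := F ⊗ʰ G) e).continuous)
          rintro _ ⟨p, rfl⟩
          refine V.le_topologicalClosure (Submodule.subset_span ⟨(e ⊗ᵥ p.1, p.2), ?_⟩)
          simp [leg_apply]
        exact fun s => this (Submodule.mem_top (x := s))
      rw [eq_top_iff, ← dense_span (E := E) (F := F ⊗ʰ G)]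
      refine Submodule.topologicalClosure_minimal _ (Submodule.span_le.2 ?_)
        V.isClosed_topologicalClosure
      rintro _ ⟨p, rfl⟩
      exact h1 p.1 p.2)

lemma assoc_htmul (e : E) (f : F) (g : G) :
    assoc E F G ((e ⊗ᵥ f) ⊗ᵥ g) = e ⊗ᵥ (f ⊗ᵥ g) := by
  simp [assoc, liftEquiv_htmul, leg_apply]

variable (F) in
/-- The identification `ℂ ⊗ F ≃ F`. -/
def lid [CompleteSpace F] : ℂ ⊗ʰ F ≃ₗᵢ[ℂ] F :=
  liftEquiv (LinearMap.lsmul ℂ F) (fun c f c' f' => by simp [inner_smul_left, inner_smul_right]; ring)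
    (by
      rw [eq_top_iff]
      intro x _
      exact Submodule.le_topologicalClosure _ (Submodule.subset_span ⟨(1, x), by simp⟩))

@[simp] lemma lid_htmul [CompleteSpace F] (c : ℂ) (f : F) : lid F (c ⊗ᵥ f) = c • f :=
  liftEquiv_htmul ..

lemma lid_symm_apply [CompleteSpace F] (f : F) : (lid F).symm f = (1 : ℂ) ⊗ᵥ f := by
  rw [LinearIsometryEquiv.symm_apply_eq]; simp

end HTensor
end HilbertTensor

section VNTensor

set_option linter.unusedSectionVars false

variable {E F G K : Type*}
  [NormedAddCommGroup E] [InnerProductSpace ℂ E] [CompleteSpace E]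
  [NormedAddCommGroup F] [InnerProductSpace ℂ F] [CompleteSpace F]
  [NormedAddCommGroup G] [InnerProductSpace ℂ G] [CompleteSpace G]
  [NormedAddCommGroup K] [InnerProductSpace ℂ K] [CompleteSpace K]

open HTensor

lemma HTensor.ext_clm3 {Y : Type*} [NormedAddCommGroup Y] [NormedSpace ℂ Y]
    {S T : (E ⊗ʰ F) ⊗ʰ G →L[ℂ] Y}
    (h : ∀ e f g, S ((e ⊗ᵥ f) ⊗ᵥ g) = T ((e ⊗ᵥ f) ⊗ᵥ g)) : S = T := by
  apply ext_clm
  intro t g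
  have : S ∘L (leg (E := E ⊗ʰ F) (F := G)).flip g = T ∘L (leg (E := E ⊗ʰ F) (F := G)).flip g :=
    ext_clm fun e f => h e f g
  exact congrArg (fun L : E ⊗ʰ F →L[ℂ] Y => L t) this

lemma HTensor.ext_clm3' {Y : Type*} [NormedAddCommGroup Y] [NormedSpace ℂ Y]
    {S T : E ⊗ʰ (F ⊗ʰ G) →L[ℂ] Y}
    (h : ∀ e f g, S (e ⊗ᵥ (f ⊗ᵥ g)) = T (e ⊗ᵥ (f ⊗ᵥ g))) : S = T := by
  apply ext_clm
  intro e t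
  have : S ∘L leg (E := E) (F := F ⊗ʰ G) e = T ∘L leg (E := E) (F := F ⊗ʰ G) e :=
    ext_clm fun f g => h e f g
  exact congrArg (fun L : F ⊗ʰ G →L[ℂ] Y => L t) this

lemma HTensor.ext_vec3 {x y : (E ⊗ʰ F) ⊗ʰ G}
    (h : ∀ e f g, inner ℂ ((e ⊗ᵥ f) ⊗ᵥ g) x = inner ℂ ((e ⊗ᵥ f) ⊗ᵥ g) y) : x = y := by
  have : innerSL ℂ x = innerSL ℂ y := by
    refine ext_clm3 fun e f g => ?_
    rw [innerSL_apply_apply, innerSL_apply_apply, ← inner_conj_symm, h, inner_conj_symm]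
  exact innerSL_inj.1 this

lemma HTensor.ext_op3 {S T : (E ⊗ʰ F) ⊗ʰ G →L[ℂ] (E ⊗ʰ F) ⊗ʰ G}
    (h : ∀ e f g e' f' g', inner ℂ ((e' ⊗ᵥ f') ⊗ᵥ g') (S ((e ⊗ᵥ f) ⊗ᵥ g))
      = inner ℂ ((e' ⊗ᵥ f') ⊗ᵥ g') (T ((e ⊗ᵥ f) ⊗ᵥ g))) : S = T :=
  ext_clm3 fun e f g => ext_vec3 fun e' f' g' => h e f g e' f' g'

/-- The von Neumann algebra `B(E)`. -/
def fullVN (E : Type*) [NormedAddCommGroup E] [InnerProductSpace ℂ E] [CompleteSpace E] :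
    VonNeumannAlgebra E where
  toStarSubalgebra := ⊤
  centralizer_centralizer' := by
    refine Set.eq_univ_of_forall fun x => ?_
    rw [Set.mem_centralizer_iff]
    intro y hy
    exact (hy x trivial).symm

@[simp] lemma mem_fullVN (x : E →L[ℂ] E) : x ∈ fullVN E := trivial

/-- The von Neumann algebra generated by a set of operators: the bicommutant of `s ∪ s*`. -/
def vnGen (s : Set (E →L[ℂ] E)) : VonNeumannAlgebra E where
  toStarSubalgebra := StarSubalgebra.centralizer ℂ (StarSubalgebra.centralizer ℂ s : Set (E →L[ℂ] E))
  centralizer_centralizer' := by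
    change Set.centralizer (Set.centralizer ((StarSubalgebra.centralizer ℂ
      (StarSubalgebra.centralizer ℂ s : Set (E →L[ℂ] E)) : StarSubalgebra ℂ (E →L[ℂ] E)) :
        Set (E →L[ℂ] E))) = ((StarSubalgebra.centralizer ℂ
      (StarSubalgebra.centralizer ℂ s : Set (E →L[ℂ] E)) : StarSubalgebra ℂ (E →L[ℂ] E)) :
        Set (E →L[ℂ] E))
    rw [StarSubalgebra.coe_centralizer_centralizer, Set.centralizer_centralizer_centralizer]

lemma mem_vnGen_iff {s : Set (E →L[ℂ] E)} (hs : ∀ x ∈ s, star x ∈ s) {x : E →L[ℂ] E} :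
    x ∈ vnGen s ↔ ∀ z : E →L[ℂ] E, (∀ a ∈ s, a * z = z * a) → z * x = x * z := by
  have h1 : s ∪ star s = s := by
    apply Set.union_eq_self_of_subset_right
    intro x hx
    simpa using hs _ hx
  change x ∈ ((StarSubalgebra.centralizer ℂ
      (StarSubalgebra.centralizer ℂ s : Set (E →L[ℂ] E)) : StarSubalgebra ℂ (E →L[ℂ] E)) :
        Set (E →L[ℂ] E)) ↔ _
  rw [StarSubalgebra.coe_centralizer_centralizer, h1]
  rfl

/-- The von Neumann algebraic tensor product `R ⊗ S`, generated by the operators `a ⊗ b`. -/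
def vnTensor (R : VonNeumannAlgebra E) (S : VonNeumannAlgebra F) : VonNeumannAlgebra (E ⊗ʰ F) :=
  vnGen {x | ∃ a ∈ R, ∃ b ∈ S, x = HTensor.map a b}

lemma star_map (a : E →L[ℂ] E) (b : F →L[ℂ] F) :
    star (HTensor.map a b) = HTensor.map (star a) (star b) := adjoint_map a b

lemma map_mul_map (a c : E →L[ℂ] E) (b d : F →L[ℂ] F) :
    HTensor.map a b * HTensor.map c d = HTensor.map (a * c) (b * d) := map_comp a b c d

lemma mem_vnTensor_iff {R : VonNeumannAlgebra E} {S : VonNeumannAlgebra F}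
    {T : E ⊗ʰ F →L[ℂ] E ⊗ʰ F} :
    T ∈ vnTensor R S ↔ ∀ Z : E ⊗ʰ F →L[ℂ] E ⊗ʰ F,
      (∀ a ∈ R, ∀ b ∈ S, HTensor.map a b * Z = Z * HTensor.map a b) → Z * T = T * Z := by
  rw [vnTensor, mem_vnGen_iff]
  · refine forall_congr' fun Z => imp_congr_left ?_
    constructor
    · exact fun h a ha b hb => h _ ⟨a, ha, b, hb, rfl⟩
    · rintro h _ ⟨a, ha, b, hb, rfl⟩
      exact h a ha b hb
  · rintro _ ⟨a, ha, b, hb, rfl⟩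
    exact ⟨_, star_mem ha, _, star_mem hb, star_map a b⟩

lemma map_mem_vnTensor {R : VonNeumannAlgebra E} {S : VonNeumannAlgebra F}
    {a : E →L[ℂ] E} {b : F →L[ℂ] F} (ha : a ∈ R) (hb : b ∈ S) :
    HTensor.map a b ∈ vnTensor R S :=
  mem_vnTensor_iff.2 fun _ h => (h a ha b hb).symm

/-- The slice `(ω_{v,w} ⊗ ι)(T)` by the functional `ω_{v,w}(x) = ⟨x v, w⟩` (linear in the
first variable of the inner product), i.e. `⟨(ω_{v,w} ⊗ ι)(T) f, f'⟩ = ⟨T (v ⊗ f), w ⊗ f'⟩`. -/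
def slice (v w : E) (T : E ⊗ʰ F →L[ℂ] E ⊗ʰ F) : F →L[ℂ] F :=
  ContinuousLinearMap.adjoint (leg w) ∘L T ∘L leg v

/-- The slice `(ι ⊗ ω_{v,w})(T)`. -/
def sliceR (v w : F) (T : E ⊗ʰ F →L[ℂ] E ⊗ʰ F) : E →L[ℂ] E :=
  ContinuousLinearMap.adjoint (leg.flip w) ∘L T ∘L leg.flip v

lemma inner_slice (v w : E) (T : E ⊗ʰ F →L[ℂ] E ⊗ʰ F) (f f' : F) :
    inner ℂ f' (slice v w T f) = inner ℂ (w ⊗ᵥ f') (T (v ⊗ᵥ f)) := by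
  simp [slice, ContinuousLinearMap.adjoint_inner_right, leg_apply]

lemma slice_ext {S T : E ⊗ʰ F →L[ℂ] E ⊗ʰ F} (h : ∀ v w, slice v w S = slice v w T) : S = T :=
  ext_op fun e f e' f' => by rw [← inner_slice, ← inner_slice, h]

lemma slice_map (v w : E) (a : E →L[ℂ] E) (b : F →L[ℂ] F) :
    slice v w (HTensor.map a b) = (inner ℂ w (a v)) • b := by
  ext f
  apply ext_inner_left ℂ
  intro f'
  rw [inner_slice]
  simp

lemma slice_mul_map (v w : E) (T : E ⊗ʰ F →L[ℂ] E ⊗ʰ F) (b : F →L[ℂ] F) :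
    slice v w (T * HTensor.map 1 b) = slice v w T * b := by
  ext f
  apply ext_inner_left ℂ
  intro f'
  change _ = inner ℂ f' (slice v w T (b f))
  rw [inner_slice, inner_slice]
  change inner ℂ (w ⊗ᵥ f') (T (HTensor.map 1 b (v ⊗ᵥ f))) = _
  simp

lemma slice_star (v w : E) (T : E ⊗ʰ F →L[ℂ] E ⊗ʰ F) :
    slice v w (star T) = star (slice w v T) := by
  ext f
  apply ext_inner_left ℂ
  intro f'
  rw [inner_slice, ContinuousLinearMap.star_eq_adjoint, ContinuousLinearMap.star_eq_adjoint,
    ContinuousLinearMap.adjoint_inner_right, ContinuousLinearMap.adjoint_inner_right,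
    ← inner_conj_symm, ← inner_slice, inner_conj_symm]

lemma slice_map_mul (v w : E) (T : E ⊗ʰ F →L[ℂ] E ⊗ʰ F) (b : F →L[ℂ] F) :
    slice v w (HTensor.map 1 b * T) = b * slice v w T := by
  have := congrArg star (slice_mul_map w v (star T) (star b))
  rw [← slice_star, star_mul, star_star, star_map, star_star, star_one, star_mul, star_star,
    slice_star, star_star] at this
  exact this

lemma slice_add (v w : E) (S T : E ⊗ʰ F →L[ℂ] E ⊗ʰ F) :
    slice v w (S + T) = slice v w S + slice v w T := by ext; simp [slice]

lemma slice_smul (v w : E) (c : ℂ) (T : E ⊗ʰ F →L[ℂ] E ⊗ʰ F) :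
    slice v w (c • T) = c • slice v w T := by ext; simp [slice]

/-- An operator commuting with `B(E) ⊗ 1` is of the form `1 ⊗ y`, with `y` a slice of it. -/
lemma exists_eq_map_one {Z : E ⊗ʰ F →L[ℂ] E ⊗ʰ F}
    (hZ : ∀ a : E →L[ℂ] E, HTensor.map a 1 * Z = Z * HTensor.map a 1) :
    ∃ e : E, Z = HTensor.map 1 (slice e e Z) := by
  rcases subsingleton_or_nontrivial E with hE | hE
  · refine ⟨0, ext_clm fun e f => ?_⟩
    rw [Subsingleton.elim e 0]
    simp [← leg_apply]
  · obtain ⟨e, he⟩ := exists_ne (0 : E)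
    obtain ⟨e, he⟩ : ∃ e : E, ‖e‖ = 1 := NormedSpace.exists_lt_norm ℂ E 0 |>.elim fun _ _ =>
      ⟨((‖e‖⁻¹ : ℝ) : ℂ) • e, by simp [norm_smul, he]⟩
    refine ⟨e, ext_op fun x f x' f' => ?_⟩
    have hee : inner ℂ e e = (1 : ℂ) := by rw [inner_self_eq_norm_sq_to_K, he]; simp
    have h1 := hZ (InnerProductSpace.rankOne ℂ x e)
    have h2 := congrArg (fun L => inner ℂ (x' ⊗ᵥ f') (L (e ⊗ᵥ f))) h1
    have h3 : HTensor.map (InnerProductSpace.rankOne ℂ x e) (1 : F →L[ℂ] F)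
        = star (HTensor.map (InnerProductSpace.rankOne ℂ e x) (1 : F →L[ℂ] F)) := by
      rw [star_map, star_one, ContinuousLinearMap.star_eq_adjoint, InnerProductSpace.adjoint_rankOne]
    change inner ℂ (x' ⊗ᵥ f') (HTensor.map (InnerProductSpace.rankOne ℂ x e) 1 (Z (e ⊗ᵥ f)))
      = inner ℂ (x' ⊗ᵥ f') (Z (HTensor.map (InnerProductSpace.rankOne ℂ x e) 1 (e ⊗ᵥ f))) at h2
    conv at h2 => lhs; rw [h3, ContinuousLinearMap.star_eq_adjoint, ContinuousLinearMap.adjoint_inner_right]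
    simp [he] at h2
    rw [← h2, map_htmul, inner_htmul, one_apply_eq_self, inner_slice]
    rw [← leg_apply (inner ℂ x x' • e)]
    simp [leg_apply, inner_smul_left]

lemma slice_commute {R : VonNeumannAlgebra F} {Z : E ⊗ʰ F →L[ℂ] E ⊗ʰ F}
    (hZ : ∀ y ∈ R, HTensor.map 1 y * Z = Z * HTensor.map 1 y) (v w : E) :
    slice v w Z ∈ R.commutant := by
  rw [VonNeumannAlgebra.mem_commutant_iff]
  intro g hg
  rw [← slice_map_mul, hZ g hg, slice_mul_map]

/-- `B(E) ⊗ R = (1 ⊗ R')'`. -/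
lemma mem_full_tensor_iff {R : VonNeumannAlgebra F} {T : E ⊗ʰ F →L[ℂ] E ⊗ʰ F} :
    T ∈ vnTensor (fullVN E) R ↔
      ∀ y ∈ R.commutant, HTensor.map 1 y * T = T * HTensor.map 1 y := by
  rw [mem_vnTensor_iff]
  constructor
  · intro h y hy
    refine h _ fun a _ b hb => ?_
    rw [map_mul_map, map_mul_map, one_mul, mul_one,
      (VonNeumannAlgebra.mem_commutant_iff.1 hy) b hb]
  · intro h Z hZ
    obtain ⟨e, he⟩ := exists_eq_map_one (Z := Z) fun a => hZ a (mem_fullVN a) 1 (one_mem R)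
    rw [he]
    exact h _ (slice_commute (fun y hy => hZ 1 (mem_fullVN 1) y hy) e e)

/-- An operator lies in `B(E) ⊗ R` exactly when all its slices lie in `R`. -/
lemma mem_full_tensor_iff_slice {R : VonNeumannAlgebra F} {T : E ⊗ʰ F →L[ℂ] E ⊗ʰ F} :
    T ∈ vnTensor (fullVN E) R ↔ ∀ v w, slice v w T ∈ R := by
  rw [mem_full_tensor_iff]
  constructor
  · intro h v w
    have := slice_commute (R := R.commutant) h v w
    rwa [VonNeumannAlgebra.commutant_commutant] at this
  · intro h y hy
    refine slice_ext fun v w => ?_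
    rw [slice_map_mul, slice_mul_map]
    exact ((VonNeumannAlgebra.mem_commutant_iff.1 hy) _ (h v w)).symm

/-- Conjugation `T ↦ U T U*` by a unitary. -/
abbrev Ad (U : E ≃ₗᵢ[ℂ] F) : (E →L[ℂ] E) ≃⋆ₐ[ℂ] (F →L[ℂ] F) := U.conjStarAlgEquiv

lemma Ad_symm_Ad (U : E ≃ₗᵢ[ℂ] F) (T : E →L[ℂ] E) : Ad U.symm (Ad U T) = T := by
  ext x; simp

lemma Ad_Ad_symm (U : E ≃ₗᵢ[ℂ] F) (T : F →L[ℂ] F) : Ad U (Ad U.symm T) = T := by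
  ext x; simp

lemma Ad_comm_map (a : E →L[ℂ] E) (b : F →L[ℂ] F) :
    Ad (HTensor.comm E F) (HTensor.map a b) = HTensor.map b a := by
  have hs : ∀ (x : E) (y : F), (HTensor.comm E F).symm (y ⊗ᵥ x) = x ⊗ᵥ y := fun x y => by
    rw [LinearIsometryEquiv.symm_apply_eq]; simp
  refine ext_clm fun x y => ?_
  simp [hs]

lemma Ad_comm_mem {R : VonNeumannAlgebra E} {S : VonNeumannAlgebra F} {T : E ⊗ʰ F →L[ℂ] E ⊗ʰ F}
    (hT : T ∈ vnTensor R S) : Ad (HTensor.comm E F) T ∈ vnTensor S R := by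
  rw [mem_vnTensor_iff] at hT ⊢
  intro Z hZ
  have := hT (Ad (HTensor.comm E F).symm Z) (fun a ha b hb => by
    rw [← Ad_symm_Ad (HTensor.comm E F) (HTensor.map a b), Ad_comm_map, ← map_mul, ← map_mul,
      hZ b hb a ha])
  have := congrArg (Ad (HTensor.comm E F)) this
  simpa only [map_mul, Ad_Ad_symm] using this

/-- Elements of the commutant of `R ⊗ B(K)` are of the form `y ⊗ 1` with `y ∈ R'`. -/
lemma exists_eq_map_of_commute {R : VonNeumannAlgebra G} {Z : G ⊗ʰ K →L[ℂ] G ⊗ʰ K}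
    (hZ : ∀ a ∈ R, ∀ b : K →L[ℂ] K, HTensor.map a b * Z = Z * HTensor.map a b) :
    ∃ y ∈ R.commutant, Z = HTensor.map y 1 := by
  have h : ∀ a ∈ R, ∀ b : K →L[ℂ] K,
      HTensor.map b a * Ad (HTensor.comm G K) Z = Ad (HTensor.comm G K) Z * HTensor.map b a := by
    intro a ha b
    rw [← Ad_comm_map, ← map_mul, ← map_mul, hZ a ha b]
  obtain ⟨e, he⟩ := exists_eq_map_one (Z := Ad (HTensor.comm G K) Z)
    fun a => h 1 (one_mem R) a
  refine ⟨_, slice_commute (R := R) (fun y hy => h y hy 1) e e, ?_⟩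
  have := congrArg (Ad (HTensor.comm G K).symm) he
  rw [Ad_symm_Ad] at this
  refine this.trans ?_
  rw [← Ad_comm_map, Ad_symm_Ad]

/-- `B(H) ⊗ R ⊗ B(K)` on `H ⊗ (G ⊗ K)`. -/
abbrev midVN (H K : Type*) [NormedAddCommGroup H] [InnerProductSpace ℂ H] [CompleteSpace H]
    [NormedAddCommGroup K] [InnerProductSpace ℂ K] [CompleteSpace K] (R : VonNeumannAlgebra G) :
    VonNeumannAlgebra (H ⊗ʰ (G ⊗ʰ K)) :=
  vnTensor (fullVN H) (vnTensor R (fullVN K))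

lemma mem_midVN_iff {R : VonNeumannAlgebra G} {T : E ⊗ʰ (G ⊗ʰ K) →L[ℂ] E ⊗ʰ (G ⊗ʰ K)} :
    T ∈ midVN E K R ↔ ∀ y ∈ R.commutant,
      HTensor.map 1 (HTensor.map y 1) * T = T * HTensor.map 1 (HTensor.map y 1) := by
  rw [mem_full_tensor_iff]
  constructor
  · intro h y hy
    refine h _ (VonNeumannAlgebra.mem_commutant_iff.2 fun g hg => ?_)
    refine ((mem_vnTensor_iff.1 hg) _ fun a ha b _ => ?_).symm
    rw [map_mul_map, map_mul_map, one_mul, mul_one,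
      (VonNeumannAlgebra.mem_commutant_iff.1 hy) a ha]
  · intro h Z hZ
    obtain ⟨y, hy, rfl⟩ := exists_eq_map_of_commute (R := R) (Z := Z) fun a ha b =>
      VonNeumannAlgebra.mem_commutant_iff.1 hZ _ (map_mem_vnTensor ha (mem_fullVN b))
    exact h y hy

variable (E G K) in
/-- The rearrangement of legs `h ⊗ (g ⊗ k) ↦ (k ⊗ h) ⊗ g`. -/
def perm : E ⊗ʰ (G ⊗ʰ K) ≃ₗᵢ[ℂ] (K ⊗ʰ E) ⊗ʰ G :=
  (HTensor.comm E (G ⊗ʰ K)).trans ((HTensor.assoc G K E).trans (HTensor.comm G (K ⊗ʰ E)))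

@[simp] lemma perm_htmul (e : E) (g : G) (k : K) :
    perm E G K (e ⊗ᵥ (g ⊗ᵥ k)) = (k ⊗ᵥ e) ⊗ᵥ g := by
  simp [perm, assoc_htmul]

@[simp] lemma perm_symm_htmul (e : E) (g : G) (k : K) :
    (perm E G K).symm ((k ⊗ᵥ e) ⊗ᵥ g) = e ⊗ᵥ (g ⊗ᵥ k) := by
  rw [LinearIsometryEquiv.symm_apply_eq, perm_htmul]

lemma Ad_perm_map (y : G →L[ℂ] G) :
    Ad (perm E G K) (HTensor.map 1 (HTensor.map y 1)) = HTensor.map 1 y :=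
  ext_clm3 fun k e g => by simp

lemma Ad_perm_mem_iff {R : VonNeumannAlgebra G} {T : E ⊗ʰ (G ⊗ʰ K) →L[ℂ] E ⊗ʰ (G ⊗ʰ K)} :
    Ad (perm E G K) T ∈ vnTensor (fullVN (K ⊗ʰ E)) R ↔ T ∈ midVN E K R := by
  rw [mem_midVN_iff, mem_full_tensor_iff]
  refine forall₂_congr fun y _ => ?_
  rw [← Ad_perm_map (E := E) (K := K), ← map_mul, ← map_mul, EmbeddingLike.apply_eq_iff_eq]

/-- Slices along elementary tensors suffice. -/
lemma mem_full_tensor_of_slice {R : VonNeumannAlgebra G}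
    {T : (K ⊗ʰ E) ⊗ʰ G →L[ℂ] (K ⊗ʰ E) ⊗ʰ G}
    (h : ∀ k e k' e', slice (k ⊗ᵥ e) (k' ⊗ᵥ e') T ∈ R) : T ∈ vnTensor (fullVN (K ⊗ʰ E)) R := by
  rw [mem_full_tensor_iff]
  intro y hy
  refine ext_op3 fun k e g k' e' g' => ?_
  rw [← inner_slice, ← inner_slice, slice_map_mul, slice_mul_map,
    (VonNeumannAlgebra.mem_commutant_iff.1 hy) _ (h k e k' e')]

end VNTensor

section CompletelyPositive

set_option linter.unusedSectionVars false

variable {E F G L K : Type*}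
  [NormedAddCommGroup E] [InnerProductSpace ℂ E] [CompleteSpace E]
  [NormedAddCommGroup F] [InnerProductSpace ℂ F] [CompleteSpace F]
  [NormedAddCommGroup G] [InnerProductSpace ℂ G] [CompleteSpace G]
  [NormedAddCommGroup L] [InnerProductSpace ℂ L] [CompleteSpace L]
  [NormedAddCommGroup K] [InnerProductSpace ℂ K] [CompleteSpace K]

open HTensor

instance : SMulMemClass (VonNeumannAlgebra G) ℂ (G →L[ℂ] G) where
  smul_mem {R} c _ hx := R.toStarSubalgebra.smul_mem hx c

lemma isClosed_vn (R : VonNeumannAlgebra G) : IsClosed (R : Set (G →L[ℂ] G)) := by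
  rw [← VonNeumannAlgebra.centralizer_centralizer R]
  exact Set.isClosed_centralizer _

instance (R : VonNeumannAlgebra G) : IsClosed (R : Set (G →L[ℂ] G)) := isClosed_vn R

section Matrix

variable {n : Type*} [Fintype n] [DecidableEq n]

abbrev mleg (G : Type*) [NormedAddCommGroup G] [InnerProductSpace ℂ G] [CompleteSpace G]
    {n : Type*} [Fintype n] [DecidableEq n] (i : n) :
    G →L[ℂ] EuclideanSpace ℂ n ⊗ʰ G := leg (EuclideanSpace.basisFun n ℂ i)

lemma adjoint_mleg_mleg (i j : n) :
    ContinuousLinearMap.adjoint (mleg G i) ∘L mleg G j = if i = j then 1 else 0 := by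
  ext g
  apply ext_inner_left ℂ
  intro g'
  rw [ContinuousLinearMap.comp_apply, ContinuousLinearMap.adjoint_inner_right, leg_apply, leg_apply,
    inner_htmul, (EuclideanSpace.basisFun n ℂ).inner_eq_ite]
  split_ifs <;> simp

lemma adjoint_leg_htmul (v e : E) (f : F) :
    ContinuousLinearMap.adjoint (leg v) (e ⊗ᵥ f) = inner ℂ v e • f := by
  apply ext_inner_left ℂ
  intro f'
  rw [ContinuousLinearMap.adjoint_inner_right, leg_apply, inner_htmul, inner_smul_right]

lemma sum_mleg (x : EuclideanSpace ℂ n ⊗ʰ G) :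
    ∑ i : n, mleg G i (ContinuousLinearMap.adjoint (mleg G i) x) = x := by
  have : ∑ i : n, mleg G i ∘L ContinuousLinearMap.adjoint (mleg G i) = 1 := by
    refine ext_clm fun e f => ?_
    have := (EuclideanSpace.basisFun n ℂ).sum_repr' e
    simp only [sum_apply, ContinuousLinearMap.comp_apply, adjoint_leg_htmul, map_smul, leg_apply]
    conv_rhs => rw [← this, one_apply_eq_self, ← leg_apply]
    simp only [map_sum, map_smul, sum_apply, smul_apply, leg_apply]
  simpa using congrArg (fun T => T x) this

lemma adjoint_mleg_sum (j : n) (y : n → G) :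
    ContinuousLinearMap.adjoint (mleg G j) (∑ i, mleg G i (y i)) = y j := by
  have : ∀ i, ContinuousLinearMap.adjoint (mleg G j) (mleg G i (y i)) = if j = i then y i else 0 := by
    intro i
    rw [← ContinuousLinearMap.comp_apply, adjoint_mleg_mleg]
    split_ifs <;> simp
  simp [map_sum, this]

/-- The `(i,j)` matrix entry of an operator in `M_n(R)`. -/
def entry {R : VonNeumannAlgebra G} (i j : n) (T : vnTensor (fullVN (EuclideanSpace ℂ n)) R) : R :=
  ⟨slice (EuclideanSpace.basisFun n ℂ j) (EuclideanSpace.basisFun n ℂ i) T.1,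
      mem_full_tensor_iff_slice.1 T.2 _ _⟩

lemma entry_add {R : VonNeumannAlgebra G} (i j : n)
    (S T : vnTensor (fullVN (EuclideanSpace ℂ n)) R) :
    entry i j (S + T) = entry i j S + entry i j T := Subtype.ext (slice_add ..)

lemma entry_star {R : VonNeumannAlgebra G} (i j : n)
    (T : vnTensor (fullVN (EuclideanSpace ℂ n)) R) :
    entry i j (star T) = star (entry j i T) := Subtype.ext (slice_star ..)

lemma entry_mul {R : VonNeumannAlgebra G} (i j : n)
    (S T : vnTensor (fullVN (EuclideanSpace ℂ n)) R) :
    entry i j (S * T) = ∑ k, entry i k S * entry k j T := by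
  apply Subtype.ext
  rw [AddSubmonoidClass.coe_finsetSum]
  ext x
  rw [sum_apply]
  change ContinuousLinearMap.adjoint (mleg G i) (S.1 (T.1 (mleg G j x))) = _
  conv_lhs => rw [← sum_mleg (T.1 (mleg G j x)), map_sum, map_sum]
  rfl

lemma entry_algebraMap {R : VonNeumannAlgebra G} (i j : n) (c : ℂ) :
    entry i j (algebraMap ℂ (vnTensor (fullVN (EuclideanSpace ℂ n)) R) c)
      = if i = j then algebraMap ℂ R c else 0 := by
  apply Subtype.ext
  change slice _ _ (algebraMap ℂ (EuclideanSpace ℂ n ⊗ʰ G →L[ℂ] EuclideanSpace ℂ n ⊗ʰ G) c) = _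
  rw [Algebra.algebraMap_eq_smul_one, slice_smul, ← map_one_one, slice_map, one_apply_eq_self,
    (EuclideanSpace.basisFun n ℂ).inner_eq_ite]
  split_ifs with h
  · rw [one_smul]
    change _ = algebraMap ℂ (G →L[ℂ] G) c
    rw [Algebra.algebraMap_eq_smul_one]
  · simp

/-- The amplification of `φ` to matrices. -/
def matAmp {R : VonNeumannAlgebra G} (φ : R →⋆ₐ[ℂ] (L →L[ℂ] L)) :
    vnTensor (fullVN (EuclideanSpace ℂ n)) R →⋆ₐ[ℂ]
      (EuclideanSpace ℂ n ⊗ʰ L →L[ℂ] EuclideanSpace ℂ n ⊗ʰ L) :=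
  have hcomm : ∀ c : ℂ, ∑ i : n, mleg L i ∘L ∑ j : n,
      φ (entry i j (algebraMap ℂ (vnTensor (fullVN (EuclideanSpace ℂ n)) R) c)) ∘L
        ContinuousLinearMap.adjoint (mleg L j) = algebraMap ℂ _ c := by
    intro c
    simp only [entry_algebraMap]
    ext x
    rw [sum_apply, show (algebraMap ℂ (EuclideanSpace ℂ n ⊗ʰ L →L[ℂ] EuclideanSpace ℂ n ⊗ʰ L) c) x
      = c • x by rw [Algebra.algebraMap_eq_smul_one]; rfl]
    conv_rhs => rw [← sum_mleg x, Finset.smul_sum]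
    refine Finset.sum_congr rfl fun i _ => ?_
    rw [ContinuousLinearMap.comp_apply, sum_apply, Finset.sum_eq_single i]
    · simp [Algebra.algebraMap_eq_smul_one]
    · intro j _ hj
      simp [hj.symm]
    · simp
  have hmul : ∀ S T : vnTensor (fullVN (EuclideanSpace ℂ n)) R, ∑ i : n, mleg L i ∘L ∑ j : n,
      φ (entry i j (S * T)) ∘L ContinuousLinearMap.adjoint (mleg L j) =
      (∑ i : n, mleg L i ∘L ∑ j : n,
        φ (entry i j S) ∘L ContinuousLinearMap.adjoint (mleg L j)) *
      (∑ i : n, mleg L i ∘L ∑ j : n,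
        φ (entry i j T) ∘L ContinuousLinearMap.adjoint (mleg L j)) := by
    intro S T
    ext x
    change _ = (∑ i : n, mleg L i ∘L ∑ j : n,
        φ (entry i j S) ∘L ContinuousLinearMap.adjoint (mleg L j)) 
      ((∑ i : n, mleg L i ∘L ∑ j : n,
        φ (entry i j T) ∘L ContinuousLinearMap.adjoint (mleg L j)) x)
    simp only [sum_apply, ContinuousLinearMap.comp_apply]
    refine Finset.sum_congr rfl fun i _ => ?_
    congr 1
    have : ∀ j : n, (ContinuousLinearMap.adjoint (mleg L j)) (∑ i : n, (mleg L i)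
        (∑ j : n, (φ (entry i j T)) (ContinuousLinearMap.adjoint (mleg L j) x)))
        = ∑ k : n, (φ (entry j k T)) (ContinuousLinearMap.adjoint (mleg L k) x) :=
      fun j => adjoint_mleg_sum j _
    simp only [this]
    simp only [entry_mul, map_sum, map_mul, sum_apply]
    rw [Finset.sum_comm]
    rfl
  { toFun := fun T => ∑ i : n, mleg L i ∘L ∑ j : n,
      φ (entry i j T) ∘L ContinuousLinearMap.adjoint (mleg L j)
    map_one' := by simpa using hcomm 1
    map_mul' := hmul
    map_zero' := by simpa using hcomm 0
    map_add' := fun S T => by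
      ext x
      simp [entry_add, Finset.sum_add_distrib]
    commutes' := hcomm
    map_star' := fun T => by
      refine ContinuousLinearMap.ext fun x => ext_inner_left ℂ fun y => ?_
      rw [ContinuousLinearMap.star_eq_adjoint, ContinuousLinearMap.adjoint_inner_right]
      simp only [sum_apply, ContinuousLinearMap.comp_apply, entry_star, map_star, inner_sum, sum_inner,
        map_sum, ← ContinuousLinearMap.adjoint_inner_left (mleg L _)]
      simp only [← ContinuousLinearMap.adjoint_inner_right (mleg L _)]
      rw [Finset.sum_comm]
      refine Finset.sum_congr rfl fun i _ => Finset.sum_congr rfl fun j _ => ?_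
      rw [ContinuousLinearMap.star_eq_adjoint, ContinuousLinearMap.adjoint_inner_right] }

/-- A `*`-homomorphism on a von Neumann algebra is completely positive. -/
lemma cp {R : VonNeumannAlgebra G} (φ : R →⋆ₐ[ℂ] (L →L[ℂ] L)) (A : n → n → R)
    (hA : ∀ ξ : n → G, 0 ≤ ∑ i, ∑ j, inner ℂ (ξ i) ((A i j : G →L[ℂ] G) (ξ j))) (η : n → L) :
    0 ≤ ∑ i, ∑ j, inner ℂ (η i) (φ (A i j) (η j)) := by
  let T0 : EuclideanSpace ℂ n ⊗ʰ G →L[ℂ] EuclideanSpace ℂ n ⊗ʰ G := ∑ i : n, mleg G i ∘L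
    ∑ j : n, (A i j : G →L[ℂ] G) ∘L ContinuousLinearMap.adjoint (mleg G j)
  have hT0 : T0 ∈ vnTensor (fullVN (EuclideanSpace ℂ n)) R := by
    rw [mem_full_tensor_iff_slice]
    intro v w
    have : slice v w T0 = ∑ i, ∑ j,
        (inner ℂ w (EuclideanSpace.basisFun n ℂ i) * inner ℂ (EuclideanSpace.basisFun n ℂ j) v) •
          (A i j : G →L[ℂ] G) := by
      refine ContinuousLinearMap.ext fun x => ext_inner_left ℂ fun y => ?_
      rw [inner_slice]
      simp only [T0, sum_apply, ContinuousLinearMap.comp_apply, inner_sum, map_sum, smul_apply,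
        adjoint_leg_htmul, map_smul, inner_smul_right, leg_apply, inner_htmul]
      refine Finset.sum_congr rfl fun i _ => Finset.sum_congr rfl fun j _ => ?_
      ring
    rw [this]
    exact sum_mem fun i _ => sum_mem fun j _ => SMulMemClass.smul_mem _ (A i j).2
  let T : vnTensor (fullVN (EuclideanSpace ℂ n)) R := ⟨T0, hT0⟩
  have hentry : ∀ i j, entry i j T = A i j := by
    intro i j
    apply Subtype.ext
    ext x
    change ContinuousLinearMap.adjoint (mleg G i) (T0 (mleg G j x)) = _
    simp only [T0, sum_apply, ContinuousLinearMap.comp_apply]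
    rw [adjoint_mleg_sum i (fun i => ∑ j', (A i j' : G →L[ℂ] G)
      (ContinuousLinearMap.adjoint (mleg G j') (mleg G j x))), Finset.sum_eq_single j]
    · rw [← ContinuousLinearMap.comp_apply (ContinuousLinearMap.adjoint _), adjoint_mleg_mleg]
      simp
    · intro k _ hk
      rw [← ContinuousLinearMap.comp_apply (ContinuousLinearMap.adjoint _), adjoint_mleg_mleg]
      simp [hk]
    · simp
  have hquad : ∀ (ψ : R →⋆ₐ[ℂ] (L →L[ℂ] L)) (x : EuclideanSpace ℂ n ⊗ʰ L),
      inner ℂ x (matAmp ψ T x) = ∑ i, ∑ j, inner ℂ (ContinuousLinearMap.adjoint (mleg L i) x)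
        (ψ (A i j) (ContinuousLinearMap.adjoint (mleg L j) x)) := by
    intro ψ x
    change inner ℂ x ((∑ i : n, mleg L i ∘L ∑ j : n,
      ψ (entry i j T) ∘L ContinuousLinearMap.adjoint (mleg L j)) x) = _
    simp only [sum_apply, ContinuousLinearMap.comp_apply, inner_sum, map_sum, hentry,
      ContinuousLinearMap.adjoint_inner_left]
  have hpos : 0 ≤ T0 := by
    rw [ContinuousLinearMap.nonneg_iff_isPositive, ContinuousLinearMap.isPositive_iff_complex]
    intro x
    have h : 0 ≤ inner ℂ x (T0 x) := by
      have := hA fun i => ContinuousLinearMap.adjoint (mleg G i) x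
      simpa only [T0, sum_apply, ContinuousLinearMap.comp_apply, inner_sum, map_sum,
        ContinuousLinearMap.adjoint_inner_left] using this
    have h' : 0 ≤ inner ℂ (T0 x) x := by
      rw [← inner_conj_symm]
      exact star_nonneg_iff.2 h
    rw [Complex.nonneg_iff] at h'
    exact ⟨Complex.ext rfl (by simpa using h'.2), h'.1⟩
  have hsa : IsSelfAdjoint T := Subtype.ext (IsSelfAdjoint.of_nonneg hpos).star_eq
  have hnorm : ‖algebraMap ℂ (vnTensor (fullVN (EuclideanSpace ℂ n)) R) (‖T0‖ : ℂ) - T‖ ≤ ‖T0‖ := by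
    change ‖algebraMap ℂ (EuclideanSpace ℂ n ⊗ʰ G →L[ℂ] EuclideanSpace ℂ n ⊗ʰ G) (‖T0‖ : ℂ) - T0‖ ≤ _
    have h0 : algebraMap ℂ (EuclideanSpace ℂ n ⊗ʰ G →L[ℂ] EuclideanSpace ℂ n ⊗ʰ G) (‖T0‖ : ℂ)
        = algebraMap ℝ (EuclideanSpace ℂ n ⊗ʰ G →L[ℂ] EuclideanSpace ℂ n ⊗ʰ G) ‖T0‖ := by
      rw [Algebra.algebraMap_eq_smul_one, Algebra.algebraMap_eq_smul_one]
      rfl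
    rw [h0, CStarAlgebra.norm_le_iff_le_algebraMap _ (norm_nonneg _)
      (sub_nonneg.2 (IsSelfAdjoint.of_nonneg hpos).le_algebraMap_norm_self)]
    exact sub_le_self _ hpos
  have h1 := (NonUnitalStarAlgHom.norm_apply_le (matAmp φ) _).trans hnorm
  rw [map_sub, AlgHomClass.commutes] at h1
  have hx : ∀ x : EuclideanSpace ℂ n ⊗ʰ L, 0 ≤ inner ℂ x (matAmp φ T x) := by
    intro x
    have h2 : IsSelfAdjoint (matAmp φ T) := hsa.map _
    have h3 : ‖(‖T0‖ : ℂ) • x - matAmp φ T x‖ ≤ ‖T0‖ * ‖x‖ := by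
      have := ContinuousLinearMap.le_of_opNorm_le _ h1 x
      rwa [Algebra.algebraMap_eq_smul_one] at this
    have h4 := (re_inner_le_norm (𝕜 := ℂ) x ((‖T0‖ : ℂ) • x - matAmp φ T x)).trans
      (mul_le_mul_of_nonneg_left h3 (norm_nonneg x))
    rw [inner_sub_right, inner_smul_right, inner_self_eq_norm_sq_to_K, map_sub] at h4
    have h5 : (inner ℂ x (matAmp φ T x)).im = 0 := by
      have := ContinuousLinearMap.adjoint_inner_right (matAmp φ T) x x
      rw [← ContinuousLinearMap.star_eq_adjoint, h2.star_eq, ← inner_conj_symm] at this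
      exact Complex.conj_eq_iff_im.1 (by rw [inner_conj_symm, ← this, inner_conj_symm])
    rw [Complex.nonneg_iff]
    refine ⟨?_, h5.symm⟩
    have h6 : RCLike.re ((‖T0‖ : ℂ) * ((‖x‖ : ℂ)) ^ 2) = ‖T0‖ * ‖x‖ ^ 2 := by
      norm_cast
    have h7 : RCLike.re ((‖T0‖ : ℂ) * ((‖x‖ : ℂ)) ^ 2) - (inner ℂ x (matAmp φ T x)).re
      ≤ ‖x‖ * (‖T0‖ * ‖x‖) := h4
    rw [h6] at h7
    nlinarith
  have := hx (∑ i, mleg L i (η i))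
  rw [hquad] at this
  simpa only [adjoint_mleg_sum] using this

end Matrix
end CompletelyPositive

section Amplification

set_option linter.unusedSectionVars false

variable {E F G L K : Type*}
  [NormedAddCommGroup E] [InnerProductSpace ℂ E] [CompleteSpace E]
  [NormedAddCommGroup F] [InnerProductSpace ℂ F] [CompleteSpace F]
  [NormedAddCommGroup G] [InnerProductSpace ℂ G] [CompleteSpace G]
  [NormedAddCommGroup L] [InnerProductSpace ℂ L] [CompleteSpace L]
  [NormedAddCommGroup K] [InnerProductSpace ℂ K] [CompleteSpace K]

open HTensor

lemma slice_add_left (v v' w : E) (T : E ⊗ʰ F →L[ℂ] E ⊗ʰ F) :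
    slice (v + v') w T = slice v w T + slice v' w T := by ext; simp [slice]

lemma slice_smul_left (c : ℂ) (v w : E) (T : E ⊗ʰ F →L[ℂ] E ⊗ʰ F) :
    slice (c • v) w T = c • slice v w T := by ext; simp [slice]

lemma slice_add_right (v w w' : E) (T : E ⊗ʰ F →L[ℂ] E ⊗ʰ F) :
    slice v (w + w') T = slice v w T + slice v w' T := by ext; simp [slice]

lemma slice_smul_right (c : ℂ) (v w : E) (T : E ⊗ʰ F →L[ℂ] E ⊗ʰ F) :
    slice v (c • w) T = starRingEnd ℂ c • slice v w T := by
  ext f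
  simp [slice, map_smulₛₗ]

/-- The slice `(ω_{v,w} ⊗ ι)(T)` of `T ∈ B(E) ⊗ R`, as an element of `R`. -/
def sliceIn {R : VonNeumannAlgebra G} (v w : E) (T : vnTensor (fullVN E) R) : R :=
  ⟨slice v w T.1, mem_full_tensor_iff_slice.1 T.2 v w⟩

/-- The sesquilinear form on `E ⊙ L` of the amplification of `φ` evaluated at `T`. -/
def ampForm {R : VonNeumannAlgebra G} (φ : R →⋆ₐ[ℂ] (L →L[ℂ] L)) (T : vnTensor (fullVN E) R) :
    E ⊗[ℂ] L →ₗ⋆[ℂ] E ⊗[ℂ] L →ₗ[ℂ] ℂ :=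
  have h1 : ∀ v v' w, sliceIn (v + v') w T = sliceIn v w T + sliceIn v' w T :=
    fun _ _ _ => Subtype.ext (slice_add_left ..)
  have h2 : ∀ (c : ℂ) v w, sliceIn (c • v) w T = c • sliceIn v w T :=
    fun _ _ _ => Subtype.ext (slice_smul_left ..)
  have h3 : ∀ v w w', sliceIn v (w + w') T = sliceIn v w T + sliceIn v w' T :=
    fun _ _ _ => Subtype.ext (slice_add_right ..)
  have h4 : ∀ (c : ℂ) v w, sliceIn v (c • w) T = starRingEnd ℂ c • sliceIn v w T :=
    fun _ _ _ => Subtype.ext (slice_smul_right ..)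
  TensorProduct.lift (LinearMap.mk₂'ₛₗ (starRingEnd ℂ) (starRingEnd ℂ)
    (fun (e' : E) (l' : L) => TensorProduct.lift (LinearMap.mk₂ ℂ
      (fun (e : E) (l : L) => inner ℂ l' (φ (sliceIn e e' T) l))
      (fun _ _ _ => by simp [h1])
      (fun _ _ _ => by simp [h2])
      (fun _ _ _ => by simp)
      (fun _ _ _ => by simp)))
    (fun _ _ _ => TensorProduct.ext' fun _ _ => by simp [h3])
    (fun _ _ _ => TensorProduct.ext' fun _ _ => by simp [h4])
    (fun _ _ _ => TensorProduct.ext' fun _ _ => by simp)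
    (fun _ _ _ => TensorProduct.ext' fun _ _ => by simp [mul_comm]))

lemma ampForm_tmul {R : VonNeumannAlgebra G} (φ : R →⋆ₐ[ℂ] (L →L[ℂ] L))
    (T : vnTensor (fullVN E) R) (e e' : E) (l l' : L) :
    ampForm φ T (e' ⊗ₜ l') (e ⊗ₜ l) = inner ℂ l' (φ (sliceIn e e' T) l) := by
  simp [ampForm]

/-- The inclusion `R → B(G)`. -/
def VNincl (R : VonNeumannAlgebra G) : R →⋆ₐ[ℂ] (G →L[ℂ] G) where
  toFun x := x.1
  map_one' := rfl
  map_mul' _ _ := rfl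
  map_zero' := rfl
  map_add' _ _ := rfl
  commutes' _ := rfl
  map_star' _ := rfl

lemma ampForm_incl {R : VonNeumannAlgebra G} (T : vnTensor (fullVN E) R) (y x : E ⊗[ℂ] G) :
    ampForm (VNincl R) T y x = inner ℂ (ι y) (T.1 (ι x)) := by
  induction y with
  | zero => simp
  | add y y' hy hy' => simp only [map_add, LinearMap.add_apply, hy, hy', inner_add_left]
  | tmul e' f' =>
    induction x with
    | zero => simp
    | add x x' hx hx' => simp only [map_add, hx, hx', inner_add_right]
    | tmul e f =>
      rw [ampForm_tmul]
      exact inner_slice e e' T.1 f f'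

/-- The block matrix with diagonal blocks Gram matrices and off-diagonal blocks slices. -/
def blockMat {R : VonNeumannAlgebra G} (T : vnTensor (fullVN E) R) {m n : Type*}
    (e : m → E) (f : n → E) : m ⊕ n → m ⊕ n → R
  | .inl i, .inl j => ((‖T‖ : ℂ) * inner ℂ (e i) (e j)) • 1
  | .inr i, .inr j => ((‖T‖ : ℂ) * inner ℂ (f i) (f j)) • 1
  | .inr i, .inl j => sliceIn (e j) (f i) T
  | .inl i, .inr j => sliceIn (f j) (e i) (star T)

lemma blockMat_sum {R : VonNeumannAlgebra G} (φ : R →⋆ₐ[ℂ] (L →L[ℂ] L))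
    (T : vnTensor (fullVN E) R) {m n : Type*} [Fintype m] [Fintype n]
    (e : m → E) (f : n → E) (η : m ⊕ n → L) :
    ∑ i, ∑ j, inner ℂ (η i) (φ (blockMat T e f i j) (η j)) =
      (‖T‖ : ℂ) * (‖∑ i, e i ⊗ₜ[ℂ] η (.inl i)‖ : ℂ) ^ 2
      + (‖T‖ : ℂ) * (‖∑ i, f i ⊗ₜ[ℂ] η (.inr i)‖ : ℂ) ^ 2
      + (ampForm φ T (∑ i, f i ⊗ₜ[ℂ] η (.inr i)) (∑ i, e i ⊗ₜ[ℂ] η (.inl i))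
      + ampForm φ (star T) (∑ i, e i ⊗ₜ[ℂ] η (.inl i)) (∑ i, f i ⊗ₜ[ℂ] η (.inr i))) := by
  have hn : ∀ z : E ⊗[ℂ] L, ((‖z‖ : ℂ)) ^ 2 = inner ℂ z z := fun z =>
    (inner_self_eq_norm_sq_to_K z).symm
  simp only [Fintype.sum_sum_type, blockMat, hn, map_sum, LinearMap.sum_apply, ampForm_tmul,
    sum_inner, inner_sum, TensorProduct.inner_tmul, Finset.mul_sum, Finset.sum_add_distrib]
  simp only [map_smul, map_one, smul_apply, one_apply_eq_self, inner_smul_right, mul_assoc]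
  have key : ∀ a b c d a' b' c' d' : ℂ, a = a' → b = b' → c = c' → d = d' →
      a + b + (c + d) = a' + d' + (b' + c') := by
    rintro a b c d _ _ _ _ rfl rfl rfl rfl
    ring
  exact key _ _ _ _ _ _ _ _ Finset.sum_comm Finset.sum_comm Finset.sum_comm Finset.sum_comm

lemma ampForm_star {R : VonNeumannAlgebra G} (φ : R →⋆ₐ[ℂ] (L →L[ℂ] L))
    (T : vnTensor (fullVN E) R) (y x : E ⊗[ℂ] L) :
    ampForm φ (star T) x y = starRingEnd ℂ (ampForm φ T y x) := by
  induction y with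
  | zero => simp
  | add y y' hy hy' => simp only [map_add, LinearMap.add_apply, hy, hy']
  | tmul e' f' =>
    induction x with
    | zero => simp
    | add x x' hx hx' => simp only [map_add, LinearMap.add_apply, hx, hx']
    | tmul e f =>
      have : sliceIn e' e (star T) = star (sliceIn e e' T) := Subtype.ext (slice_star ..)
      rw [ampForm_tmul, ampForm_tmul, this, map_star, ContinuousLinearMap.star_eq_adjoint,
        ContinuousLinearMap.adjoint_inner_right, inner_conj_symm]

lemma ampForm_pos {R : VonNeumannAlgebra G} (φ : R →⋆ₐ[ℂ] (L →L[ℂ] L))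
    (T : vnTensor (fullVN E) R) (y x : E ⊗[ℂ] L) :
    0 ≤ ‖T‖ * ‖x‖ ^ 2 + ‖T‖ * ‖y‖ ^ 2 + 2 * (ampForm φ T y x).re := by
  classical
  obtain ⟨s, rfl⟩ := TensorProduct.exists_finset x
  obtain ⟨t, rfl⟩ := TensorProduct.exists_finset y
  have h := cp φ (blockMat T (fun i : s => i.1.1) (fun i : t => i.1.1)) (by
    intro ξ
    have := blockMat_sum (VNincl R) T (fun i : s => i.1.1) (fun i : t => i.1.1) ξ
    change ∑ i, ∑ j, inner ℂ (ξ i) ((blockMat T (fun i : s => i.1.1) (fun i : t => i.1.1) i j).1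
      (ξ j)) = _ at this
    rw [this, ampForm_star]
    set X := ∑ i : s, i.1.1 ⊗ₜ[ℂ] ξ (.inl i)
    set Y := ∑ i : t, i.1.1 ⊗ₜ[ℂ] ξ (.inr i)
    rw [ampForm_incl, Complex.add_conj]
    have h1 : ‖(inner ℂ (ι Y) (T.1 (ι X)) : ℂ)‖ ≤ ‖Y‖ * (‖T‖ * ‖X‖) := by
      refine (norm_inner_le_norm _ _).trans ?_
      rw [ι.norm_map]
      refine mul_le_mul_of_nonneg_left ?_ (norm_nonneg _)
      refine (T.1.le_opNorm _).trans ?_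
      rw [ι.norm_map]
      rfl
    have h2 := (abs_le.1 ((Complex.abs_re_le_norm _).trans h1)).1
    norm_cast
    nlinarith [mul_nonneg (norm_nonneg T) (sq_nonneg (‖X‖ - ‖Y‖))])
    (Sum.elim (fun i => i.1.2) (fun i => i.1.2))
  rw [blockMat_sum, ampForm_star, Complex.add_conj] at h
  simp only [Sum.elim_inl, Sum.elim_inr] at h
  rw [Finset.sum_coe_sort s (fun i => i.1 ⊗ₜ[ℂ] i.2),
    Finset.sum_coe_sort t (fun i => i.1 ⊗ₜ[ℂ] i.2)] at h
  exact_mod_cast h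

lemma ampForm_bound {R : VonNeumannAlgebra G} (φ : R →⋆ₐ[ℂ] (L →L[ℂ] L))
    (T : vnTensor (fullVN E) R) (y x : E ⊗[ℂ] L) :
    ‖ampForm φ T y x‖ ≤ ‖T‖ * ‖y‖ * ‖x‖ := by
  set w := ampForm φ T y x
  obtain ⟨u, hu, huw⟩ : ∃ u : ℂ, ‖u‖ = 1 ∧ u * w = -(‖w‖ : ℂ) := by
    by_cases hw : w = 0
    · exact ⟨1, by simp, by simp [hw]⟩
    · have hw' : (‖w‖ : ℂ) ≠ 0 := by simpa using hw
      refine ⟨-(starRingEnd ℂ w / ‖w‖), by simp [hw], ?_⟩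
      field_simp
      rw [mul_comm, Complex.mul_conj']
  have h : ∀ t : ℝ, 0 ≤ (‖T‖ * ‖x‖ ^ 2) * (t * t) + (-2 * ‖w‖) * t + ‖T‖ * ‖y‖ ^ 2 := by
    intro t
    have := ampForm_pos φ T y (((t : ℂ) * u) • x)
    rw [map_smul, norm_smul, norm_mul, hu, smul_eq_mul, mul_assoc (t : ℂ) u, huw] at this
    have e1 : ((t : ℂ) * -(‖w‖ : ℂ)).re = - (t * ‖w‖) := by simp
    rw [e1] at this
    have e2 : (‖(t : ℂ)‖ * 1 * ‖x‖) ^ 2 = t * t * ‖x‖ ^ 2 := by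
      rw [Complex.norm_real, mul_one, mul_pow, Real.norm_eq_abs, sq_abs, sq t]
    rw [e2] at this
    linarith
  have hd := discrim_le_zero h
  rw [discrim] at hd
  refine abs_le_of_sq_le_sq' ?_ (by positivity) |>.2
  nlinarith

/-- Existence of the amplification `(ι ⊗ φ)(T)`. -/
lemma exists_amp {R : VonNeumannAlgebra G} (φ : R →⋆ₐ[ℂ] (L →L[ℂ] L))
    (T : vnTensor (fullVN E) R) :
    ∃ Z : E ⊗ʰ L →L[ℂ] E ⊗ʰ L, ∀ v w, slice v w Z = φ (sliceIn v w T) := by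
  let B : E ⊗[ℂ] L →L⋆[ℂ] E ⊗[ℂ] L →L[ℂ] ℂ :=
    (ampForm φ T).mkContinuous₂ ‖T‖ (ampForm_bound φ T)
  let j : E ⊗[ℂ] L →L[ℂ] E ⊗ʰ L := (ι : E ⊗[ℂ] L →ₗᵢ[ℂ] E ⊗ʰ L).toContinuousLinearMap
  have hj : IsUniformInducing j := (ι : E ⊗[ℂ] L →ₗᵢ[ℂ] E ⊗ʰ L).isometry.isUniformInducing
  have hd : DenseRange j := denseRange_ι
  let B1 : E ⊗ʰ L →L[ℂ] E ⊗[ℂ] L →L⋆[ℂ] ℂ := B.flip.extend j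
  let B2 : E ⊗ʰ L →L⋆[ℂ] E ⊗ʰ L →L[ℂ] ℂ := B1.flip.extend j
  refine ⟨ContinuousLinearMap.adjoint (InnerProductSpace.continuousLinearMapOfBilin B2), ?_⟩
  intro v w
  ext f
  apply ext_inner_left ℂ
  intro f'
  rw [inner_slice, ContinuousLinearMap.adjoint_inner_right,
    InnerProductSpace.continuousLinearMapOfBilin_apply, ← ι_tmul, ← ι_tmul]
  have e1 : B2 (ι (w ⊗ₜ[ℂ] f')) = B1.flip (w ⊗ₜ[ℂ] f') :=
    ContinuousLinearMap.extend_eq _ hd hj _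
  have e2 : B1 (ι (v ⊗ₜ[ℂ] f)) = B.flip (v ⊗ₜ[ℂ] f) :=
    ContinuousLinearMap.extend_eq _ hd hj _
  rw [e1, ContinuousLinearMap.flip_apply, e2, ContinuousLinearMap.flip_apply]
  exact ampForm_tmul φ T v w f f'

end Amplification

section Normality

set_option linter.unusedSectionVars false

variable {E F G L K : Type*}
  [NormedAddCommGroup E] [InnerProductSpace ℂ E] [CompleteSpace E]
  [NormedAddCommGroup F] [InnerProductSpace ℂ F] [CompleteSpace F]
  [NormedAddCommGroup G] [InnerProductSpace ℂ G] [CompleteSpace G]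
  [NormedAddCommGroup L] [InnerProductSpace ℂ L] [CompleteSpace L]
  [NormedAddCommGroup K] [InnerProductSpace ℂ K] [CompleteSpace K]

open HTensor

/-- A functional on `R` is normal (`σ`-weakly continuous) if it is of the form
`x ↦ ∑ₙ ⟨x ξₙ, ξ'ₙ⟩` with square-summable sequences `ξ`, `ξ'`. -/
def IsNormalFunctional (R : VonNeumannAlgebra G) (ω : R → ℂ) : Prop :=
  ∃ ξ ξ' : ℕ → G, Summable (fun n => ‖ξ n‖ ^ 2) ∧ Summable (fun n => ‖ξ' n‖ ^ 2) ∧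
    ∀ x : R, ω x = ∑' n, inner ℂ (ξ' n) (x.1 (ξ n))

/-- A unital normal `*`-homomorphism between von Neumann algebras. -/
structure NormalHom (R : VonNeumannAlgebra G) (S : VonNeumannAlgebra L) where
  toHom : R →⋆ₐ[ℂ] S
  normal : ∀ ω : S → ℂ, IsNormalFunctional S ω → IsNormalFunctional R (fun x => ω (toHom x))

/-- A normal homomorphism `R → S ⊆ B(L)` regarded as a representation on `L`. -/
def NormalHom.op {R : VonNeumannAlgebra G} {S : VonNeumannAlgebra L} (π : NormalHom R S) :
    R →⋆ₐ[ℂ] (L →L[ℂ] L) := (VNincl S).comp π.toHom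

lemma NormalHom.op_apply {R : VonNeumannAlgebra G} {S : VonNeumannAlgebra L}
    (π : NormalHom R S) (x : R) : π.op x = (π.toHom x).1 := rfl

lemma NormalHom.exists_vec {R : VonNeumannAlgebra G} {S : VonNeumannAlgebra L}
    (π : NormalHom R S) (η η' : L) :
    ∃ ξ ξ' : ℕ → G, Summable (fun n => ‖ξ n‖ ^ 2) ∧ Summable (fun n => ‖ξ' n‖ ^ 2) ∧
      ∀ x : R, inner ℂ η' (π.op x η) = ∑' n, inner ℂ (ξ' n) (x.1 (ξ n)) := by
  refine π.normal (fun y => inner ℂ η' (y.1 η)) ⟨fun n => if n = 0 then η else 0,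
    fun n => if n = 0 then η' else 0, ?_, ?_, fun x => ?_⟩
  · exact summable_of_ne_finset_zero (s := {0}) fun n hn => by simp_all
  · exact summable_of_ne_finset_zero (s := {0}) fun n hn => by simp_all
  · rw [tsum_eq_single 0 fun n hn => by simp [hn]]
    simp

lemma hasSum_leg {ι' : Type*} (b : HilbertBasis ι' ℂ E) (x : E ⊗ʰ F) :
    HasSum (fun i => leg (b i) (ContinuousLinearMap.adjoint (leg (b i)) x)) x := by
  classical
  have hinner : ∀ i j (f f' : F), inner ℂ (leg (b i) f) (leg (b j) f') =
      if i = j then inner ℂ f f' else (0 : ℂ) := fun i j f f' => by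
    rw [leg_apply, leg_apply, inner_htmul, orthonormal_iff_ite.1 b.orthonormal i j]
    split_ifs <;> simp
  let V : ι' → F →ₗᵢ[ℂ] E ⊗ʰ F := fun i =>
    (leg (b i)).toLinearMap.isometryOfInner fun f f' => by simpa using hinner i i f f'
  have hV : IsHilbertSum ℂ (fun _ : ι' => F) V := by
    refine IsHilbertSum.mk ?_ ?_
    · intro i j hij f f'
      exact (hinner i j f f').trans (by simp [hij])
    · rw [← dense_span (E := E) (F := F)]
      set W := ⨆ i, LinearMap.range (V i).toLinearMap
      refine Submodule.topologicalClosure_minimal _ (Submodule.span_le.2 ?_)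
        W.isClosed_topologicalClosure
      rintro _ ⟨⟨e, f⟩, rfl⟩
      have : (⊤ : Submodule ℂ E) ≤ W.topologicalClosure.comap (leg.flip f).toLinearMap := by
        rw [← b.dense_span]
        refine Submodule.topologicalClosure_minimal _ (Submodule.span_le.2 ?_)
          (W.isClosed_topologicalClosure.preimage (leg.flip f).continuous)
        rintro _ ⟨i, rfl⟩
        exact W.le_topologicalClosure (Submodule.mem_iSup_of_mem i ⟨f, rfl⟩)
      exact this (Submodule.mem_top (x := e))
  have h := hV.hasSum_linearIsometryEquiv_symm (hV.linearIsometryEquiv x)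
  rw [LinearIsometryEquiv.symm_apply_apply] at h
  have hw : ∀ i, ContinuousLinearMap.adjoint (leg (b i)) x = hV.linearIsometryEquiv x i := by
    intro i
    apply ext_inner_left ℂ
    intro f
    rw [ContinuousLinearMap.adjoint_inner_right]
    have h1 := h.mapL (innerSL ℂ (leg (b i) f))
    have h2 : HasSum (fun j => innerSL ℂ (leg (b i) f) (V j (hV.linearIsometryEquiv x j)))
        (inner ℂ f (hV.linearIsometryEquiv x i)) := by
      convert hasSum_ite_eq i (inner ℂ f (hV.linearIsometryEquiv x i)) using 2 with j
      rw [innerSL_apply_apply]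
      refine (hinner i j f _).trans ?_
      by_cases hij : i = j
      · subst hij; simp
      · simp [hij, Ne.symm hij]
    exact h1.unique h2
  simp only [hw]
  exact h

lemma hasSum_inner_leg {ι' : Type*} (b : HilbertBasis ι' ℂ E) (x y : E ⊗ʰ F) :
    HasSum (fun i => inner ℂ (ContinuousLinearMap.adjoint (leg (b i)) x)
      (ContinuousLinearMap.adjoint (leg (b i)) y)) (inner ℂ x y) := by
  have := (hasSum_leg b y).mapL (innerSL ℂ x)
  simpa only [innerSL_apply_apply, ← ContinuousLinearMap.adjoint_inner_left] using this

lemma inner_slice_mul (b v w : E) (S T : E ⊗ʰ F →L[ℂ] E ⊗ʰ F) (ξ ξ' : F) :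
    inner ℂ ξ' ((slice b w S * slice v b T) ξ) =
      inner ℂ (ContinuousLinearMap.adjoint (leg b) (ContinuousLinearMap.adjoint S (w ⊗ᵥ ξ')))
        (ContinuousLinearMap.adjoint (leg b) (T (v ⊗ᵥ ξ))) := by
  change inner ℂ ξ' (slice b w S (slice v b T ξ)) = _
  rw [inner_slice, ContinuousLinearMap.adjoint_inner_left, ContinuousLinearMap.adjoint_inner_left]
  rfl

lemma slice_mul_hasSum {ι' : Type*} (b : HilbertBasis ι' ℂ E) (v w : E)
    (S T : E ⊗ʰ F →L[ℂ] E ⊗ʰ F) (ξ ξ' : F) :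
    HasSum (fun i => inner ℂ ξ' ((slice (b i) w S * slice v (b i) T) ξ))
      (inner ℂ ξ' (slice v w (S * T) ξ)) := by
  have := hasSum_inner_leg b (ContinuousLinearMap.adjoint S (w ⊗ᵥ ξ')) (T (v ⊗ᵥ ξ))
  rw [ContinuousLinearMap.adjoint_inner_left] at this
  rw [inner_slice]
  simp only [inner_slice_mul]
  exact this

lemma sum_leg_le {ι' : Type*} (b : HilbertBasis ι' ℂ E) (x : E ⊗ʰ F) (J : Finset ι') :
    ∑ i ∈ J, ‖ContinuousLinearMap.adjoint (leg (F := F) (b i)) x‖ ^ 2 ≤ ‖x‖ ^ 2 := by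
  have h := Complex.hasSum_re (hasSum_inner_leg b x x)
  have hx : (inner ℂ x x : ℂ).re = ‖x‖ ^ 2 := inner_self_eq_norm_sq (𝕜 := ℂ) x
  have e : ∀ y : F, (inner ℂ y y : ℂ).re = ‖y‖ ^ 2 := fun y => inner_self_eq_norm_sq (𝕜 := ℂ) y
  rw [hx] at h
  refine le_trans (le_of_eq (Finset.sum_congr rfl fun i _ => (e _).symm))
    (sum_le_hasSum J (fun i _ => ?_) h)
  rw [e]
  positivity

lemma slice_mul_partial_le {ι' : Type*} (b : HilbertBasis ι' ℂ E) (v w : E)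
    (S T : E ⊗ʰ F →L[ℂ] E ⊗ʰ F) (ξ ξ' : F) (J : Finset ι') :
    ‖∑ i ∈ J, inner ℂ ξ' ((slice (b i) w S * slice v (b i) T) ξ)‖
      ≤ (‖S‖ * ‖w‖) ^ 2 * ‖ξ'‖ ^ 2 + (‖T‖ * ‖v‖) ^ 2 * ‖ξ‖ ^ 2 := by
  have hn : ∀ (e : E) (f : F), ‖e ⊗ᵥ f‖ = ‖e‖ * ‖f‖ := fun e f => by
    rw [← ι_tmul, LinearIsometry.norm_map, TensorProduct.norm_tmul]
  set a := ContinuousLinearMap.adjoint S (w ⊗ᵥ ξ')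
  set c := T (v ⊗ᵥ ξ)
  have ha : ‖a‖ ≤ ‖S‖ * (‖w‖ * ‖ξ'‖) := by
    rw [← hn, ← LinearIsometryEquiv.norm_map ContinuousLinearMap.adjoint S]
    exact ContinuousLinearMap.le_opNorm _ _
  have hc : ‖c‖ ≤ ‖T‖ * (‖v‖ * ‖ξ‖) := by
    rw [← hn]; exact ContinuousLinearMap.le_opNorm _ _
  have h1 := sum_leg_le b a J
  have h2 := sum_leg_le b c J
  have h3 : ‖∑ i ∈ J, inner ℂ ξ' ((slice (b i) w S * slice v (b i) T) ξ)‖ ≤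
      ∑ i ∈ J, (‖ContinuousLinearMap.adjoint (leg (F := F) (b i)) a‖ ^ 2
        + ‖ContinuousLinearMap.adjoint (leg (F := F) (b i)) c‖ ^ 2) := by
    refine (norm_sum_le _ _).trans (Finset.sum_le_sum fun i _ => ?_)
    rw [inner_slice_mul]
    refine (norm_inner_le_norm _ _).trans ?_
    nlinarith [sq_nonneg (‖ContinuousLinearMap.adjoint (leg (F := F) (b i)) a‖
      - ‖ContinuousLinearMap.adjoint (leg (F := F) (b i)) c‖),
      sq_nonneg (‖ContinuousLinearMap.adjoint (leg (F := F) (b i)) a‖),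
      sq_nonneg (‖ContinuousLinearMap.adjoint (leg (F := F) (b i)) c‖)]
  rw [Finset.sum_add_distrib] at h3
  have h4 : ‖a‖ ^ 2 ≤ (‖S‖ * (‖w‖ * ‖ξ'‖)) ^ 2 := by gcongr
  have h5 : ‖c‖ ^ 2 ≤ (‖T‖ * (‖v‖ * ‖ξ‖)) ^ 2 := by gcongr
  calc _ ≤ _ := h3
    _ ≤ (‖S‖ * (‖w‖ * ‖ξ'‖)) ^ 2 + (‖T‖ * (‖v‖ * ‖ξ‖)) ^ 2 := by linarith
    _ = _ := by ring

/-- The amplification `ι ⊗ φ : B(E) ⊗ R → B(E ⊗ L)` of a `*`-homomorphism `φ : R → B(L)`;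
`(ι ⊗ φ)(T)` is the operator with slices `φ((ω_{v,w} ⊗ ι)(T))`. -/
def amp (E : Type*) [NormedAddCommGroup E] [InnerProductSpace ℂ E] [CompleteSpace E]
    {R : VonNeumannAlgebra G} (φ : R →⋆ₐ[ℂ] (L →L[ℂ] L)) :
    vnTensor (fullVN E) R →ₗ[ℂ] (E ⊗ʰ L →L[ℂ] E ⊗ʰ L) where
  toFun T := Classical.choose (exists_amp φ T)
  map_add' S T := slice_ext fun v w => by
    rw [slice_add, Classical.choose_spec (exists_amp φ S), Classical.choose_spec (exists_amp φ T),
      Classical.choose_spec (exists_amp φ (S + T)), ← map_add]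
    exact congrArg φ (Subtype.ext (slice_add ..))
  map_smul' c T := slice_ext fun v w => by
    rw [RingHom.id_apply, slice_smul, Classical.choose_spec (exists_amp φ T),
      Classical.choose_spec (exists_amp φ (c • T)), ← map_smul]
    exact congrArg φ (Subtype.ext (slice_smul ..))

lemma slice_amp {R : VonNeumannAlgebra G} (φ : R →⋆ₐ[ℂ] (L →L[ℂ] L))
    (T : vnTensor (fullVN E) R) (v w : E) : slice v w (amp E φ T) = φ (sliceIn v w T) :=
  Classical.choose_spec (exists_amp φ T) v w

lemma amp_star {R : VonNeumannAlgebra G} (φ : R →⋆ₐ[ℂ] (L →L[ℂ] L))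
    (T : vnTensor (fullVN E) R) : amp E φ (star T) = star (amp E φ T) :=
  slice_ext fun v w => by
    rw [slice_star, slice_amp, slice_amp, ← map_star]
    exact congrArg φ (Subtype.ext (slice_star ..))

lemma amp_mul {R : VonNeumannAlgebra G} {S' : VonNeumannAlgebra L} (π : NormalHom R S')
    (S T : vnTensor (fullVN E) R) : amp E π.op (S * T) = amp E π.op S * amp E π.op T := by
  obtain ⟨s, b, -⟩ := exists_hilbertBasis ℂ E
  refine slice_ext fun v w => ContinuousLinearMap.ext fun η => ext_inner_left ℂ fun η' => ?_
  obtain ⟨ξ, ξ', hξ, hξ', h⟩ := π.exists_vec η η'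
  have h1 := slice_mul_hasSum b v w (amp E π.op S) (amp E π.op T) η η'
  have h2 : ∀ i, slice (b i) w (amp E π.op S) * slice v (b i) (amp E π.op T)
      = π.op (sliceIn (b i) w S * sliceIn v (b i) T) := fun i => by
    rw [slice_amp, slice_amp, map_mul]
  simp only [h2] at h1
  rw [slice_amp, h]
  refine HasSum.unique ?_ h1
  have hsum : ∀ (x : R), Summable fun n => inner ℂ (ξ' n) (x.1 (ξ n)) := fun x => by
    refine Summable.of_norm_bounded (g := fun n => ‖x‖ ^ 2 * ‖ξ n‖ ^ 2 + ‖ξ' n‖ ^ 2)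
      ((hξ.mul_left _).add hξ') fun n => ?_
    have h1 := x.1.le_opNorm (ξ n)
    have h2 : ‖(inner ℂ (ξ' n) (x.1 (ξ n)) : ℂ)‖ ≤ ‖ξ' n‖ * (‖x‖ * ‖ξ n‖) :=
      (norm_inner_le_norm _ _).trans (mul_le_mul_of_nonneg_left h1 (norm_nonneg _))
    nlinarith [sq_nonneg (‖ξ' n‖ - ‖x‖ * ‖ξ n‖), sq_nonneg (‖ξ' n‖), sq_nonneg (‖x‖ * ‖ξ n‖)]
  have hpart : ∀ J : Finset s, ∑ i ∈ J, inner ℂ η' (π.op (sliceIn (b i) w S * sliceIn v (b i) T) η)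
      = ∑' n, ∑ i ∈ J, inner ℂ (ξ' n) ((slice (b i) w S.1 * slice v (b i) T.1) (ξ n)) := by
    intro J
    have := Summable.tsum_finsetSum (s := J)
      fun i _ => hsum (sliceIn (b i) w S * sliceIn v (b i) T)
    exact (Finset.sum_congr rfl fun i _ => h _).trans this.symm
  unfold HasSum
  simp only [hpart]
  refine tendsto_tsum_of_dominated_convergence
    (bound := fun n => (‖S.1‖ * ‖w‖) ^ 2 * ‖ξ' n‖ ^ 2 + (‖T.1‖ * ‖v‖) ^ 2 * ‖ξ n‖ ^ 2)
    ((hξ'.mul_left _).add (hξ.mul_left _)) (fun n => ?_)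
    (Filter.Eventually.of_forall fun J n => slice_mul_partial_le b v w S.1 T.1 (ξ n) (ξ' n) J)
  exact slice_mul_hasSum b v w S.1 T.1 (ξ n) (ξ' n)


/-- Normal `*`-homomorphisms preserve `B(E) ⊗ -`. -/
lemma amp_mem {R : VonNeumannAlgebra G} {S' : VonNeumannAlgebra L} (π : NormalHom R S')
    (T : vnTensor (fullVN E) R) : amp E π.op T ∈ vnTensor (fullVN E) S' := by
  rw [mem_full_tensor_iff_slice]
  intro v w
  rw [slice_amp]
  exact (π.toHom _).2

end Normality

section FixedPoints

set_option linter.unusedSectionVars false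

variable {E F G L K : Type*}
  [NormedAddCommGroup E] [InnerProductSpace ℂ E] [CompleteSpace E]
  [NormedAddCommGroup F] [InnerProductSpace ℂ F] [CompleteSpace F]
  [NormedAddCommGroup G] [InnerProductSpace ℂ G] [CompleteSpace G]
  [NormedAddCommGroup L] [InnerProductSpace ℂ L] [CompleteSpace L]
  [NormedAddCommGroup K] [InnerProductSpace ℂ K] [CompleteSpace K]

open HTensor

lemma exists_leg_eq (b : HilbertBasis ℕ ℂ E) (ξ : ℕ → G) (hξ : Summable fun n => ‖ξ n‖ ^ 2) :
    ∃ Ξ : E ⊗ʰ G, ∀ n, ContinuousLinearMap.adjoint (leg (b n)) Ξ = ξ n := by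
  have hinner : ∀ i j (f f' : G), inner ℂ (leg (b i) f) (leg (b j) f') =
      if i = j then inner ℂ f f' else (0 : ℂ) := fun i j f f' => by
    rw [leg_apply, leg_apply, inner_htmul, orthonormal_iff_ite.1 b.orthonormal i j]
    split_ifs <;> simp
  let V : ℕ → G →ₗᵢ[ℂ] E ⊗ʰ G := fun i =>
    (leg (b i)).toLinearMap.isometryOfInner fun f f' => by simpa using hinner i i f f'
  have hV : OrthogonalFamily ℂ (fun _ : ℕ => G) V := by
    intro i j hij f f'
    exact (hinner i j f f').trans (by simp [hij])
  have hs : Summable fun n => V n (ξ n) := (hV.summable_iff_norm_sq_summable ξ).2 hξ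
  refine ⟨∑' n, V n (ξ n), fun n => ?_⟩
  have h1 := hs.hasSum.mapL (ContinuousLinearMap.adjoint (leg (F := G) (b n)))
  have h2 : ∀ m, ContinuousLinearMap.adjoint (leg (F := G) (b n)) (V m (ξ m))
      = if m = n then ξ m else 0 := by
    intro m
    change ContinuousLinearMap.adjoint (leg (F := G) (b n)) (b m ⊗ᵥ ξ m) = _
    rw [adjoint_leg_htmul, orthonormal_iff_ite.1 b.orthonormal n m]
    by_cases h : m = n
    · simp [h]
    · simp [h, Ne.symm h]
  simp only [h2] at h1
  refine h1.unique ?_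
  convert hasSum_ite_eq n (ξ n) using 2 with m
  split_ifs with h
  · rw [h]
  · rfl

lemma adjoint_leg_map (e : E) (x : G →L[ℂ] G) (Ξ : E ⊗ʰ G) :
    ContinuousLinearMap.adjoint (leg e) (HTensor.map 1 x Ξ)
      = x (ContinuousLinearMap.adjoint (leg e) Ξ) := by
  have : ContinuousLinearMap.adjoint (leg e) ∘L HTensor.map (1 : E →L[ℂ] E) x
      = x ∘L ContinuousLinearMap.adjoint (leg e) := ext_clm fun u g => by
    simp [adjoint_leg_htmul]
  exact congrArg (fun T => T Ξ) this

lemma map_one_add (y z : G →L[ℂ] G) :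
    HTensor.map (1 : E →L[ℂ] E) (y + z) = HTensor.map 1 y + HTensor.map 1 z :=
  ext_clm fun u g => by
    rw [add_apply, map_htmul, map_htmul, map_htmul, add_apply, htmul_add]

lemma map_one_smul (c : ℂ) (y : G →L[ℂ] G) :
    HTensor.map (1 : E →L[ℂ] E) (c • y) = c • HTensor.map 1 y :=
  ext_clm fun u g => by
    rw [smul_apply, map_htmul, map_htmul, smul_apply, htmul_smul]

lemma star_map_one (y : G →L[ℂ] G) :
    ContinuousLinearMap.adjoint (HTensor.map (1 : E →L[ℂ] E) y) = HTensor.map 1 (star y) := by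
  have := star_map (1 : E →L[ℂ] E) y
  rwa [star_one] at this

/-- The map `y ↦ (1 ⊗ y) Ξ`. -/
def evVec (Ξ : E ⊗ʰ G) : (G →L[ℂ] G) →ₗ[ℂ] E ⊗ʰ G where
  toFun y := HTensor.map 1 y Ξ
  map_add' y z := by rw [map_one_add]; rfl
  map_smul' c y := by rw [map_one_smul]; rfl

lemma commute_starProjection (W : Submodule ℂ (E ⊗ʰ G)) [W.HasOrthogonalProjection]
    (s : G →L[ℂ] G) (h1 : ∀ u ∈ W, HTensor.map (1 : E →L[ℂ] E) s u ∈ W)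
    (h2 : ∀ u ∈ W, HTensor.map (1 : E →L[ℂ] E) (star s) u ∈ W) :
    HTensor.map (1 : E →L[ℂ] E) s * W.starProjection
      = W.starProjection * HTensor.map (1 : E →L[ℂ] E) s := by
  refine ContinuousLinearMap.ext fun u => ?_
  symm
  refine Submodule.eq_starProjection_of_mem_of_inner_eq_zero
    (h1 _ (Submodule.starProjection_apply_mem _ _)) fun w hw => ?_
  change inner ℂ (HTensor.map (1 : E →L[ℂ] E) s u
    - HTensor.map (1 : E →L[ℂ] E) s (W.starProjection u)) w = 0
  rw [← map_sub, ← ContinuousLinearMap.adjoint_inner_right, star_map_one]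
  exact Submodule.starProjection_inner_eq_zero _ _ (h2 w hw)

lemma mem_of_bicommutant (A : StarSubalgebra ℂ (G →L[ℂ] G)) (W : Submodule ℂ (E ⊗ʰ G))
    [W.HasOrthogonalProjection]
    (hW : ∀ s ∈ A, ∀ u ∈ W, HTensor.map (1 : E →L[ℂ] E) s u ∈ W)
    {x : G →L[ℂ] G} (hx : x ∈ Set.centralizer (Set.centralizer (A : Set (G →L[ℂ] G))))
    (Ξ : E ⊗ʰ G) (hΞ : Ξ ∈ W) : HTensor.map (1 : E →L[ℂ] E) x Ξ ∈ W := by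
  have hcx : HTensor.map (1 : E →L[ℂ] E) x * W.starProjection
      = W.starProjection * HTensor.map (1 : E →L[ℂ] E) x := by
    refine slice_ext fun v w => ?_
    rw [slice_map_mul, slice_mul_map]
    refine (hx _ fun s hs => ?_).symm
    rw [← slice_map_mul, ← slice_mul_map,
      commute_starProjection W s (hW s hs) (hW _ (star_mem (show s ∈ A from hs)))]
  rw [← Submodule.starProjection_eq_self_iff]
  have h3 : HTensor.map (1 : E →L[ℂ] E) x (W.starProjection Ξ)
      = W.starProjection (HTensor.map (1 : E →L[ℂ] E) x Ξ) :=
    congrArg (fun T : E ⊗ʰ G →L[ℂ] E ⊗ʰ G => T Ξ) hcx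
  rw [← h3, Submodule.starProjection_eq_self_iff.2 hΞ]

lemma mem_closure_of_bicommutant (A : StarSubalgebra ℂ (G →L[ℂ] G)) (W : Submodule ℂ (E ⊗ʰ G))
    (hW : ∀ s ∈ A, ∀ u ∈ W, HTensor.map (1 : E →L[ℂ] E) s u ∈ W)
    {x : G →L[ℂ] G} (hx : x ∈ Set.centralizer (Set.centralizer (A : Set (G →L[ℂ] G))))
    (Ξ : E ⊗ʰ G) (hΞ : Ξ ∈ W) :
    HTensor.map (1 : E →L[ℂ] E) x Ξ ∈ W.topologicalClosure := by
  have : CompleteSpace W.topologicalClosure := W.isClosed_topologicalClosure.completeSpace_coe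
  refine mem_of_bicommutant A W.topologicalClosure (fun s hs u hu => ?_) hx Ξ
    (W.le_topologicalClosure hΞ)
  exact map_mem_closure (HTensor.map (1 : E →L[ℂ] E) s).continuous hu (hW s hs)

lemma evVec_invariant (A : StarSubalgebra ℂ (G →L[ℂ] G)) (Ξ : E ⊗ʰ G) (s : G →L[ℂ] G)
    (hs : s ∈ A) (u : E ⊗ʰ G) (hu : u ∈ (Subalgebra.toSubmodule A.toSubalgebra).map (evVec Ξ)) :
    HTensor.map (1 : E →L[ℂ] E) s u ∈ (Subalgebra.toSubmodule A.toSubalgebra).map (evVec Ξ) := by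
  obtain ⟨t, ht, rfl⟩ := hu
  refine ⟨s * t, A.toSubalgebra.mul_mem hs ht, ?_⟩
  have h3 := map_mul_map (1 : E →L[ℂ] E) 1 s t
  rw [one_mul] at h3
  exact (congrArg (fun T : E ⊗ʰ G →L[ℂ] E ⊗ʰ G => T Ξ) h3).symm

lemma inner_map_one_eq_tsum (b : HilbertBasis ℕ ℂ E) {ξ ξ' : ℕ → G} {Ξ Ξ' : E ⊗ʰ G}
    (hΞ : ∀ n, ContinuousLinearMap.adjoint (leg (b n)) Ξ = ξ n)
    (hΞ' : ∀ n, ContinuousLinearMap.adjoint (leg (b n)) Ξ' = ξ' n) (y : G →L[ℂ] G) :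
    inner ℂ Ξ' (HTensor.map 1 y Ξ) = ∑' n, inner ℂ (ξ' n) (y (ξ n)) := by
  rw [← (hasSum_inner_leg b Ξ' (HTensor.map 1 y Ξ)).tsum_eq]
  simp only [adjoint_leg_map, hΞ, hΞ']

lemma normal_vanish_aux (b : HilbertBasis ℕ ℂ E) (A : StarSubalgebra ℂ (G →L[ℂ] G)) {ξ ξ' : ℕ → G}
    (hξ : Summable fun n => ‖ξ n‖ ^ 2) (hξ' : Summable fun n => ‖ξ' n‖ ^ 2)
    (h : ∀ s ∈ A, ∑' n, inner ℂ (ξ' n) (s (ξ n)) = (0 : ℂ)) {x : G →L[ℂ] G}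
    (hx : x ∈ Set.centralizer (Set.centralizer (A : Set (G →L[ℂ] G)))) :
    ∑' n, inner ℂ (ξ' n) (x (ξ n)) = (0 : ℂ) := by
  obtain ⟨Ξ, hΞ⟩ := exists_leg_eq b ξ hξ
  obtain ⟨Ξ', hΞ'⟩ := exists_leg_eq b ξ' hξ'
  rw [← inner_map_one_eq_tsum b hΞ hΞ']
  have hmem := mem_closure_of_bicommutant A _ (evVec_invariant A Ξ) hx Ξ
    ⟨1, one_mem A, congrArg (fun T : E ⊗ʰ G →L[ℂ] E ⊗ʰ G => T Ξ) map_one_one⟩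
  have h0 := map_mem_closure (innerSL ℂ Ξ').continuous hmem (t := {0}) fun u hu => by
    obtain ⟨t, ht, rfl⟩ := hu
    exact (inner_map_one_eq_tsum b hΞ hΞ' t).trans (h t ht)
  simpa using h0

/-- A normal functional vanishing on a unital `*`-algebra of operators vanishes on its
bicommutant. -/
lemma normal_vanish (A : StarSubalgebra ℂ (G →L[ℂ] G)) {ξ ξ' : ℕ → G}
    (hξ : Summable fun n => ‖ξ n‖ ^ 2) (hξ' : Summable fun n => ‖ξ' n‖ ^ 2)
    (h : ∀ s ∈ A, ∑' n, inner ℂ (ξ' n) (s (ξ n)) = (0 : ℂ)) {x : G →L[ℂ] G}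
    (hx : x ∈ Set.centralizer (Set.centralizer (A : Set (G →L[ℂ] G)))) :
    ∑' n, inner ℂ (ξ' n) (x (ξ n)) = (0 : ℂ) :=
  normal_vanish_aux (default : HilbertBasis ℕ ℂ (lp (fun _ : ℕ => ℂ) 2)) A hξ hξ' h hx

lemma summable_normal {ξ ξ' : ℕ → G}
    (hξ : Summable fun n => ‖ξ n‖ ^ 2) (hξ' : Summable fun n => ‖ξ' n‖ ^ 2) (x : G →L[ℂ] G) :
    Summable fun n => (inner ℂ (ξ' n) (x (ξ n)) : ℂ) := by
  refine Summable.of_norm_bounded (g := fun n => ‖x‖ ^ 2 * ‖ξ n‖ ^ 2 + ‖ξ' n‖ ^ 2)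
    ((hξ.mul_left _).add hξ') fun n => ?_
  have h1 := x.le_opNorm (ξ n)
  have h2 : ‖(inner ℂ (ξ' n) (x (ξ n)) : ℂ)‖ ≤ ‖ξ' n‖ * (‖x‖ * ‖ξ n‖) :=
    (norm_inner_le_norm _ _).trans (mul_le_mul_of_nonneg_left h1 (norm_nonneg _))
  nlinarith [sq_nonneg (‖ξ' n‖ - ‖x‖ * ‖ξ n‖), sq_nonneg (‖ξ' n‖), sq_nonneg (‖x‖ * ‖ξ n‖)]

/-- If a normal functional agrees with `c · ⟨· g, g'⟩` on a unital `*`-algebra, then also on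
its bicommutant. -/
lemma normal_eq (A : StarSubalgebra ℂ (G →L[ℂ] G)) {ξ ξ' : ℕ → G}
    (hξ : Summable fun n => ‖ξ n‖ ^ 2) (hξ' : Summable fun n => ‖ξ' n‖ ^ 2) (c : ℂ) (g g' : G)
    (h : ∀ s ∈ A, ∑' n, inner ℂ (ξ' n) (s (ξ n)) = c * inner ℂ g' (s g)) {x : G →L[ℂ] G}
    (hx : x ∈ Set.centralizer (Set.centralizer (A : Set (G →L[ℂ] G)))) :
    ∑' n, inner ℂ (ξ' n) (x (ξ n)) = c * inner ℂ g' (x g) := by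
  let ζ : ℕ → G := fun n => Nat.casesOn n (-c • g) ξ
  let ζ' : ℕ → G := fun n => Nat.casesOn n g' ξ'
  have hζ : Summable fun n => ‖ζ n‖ ^ 2 := (summable_nat_add_iff 1).1 hξ
  have hζ' : Summable fun n => ‖ζ' n‖ ^ 2 := (summable_nat_add_iff 1).1 hξ'
  have key : ∀ y : G →L[ℂ] G, ∑' n, inner ℂ (ζ' n) (y (ζ n))
      = -(c * inner ℂ g' (y g)) + ∑' n, inner ℂ (ξ' n) (y (ξ n)) := by
    intro y
    rw [(summable_normal hζ hζ' y).tsum_eq_zero_add]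
    congr 1
    change inner ℂ g' (y (-c • g)) = _
    rw [map_smul, inner_smul_right, neg_mul]
  have := normal_vanish A hζ hζ' (fun s hs => by rw [key, h s hs]; ring) hx
  rw [key] at this
  linear_combination this

/-- The `*`-algebra of fixed points of `α : R → R ⊗ S`. -/
def fixedStar {R : VonNeumannAlgebra G} {S : VonNeumannAlgebra L} (α : NormalHom R (vnTensor R S)) :
    StarSubalgebra ℂ (G →L[ℂ] G) where
  carrier := {x | ∃ h : x ∈ R, α.op ⟨x, h⟩ = HTensor.map x 1}
  mul_mem' := by
    rintro x y ⟨hx, hx'⟩ ⟨hy, hy'⟩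
    refine ⟨mul_mem hx hy, ?_⟩
    have := map_mul α.op ⟨x, hx⟩ ⟨y, hy⟩
    rw [hx', hy', map_mul_map, one_mul] at this
    exact this
  one_mem' := ⟨one_mem R, by rw [map_one_one]; exact map_one α.op⟩
  add_mem' := by
    rintro x y ⟨hx, hx'⟩ ⟨hy, hy'⟩
    refine ⟨add_mem hx hy, ?_⟩
    have := map_add α.op ⟨x, hx⟩ ⟨y, hy⟩
    rw [hx', hy'] at this
    exact this.trans (ext_clm fun u v => by simp [add_htmul])
  zero_mem' := ⟨zero_mem R, (map_zero α.op).trans (ext_clm fun u v => by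
    have h0 : (0 : G) ⊗ᵥ v = 0 := by simpa using smul_htmul 0 (0 : G) v
    rw [map_htmul]
    exact h0.symm)⟩
  algebraMap_mem' := fun c => ⟨algebraMap_mem R.toStarSubalgebra c, by
    refine (AlgHomClass.commutes α.op c).trans (ext_clm fun u v => ?_)
    simp [Algebra.algebraMap_eq_smul_one, smul_htmul]⟩
  star_mem' := by
    rintro x ⟨hx, hx'⟩
    refine ⟨star_mem hx, ?_⟩
    have := map_star α.op ⟨x, hx⟩
    rw [hx', star_map, star_one] at this
    exact this

/-- The fixed point algebra `{x ∈ R | α(x) = x ⊗ 1}` of `α : R → R ⊗ S`. -/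
def fixedVN {R : VonNeumannAlgebra G} {S : VonNeumannAlgebra L} (α : NormalHom R (vnTensor R S)) :
    VonNeumannAlgebra G where
  toStarSubalgebra := fixedStar α
  centralizer_centralizer' := by
    refine Set.Subset.antisymm ?_ Set.subset_centralizer_centralizer
    intro x hx
    have hxR : x ∈ R := by
      have : x ∈ Set.centralizer (Set.centralizer (R : Set (G →L[ℂ] G))) :=
        Set.centralizer_subset (Set.centralizer_subset fun y (hy : y ∈ fixedStar α) => hy.1) hx
      rwa [VonNeumannAlgebra.centralizer_centralizer] at this
    refine ⟨hxR, ext_op fun g f g' f' => ?_⟩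
    obtain ⟨ξ, ξ', hξ, hξ', h⟩ := α.exists_vec (g ⊗ᵥ f) (g' ⊗ᵥ f')
    rw [h, normal_eq (fixedStar α) hξ hξ' (inner ℂ f' f) g g' ?_ hx]
    · simp [mul_comm]
    · rintro s ⟨hs, hs'⟩
      rw [← h ⟨s, hs⟩, hs']
      simp [mul_comm]

lemma mem_fixedVN_iff {R : VonNeumannAlgebra G} {S : VonNeumannAlgebra L}
    {α : NormalHom R (vnTensor R S)} {x : G →L[ℂ] G} :
    x ∈ fixedVN α ↔ ∃ h : x ∈ R, α.op ⟨x, h⟩ = HTensor.map x 1 := Iff.rfl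

lemma fixedVN_le {R : VonNeumannAlgebra G} {S : VonNeumannAlgebra L}
    {α : NormalHom R (vnTensor R S)} {x : G →L[ℂ] G} (hx : x ∈ fixedVN α) : x ∈ R := hx.1

end FixedPoints

section Legs

set_option linter.unusedSectionVars false

variable {E F G L K H : Type*}
  [NormedAddCommGroup E] [InnerProductSpace ℂ E] [CompleteSpace E]
  [NormedAddCommGroup F] [InnerProductSpace ℂ F] [CompleteSpace F]
  [NormedAddCommGroup G] [InnerProductSpace ℂ G] [CompleteSpace G]
  [NormedAddCommGroup L] [InnerProductSpace ℂ L] [CompleteSpace L]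
  [NormedAddCommGroup K] [InnerProductSpace ℂ K] [CompleteSpace K]
  [NormedAddCommGroup H] [InnerProductSpace ℂ H] [CompleteSpace H]

open HTensor

lemma vnTensor_mono {R R' : VonNeumannAlgebra E} {S S' : VonNeumannAlgebra F}
    (hR : ∀ x ∈ R, x ∈ R') (hS : ∀ y ∈ S, y ∈ S') {T : E ⊗ʰ F →L[ℂ] E ⊗ʰ F}
    (hT : T ∈ vnTensor R S) : T ∈ vnTensor R' S' :=
  mem_vnTensor_iff.2 fun Z hZ => mem_vnTensor_iff.1 hT Z fun a ha b hb => hZ a (hR a ha) b (hS b hb)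

/-- The operator `(ι ⊗ φ)(T)` for `T ∈ S ⊗ R`. -/
def ampL {R : VonNeumannAlgebra G} {S : VonNeumannAlgebra E} (φ : R →⋆ₐ[ℂ] (L →L[ℂ] L))
    (T : vnTensor S R) : E ⊗ʰ L →L[ℂ] E ⊗ʰ L :=
  amp E φ ⟨T.1, vnTensor_mono (fun _ _ => mem_fullVN _) (fun _ h => h) T.2⟩

/-- The operator `(φ ⊗ ι)(T)` for `T ∈ R ⊗ S`. -/
def ampR {R : VonNeumannAlgebra G} {S : VonNeumannAlgebra E} (φ : R →⋆ₐ[ℂ] (L →L[ℂ] L))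
    (T : vnTensor R S) : L ⊗ʰ E →L[ℂ] L ⊗ʰ E :=
  Ad (HTensor.comm E L) (ampL φ ⟨Ad (HTensor.comm G E) T.1, Ad_comm_mem T.2⟩)

lemma Ad_apply (V : E ≃ₗᵢ[ℂ] F) (T : E →L[ℂ] E) (x : F) : Ad V T x = V (T (V.symm x)) := by simp

lemma Ad_star (V : E ≃ₗᵢ[ℂ] F) (T : E →L[ℂ] E) : Ad V (star T) = star (Ad V T) :=
  (Ad V).map_star' T

lemma Ad_one (V : E ≃ₗᵢ[ℂ] F) : Ad V 1 = 1 :=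
  ContinuousLinearMap.ext fun x => by rw [Ad_apply]; simp

lemma Ad_mul (V : E ≃ₗᵢ[ℂ] F) (S T : E →L[ℂ] E) : Ad V (S * T) = Ad V S * Ad V T :=
  (Ad V).map_mul' S T

lemma Ad_add (V : E ≃ₗᵢ[ℂ] F) (S T : E →L[ℂ] E) : Ad V (S + T) = Ad V S + Ad V T :=
  ContinuousLinearMap.ext fun x => by
    rw [add_apply, Ad_apply, Ad_apply, Ad_apply, add_apply, map_add]

lemma Ad_smul (V : E ≃ₗᵢ[ℂ] F) (c : ℂ) (T : E →L[ℂ] E) : Ad V (c • T) = c • Ad V T :=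
  ContinuousLinearMap.ext fun x => by
    rw [smul_apply, Ad_apply, Ad_apply, smul_apply, map_smul]

lemma Ad_injective (V : E ≃ₗᵢ[ℂ] F) {S T : E →L[ℂ] E} (h : Ad V S = Ad V T) : S = T := by
  rw [← Ad_symm_Ad V S, h, Ad_symm_Ad]

/-- The operator `(ι ⊗ φ ⊗ ι)(T)` for `T ∈ B(H) ⊗ R ⊗ B(K)`. -/
def midAmp {R : VonNeumannAlgebra G} (φ : R →⋆ₐ[ℂ] (L →L[ℂ] L)) :
    midVN H K R →ₗ[ℂ] (H ⊗ʰ (L ⊗ʰ K) →L[ℂ] H ⊗ʰ (L ⊗ʰ K)) where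
  toFun T := Ad (perm H L K).symm
    (amp (K ⊗ʰ H) φ ⟨Ad (perm H G K) T.1, Ad_perm_mem_iff.2 T.2⟩)
  map_add' S T := by
    rw [← Ad_add, ← map_add]
    congr 2
    exact Subtype.ext (Ad_add (perm H G K) S.1 T.1)
  map_smul' c T := by
    rw [RingHom.id_apply, ← Ad_smul, ← map_smul]
    congr 2
    exact Subtype.ext (Ad_smul (perm H G K) c T.1)

lemma Ad_perm_midAmp {R : VonNeumannAlgebra G} (φ : R →⋆ₐ[ℂ] (L →L[ℂ] L)) (T : midVN H K R) :
    Ad (perm H L K) (midAmp φ T)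
      = amp (K ⊗ʰ H) φ ⟨Ad (perm H G K) T.1, Ad_perm_mem_iff.2 T.2⟩ :=
  Ad_Ad_symm _ _

lemma midAmp_star {R : VonNeumannAlgebra G} (φ : R →⋆ₐ[ℂ] (L →L[ℂ] L)) (T : midVN H K R) :
    midAmp φ (star T) = star (midAmp φ T) := by
  apply Ad_injective (perm H L K)
  rw [Ad_star, Ad_perm_midAmp, Ad_perm_midAmp, ← amp_star]
  congr 1
  exact Subtype.ext (Ad_star _ _)

lemma midAmp_mul {R : VonNeumannAlgebra G} {S' : VonNeumannAlgebra L} (π : NormalHom R S')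
    (S T : midVN H K R) : midAmp π.op (S * T) = midAmp π.op S * midAmp π.op T := by
  apply Ad_injective (perm H L K)
  rw [Ad_mul, Ad_perm_midAmp, Ad_perm_midAmp, Ad_perm_midAmp, ← amp_mul]
  congr 1
  exact Subtype.ext (Ad_mul (perm H G K) S.1 T.1)

lemma slice_one (v w : E) : slice v w (1 : E ⊗ʰ F →L[ℂ] E ⊗ʰ F) = (inner ℂ w v : ℂ) • 1 := by
  rw [← map_one_one, slice_map, one_apply_eq_self]

/-- Operators on `H ⊗ (L ⊗ K)` are determined by their slices in the middle leg. -/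
lemma mid_ext {S T : H ⊗ʰ (L ⊗ʰ K) →L[ℂ] H ⊗ʰ (L ⊗ʰ K)}
    (h : ∀ v w, slice v w (Ad (perm H L K) S) = slice v w (Ad (perm H L K) T)) : S = T :=
  Ad_injective (perm H L K) (slice_ext h)

/-- The slice of `T ∈ B(H) ⊗ R ⊗ B(K)` in the middle leg, as an element of `R`. -/
def midSlice {R : VonNeumannAlgebra G} (v w : K ⊗ʰ H) (T : midVN H K R) : R :=
  sliceIn v w ⟨Ad (perm H G K) T.1, Ad_perm_mem_iff.2 T.2⟩

lemma slice_midAmp {R : VonNeumannAlgebra G} (φ : R →⋆ₐ[ℂ] (L →L[ℂ] L)) (T : midVN H K R)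
    (v w : K ⊗ʰ H) :
    slice v w (Ad (perm H L K) (midAmp φ T)) = φ (midSlice v w T) := by
  rw [Ad_perm_midAmp, slice_amp]
  rfl

lemma midAmp_scalar {R : VonNeumannAlgebra G} (φ : R →⋆ₐ[ℂ] (L →L[ℂ] L)) (c : ℂ) :
    midAmp φ (algebraMap ℂ (midVN H K R) c) = algebraMap ℂ _ c := by
  refine mid_ext fun v w => ?_
  have h : midSlice v w (algebraMap ℂ (midVN H K R) c) = algebraMap ℂ R (c * inner ℂ w v) := by
    apply Subtype.ext
    change slice v w (Ad (perm H G K) (algebraMap ℂ (H ⊗ʰ (G ⊗ʰ K) →L[ℂ] H ⊗ʰ (G ⊗ʰ K)) c)) =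
      algebraMap ℂ (G →L[ℂ] G) _
    rw [Algebra.algebraMap_eq_smul_one, Ad_smul, Ad_one, slice_smul, slice_one, smul_smul,
      Algebra.algebraMap_eq_smul_one]
  rw [slice_midAmp, h, AlgHomClass.commutes, Algebra.algebraMap_eq_smul_one,
    Algebra.algebraMap_eq_smul_one, Ad_smul, Ad_one, slice_smul, slice_one, smul_smul]

/-- For normal `π : R → S'`, the map `ι ⊗ π ⊗ ι` as a `*`-homomorphism. -/
def midHom (H K : Type*) [NormedAddCommGroup H] [InnerProductSpace ℂ H] [CompleteSpace H]
    [NormedAddCommGroup K] [InnerProductSpace ℂ K] [CompleteSpace K]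
    {R : VonNeumannAlgebra G} {S' : VonNeumannAlgebra L} (π : NormalHom R S') :
    midVN H K R →⋆ₐ[ℂ] (H ⊗ʰ (L ⊗ʰ K) →L[ℂ] H ⊗ʰ (L ⊗ʰ K)) where
  toFun := midAmp π.op
  map_one' := by simpa using midAmp_scalar (H := H) (K := K) π.op 1
  map_mul' := midAmp_mul π
  map_zero' := map_zero _
  map_add' := map_add _
  commutes' := midAmp_scalar π.op
  map_star' := midAmp_star π.op

/-- `X₁₂₄` for `X` acting on `H ⊗ (G ⊗ K)`, acting on `H ⊗ ((G ⊗ L) ⊗ K)`. -/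
def leg124 (L : Type*) [NormedAddCommGroup L] [InnerProductSpace ℂ L] [CompleteSpace L]
    (X : H ⊗ʰ (G ⊗ʰ K) →L[ℂ] H ⊗ʰ (G ⊗ʰ K)) :
    H ⊗ʰ ((G ⊗ʰ L) ⊗ʰ K) →L[ℂ] H ⊗ʰ ((G ⊗ʰ L) ⊗ʰ K) :=
  Ad (perm H (G ⊗ʰ L) K).symm (Ad (HTensor.assoc (K ⊗ʰ H) G L)
    (HTensor.map (Ad (perm H G K) X) (1 : L →L[ℂ] L)))

/-- `U₃₄` for `U` acting on `L ⊗ K`, acting on `H ⊗ ((G ⊗ L) ⊗ K)`. -/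
def leg34 (H G : Type*) [NormedAddCommGroup H] [InnerProductSpace ℂ H] [CompleteSpace H]
    [NormedAddCommGroup G] [InnerProductSpace ℂ G] [CompleteSpace G]
    (U : L ⊗ʰ K →L[ℂ] L ⊗ʰ K) : H ⊗ʰ ((G ⊗ʰ L) ⊗ʰ K) →L[ℂ] H ⊗ʰ ((G ⊗ʰ L) ⊗ʰ K) :=
  HTensor.map 1 (Ad (HTensor.assoc G L K).symm (HTensor.map 1 U))

lemma map_add_one (S T : E →L[ℂ] E) :
    HTensor.map (S + T) (1 : F →L[ℂ] F) = HTensor.map S 1 + HTensor.map T 1 :=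
  ext_clm fun u g => by
    rw [add_apply, map_htmul, map_htmul, map_htmul, add_apply, add_htmul]

lemma map_smul_one' (c : ℂ) (S : E →L[ℂ] E) :
    HTensor.map (c • S) (1 : F →L[ℂ] F) = c • HTensor.map S 1 :=
  ext_clm fun u g => by
    rw [smul_apply, map_htmul, map_htmul, smul_apply, smul_htmul]

lemma leg124_add (X Y : H ⊗ʰ (G ⊗ʰ K) →L[ℂ] H ⊗ʰ (G ⊗ʰ K)) :
    leg124 L (X + Y) = leg124 L X + leg124 L Y := by
  simp only [leg124, Ad_add, map_add_one]

lemma leg124_smul (c : ℂ) (X : H ⊗ʰ (G ⊗ʰ K) →L[ℂ] H ⊗ʰ (G ⊗ʰ K)) :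
    leg124 L (c • X) = c • leg124 L X := by
  simp only [leg124, Ad_smul, map_smul_one']

lemma leg124_mul (X Y : H ⊗ʰ (G ⊗ʰ K) →L[ℂ] H ⊗ʰ (G ⊗ʰ K)) :
    leg124 L (X * Y) = leg124 L X * leg124 L Y := by
  simp only [leg124, ← Ad_mul, map_mul_map, mul_one]

lemma leg124_star (X : H ⊗ʰ (G ⊗ʰ K) →L[ℂ] H ⊗ʰ (G ⊗ʰ K)) :
    leg124 L (star X) = star (leg124 L X) := by
  simp only [leg124, ← Ad_star, star_map, star_one]

lemma leg34_mul (U V : L ⊗ʰ K →L[ℂ] L ⊗ʰ K) :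
    leg34 H G (U * V) = leg34 H G U * leg34 H G V := by
  simp only [leg34, ← Ad_mul, map_mul_map, mul_one]

lemma leg34_star (U : L ⊗ʰ K →L[ℂ] L ⊗ʰ K) : leg34 H G (star U) = star (leg34 H G U) := by
  simp only [leg34, ← Ad_star, star_map, star_one]

lemma leg34_one : leg34 H G (1 : L ⊗ʰ K →L[ℂ] L ⊗ʰ K) = 1 := by
  simp only [leg34, map_one_one, Ad_one]

lemma slice_assoc_map (v w : E) (T : E ⊗ʰ F →L[ℂ] E ⊗ʰ F) :
    slice v w (Ad (HTensor.assoc E F G) (HTensor.map T (1 : G →L[ℂ] G)))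
      = HTensor.map (slice v w T) 1 := by
  refine ext_op fun f g f' g' => ?_
  have hs : ∀ (x : E) (y : F) (z : G), (HTensor.assoc E F G).symm (x ⊗ᵥ (y ⊗ᵥ z))
      = (x ⊗ᵥ y) ⊗ᵥ z := fun x y z => by
    rw [LinearIsometryEquiv.symm_apply_eq, assoc_htmul]
  rw [inner_slice, Ad_apply, hs, ← assoc_htmul, LinearIsometryEquiv.inner_map_map, map_htmul,
    map_htmul, inner_htmul, inner_htmul, inner_slice]

lemma slice_leg124 (v w : K ⊗ʰ H) (X : H ⊗ʰ (G ⊗ʰ K) →L[ℂ] H ⊗ʰ (G ⊗ʰ K)) :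
    slice v w (Ad (perm H (G ⊗ʰ L) K) (leg124 L X))
      = HTensor.map (slice v w (Ad (perm H G K) X)) 1 := by
  rw [leg124, Ad_Ad_symm, slice_assoc_map]

end Legs

section Weights

variable {G L : Type*}
  [NormedAddCommGroup G] [InnerProductSpace ℂ G] [CompleteSpace G]
  [NormedAddCommGroup L] [InnerProductSpace ℂ L] [CompleteSpace L]

open scoped NNReal ENNReal

/-- A normal semifinite faithful weight on `R`, given as a function that is only used on the
positive part `R₊` (with respect to the Loewner order). Normality is preservation of suprema of
increasing nets; semifiniteness is strong density of the span of `{x ∈ R₊ | φ(x) < ∞}` in `R`. -/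
structure NSFWeight (R : VonNeumannAlgebra G) where
  toFun : (G →L[ℂ] G) → ℝ≥0∞
  map_add' : ∀ x ∈ R, ∀ y ∈ R, 0 ≤ x → 0 ≤ y → toFun (x + y) = toFun x + toFun y
  map_smul' : ∀ (c : ℝ≥0), ∀ x ∈ R, 0 ≤ x → toFun (((c : ℝ) : ℂ) • x) = c * toFun x
  normal' : ∀ D : Set (G →L[ℂ] G), (∀ d ∈ D, d ∈ R ∧ 0 ≤ d) → D.Nonempty →
    DirectedOn (· ≤ ·) D → ∀ x ∈ R, IsLUB D x → toFun x = ⨆ d ∈ D, toFun d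
  faithful' : ∀ x ∈ R, 0 ≤ x → toFun x = 0 → x = 0
  semifinite' : ∀ x ∈ R, ∀ (s : Finset G) (ε : ℝ), 0 < ε →
    ∃ y ∈ Submodule.span ℂ {a : G →L[ℂ] G | a ∈ R ∧ 0 ≤ a ∧ toFun a < ⊤},
      ∀ g ∈ s, ‖(x - y) g‖ < ε

namespace NSFWeight

variable {R : VonNeumannAlgebra G} (φ : NSFWeight R)

lemma mono {x y : G →L[ℂ] G} (hx : x ∈ R) (hy : y ∈ R) (h0 : 0 ≤ x) (h : x ≤ y) :
    φ.toFun x ≤ φ.toFun y := by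
  have := φ.map_add' x hx (y - x) (sub_mem hy hx) h0 (sub_nonneg.2 h)
  rw [add_sub_cancel] at this
  rw [this]
  exact le_self_add

/-- The left ideal `N_φ = {x ∈ R | φ(x* x) < ∞}`. -/
def sqInt : Submodule ℂ (G →L[ℂ] G) where
  carrier := {x | x ∈ R ∧ φ.toFun (star x * x) < ⊤}
  zero_mem' := by
    refine ⟨zero_mem R, ?_⟩
    have := φ.map_smul' 0 0 (zero_mem R) le_rfl
    rw [smul_zero] at this
    rw [mul_zero, this]
    simp
  add_mem' := by
    rintro x y ⟨hx, hx'⟩ ⟨hy, hy'⟩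
    refine ⟨add_mem hx hy, ?_⟩
    have m : ∀ z ∈ R, star z * z ∈ R := fun z hz => mul_mem (star_mem hz) hz
    have e : star (x + y) * (x + y) + star (x - y) * (x - y)
        = (star x * x + star y * y) + (star x * x + star y * y) := by
      rw [star_add, star_sub]
      noncomm_ring
    have h1 := φ.mono (m _ (add_mem hx hy))
      (add_mem (m _ (add_mem hx hy)) (m _ (sub_mem hx hy))) (star_mul_self_nonneg _)
      (le_add_of_nonneg_right (star_mul_self_nonneg (x - y)))
    rw [e] at h1
    have hp := add_nonneg (star_mul_self_nonneg x) (star_mul_self_nonneg y)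
    have hm := add_mem (m x hx) (m y hy)
    rw [φ.map_add' _ hm _ hm hp hp, φ.map_add' _ (m x hx) _ (m y hy) (star_mul_self_nonneg x)
      (star_mul_self_nonneg y)] at h1
    exact h1.trans_lt (by simp [hx', hy'])
  smul_mem' := by
    rintro c x ⟨hx, hx'⟩
    refine ⟨SMulMemClass.smul_mem c hx, ?_⟩
    have e : star (c • x) * (c • x) = (((‖c‖₊ ^ 2 : ℝ≥0) : ℝ) : ℂ) • (star x * x) := by
      rw [star_smul, smul_mul_smul_comm]
      congr 1
      simp [RCLike.conj_mul]
    rw [e, φ.map_smul' _ _ (mul_mem (star_mem hx) hx) (star_mul_self_nonneg x)]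
    exact ENNReal.mul_lt_top ENNReal.coe_lt_top hx'

lemma mul_mem_sqInt {x y : G →L[ℂ] G} (hx : x ∈ R) (hy : y ∈ φ.sqInt) : x * y ∈ φ.sqInt := by
  obtain ⟨hy, hy'⟩ := hy
  refine ⟨mul_mem hx hy, ?_⟩
  have h1 : star (x * y) * (x * y) ≤ (((‖star x * x‖₊ : ℝ≥0) : ℝ) : ℂ) • (star y * y) := by
    have := CStarAlgebra.star_left_conjugate_le_norm_smul (a := y) (b := star x * x)
    rw [star_mul, mul_assoc, ← mul_assoc (star x), ← mul_assoc]
    exact this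
  have m := mul_mem (star_mem hy) hy
  refine (φ.mono (mul_mem (star_mem (mul_mem hx hy)) (mul_mem hx hy)) (SMulMemClass.smul_mem _ m)
    (star_mul_self_nonneg _) h1).trans_lt ?_
  rw [φ.map_smul' _ _ m (star_mul_self_nonneg y)]
  exact ENNReal.mul_lt_top ENNReal.coe_lt_top hy'

/-- `φ(y* x)` for `x, y ∈ N_φ`, the value at `y* x = ¼ ∑ₖ iᵏ (x + iᵏ y)* (x + iᵏ y)` of the linear
extension of `φ` to the span of `{a ∈ R₊ | φ(a) < ∞}`. -/
def pair (y x : G →L[ℂ] G) : ℂ :=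
  (1 / 4 : ℂ) * ∑ k ∈ Finset.range 4, Complex.I ^ k *
    ((φ.toFun (star (x + Complex.I ^ k • y) * (x + Complex.I ^ k • y))).toReal : ℂ)

end NSFWeight

/-- A GNS-construction `(L, π, Λ)` for a normal semifinite faithful weight `φ`. -/
structure GNS {R : VonNeumannAlgebra G} (φ : NSFWeight R) (L : Type*)
    [NormedAddCommGroup L] [InnerProductSpace ℂ L] [CompleteSpace L] where
  π : NormalHom R (fullVN L)
  Λ : φ.sqInt →ₗ[ℂ] L
  dense : DenseRange Λ
  /-- `⟨Λ(x), Λ(y)⟩ = φ(y* x)`, for the inner product that is linear in the first variable. -/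
  inner_Λ : ∀ x y : φ.sqInt, inner ℂ (Λ y) (Λ x) = φ.pair y x
  Λ_mul : ∀ (x : R) (y : φ.sqInt), Λ ⟨x.1 * y.1, φ.mul_mem_sqInt x.2 y.2⟩ = π.op x (Λ y)
  /-- `Λ` is closed for the `σ`-strong* topology on `R` and the norm topology on `L`. -/
  closed : ∀ x ∈ R, ∀ η : L,
    (∀ ξ : ℕ → G, Summable (fun n => ‖ξ n‖ ^ 2) → ∀ ε > 0, ∃ y : φ.sqInt,
      ∑' n, ‖(x - y.1) (ξ n)‖ ^ 2 + ∑' n, ‖star (x - y.1) (ξ n)‖ ^ 2 < ε ∧ ‖η - Λ y‖ < ε) →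
    ∃ h : x ∈ φ.sqInt, Λ ⟨x, h⟩ = η

end Weights

section QuantumGroups

open HTensor
open scoped ENNReal

/-- A von Neumann algebraic quantum group structure on `M`. Every positive normal functional is of
the form `ω = ∑ₙ ω_{ξₙ,ξₙ}` with `∑ₙ ‖ξₙ‖² < ∞`, and then `ω(1) = ∑ₙ ‖ξₙ‖²`. -/
structure VNQuantumGroup {G : Type*} [NormedAddCommGroup G] [InnerProductSpace ℂ G]
    [CompleteSpace G] (M : VonNeumannAlgebra G) where
  Δ : NormalHom M (vnTensor M M)
  /-- `(Δ ⊗ ι)Δ = (ι ⊗ Δ)Δ` -/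
  coassoc : ∀ x : M,
    Ad (HTensor.assoc G G G) (ampR Δ.op (Δ.toHom x)) = ampL Δ.op (Δ.toHom x)
  /-- existence of a left invariant weight -/
  left : ∃ φ : NSFWeight M, ∀ a : M, 0 ≤ a.1 → φ.toFun a.1 < ⊤ → ∀ ξ : ℕ → G,
    Summable (fun n => ‖ξ n‖ ^ 2) →
      φ.toFun (∑' n, slice (ξ n) (ξ n) (Δ.op a))
        = φ.toFun a.1 * ENNReal.ofReal (∑' n, ‖ξ n‖ ^ 2)
  /-- existence of a right invariant weight -/
  right : ∃ ψ : NSFWeight M, ∀ a : M, 0 ≤ a.1 → ψ.toFun a.1 < ⊤ → ∀ ξ : ℕ → G,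
    Summable (fun n => ‖ξ n‖ ^ 2) →
      ψ.toFun (∑' n, sliceR (ξ n) (ξ n) (Δ.op a))
        = ψ.toFun a.1 * ENNReal.ofReal (∑' n, ‖ξ n‖ ^ 2)

/-- `U₂₃` for `U` acting on `L ⊗ K`, acting on `(L ⊗ L) ⊗ K`. -/
def leg23 {L K : Type*} [NormedAddCommGroup L] [InnerProductSpace ℂ L] [CompleteSpace L]
    [NormedAddCommGroup K] [InnerProductSpace ℂ K] [CompleteSpace K]
    (U : L ⊗ʰ K →L[ℂ] L ⊗ʰ K) : (L ⊗ʰ L) ⊗ʰ K →L[ℂ] (L ⊗ʰ L) ⊗ʰ K :=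
  Ad (HTensor.assoc L L K).symm (HTensor.map 1 U)

/-- `U₁₃` for `U` acting on `L ⊗ K`, acting on `(L ⊗ L) ⊗ K`: the conjugate of `U₂₃` by the flip
of the first two legs. -/
def leg13 {L K : Type*} [NormedAddCommGroup L] [InnerProductSpace ℂ L] [CompleteSpace L]
    [NormedAddCommGroup K] [InnerProductSpace ℂ K] [CompleteSpace K]
    (U : L ⊗ʰ K →L[ℂ] L ⊗ʰ K) : (L ⊗ʰ L) ⊗ʰ K →L[ℂ] (L ⊗ʰ L) ⊗ʰ K :=
  HTensor.map ((HTensor.comm L L).toContinuousLinearEquiv : L ⊗ʰ L →L[ℂ] L ⊗ʰ L) 1 * leg23 U *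
    HTensor.map ((HTensor.comm L L).toContinuousLinearEquiv : L ⊗ʰ L →L[ℂ] L ⊗ʰ L) 1

/-- The data of the induction procedure: von Neumann algebraic quantum groups `(M, Δ_M)` and
`(N, Δ_N)`, a right action `α` of `(N, Δ_N)` on `M` compatible with `Δ_M`, a normal semifinite
faithful weight `θ` on `Q = {x ∈ M | α(x) = x ⊗ 1}` with a GNS-construction on `Hθ`, and a unitary
corepresentation `U` of `(N, Δ_N)` on `K`. -/
structure InductionData (HM HN Hθ K : Type*)
    [NormedAddCommGroup HM] [InnerProductSpace ℂ HM] [CompleteSpace HM]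
    [NormedAddCommGroup HN] [InnerProductSpace ℂ HN] [CompleteSpace HN]
    [NormedAddCommGroup Hθ] [InnerProductSpace ℂ Hθ] [CompleteSpace Hθ]
    [NormedAddCommGroup K] [InnerProductSpace ℂ K] [CompleteSpace K] where
  M : VonNeumannAlgebra HM
  N : VonNeumannAlgebra HN
  qgM : VNQuantumGroup M
  qgN : VNQuantumGroup N
  α : NormalHom M (vnTensor M N)
  α_injective : Function.Injective α.toHom
  /-- `(α ⊗ ι)α = (ι ⊗ Δ_N)α` -/
  α_action : ∀ x : M,
    Ad (HTensor.assoc HM HN HN) (ampR α.op (α.toHom x)) = ampL qgN.Δ.op (α.toHom x)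
  /-- `(Δ_M ⊗ ι)α = (ι ⊗ α)Δ_M` -/
  α_comult : ∀ x : M,
    Ad (HTensor.assoc HM HM HN) (ampR qgM.Δ.op (α.toHom x)) = ampL α.op (qgM.Δ.toHom x)
  θ : NSFWeight (fixedVN α)
  gns : GNS θ Hθ
  U : HN ⊗ʰ K →L[ℂ] HN ⊗ʰ K
  U_mem : U ∈ vnTensor N (fullVN K)
  U_unitary : U ∈ unitary (HN ⊗ʰ K →L[ℂ] HN ⊗ʰ K)
  /-- `(Δ_N ⊗ ι)(U) = U₁₃ U₂₃` -/
  U_corep : ampR qgN.Δ.op ⟨U, U_mem⟩ = leg13 U * leg23 U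

end QuantumGroups

section Carrier

set_option linter.unusedSectionVars false

variable {H G L K : Type*}
  [NormedAddCommGroup H] [InnerProductSpace ℂ H] [CompleteSpace H]
  [NormedAddCommGroup G] [InnerProductSpace ℂ G] [CompleteSpace G]
  [NormedAddCommGroup L] [InnerProductSpace ℂ L] [CompleteSpace L]
  [NormedAddCommGroup K] [InnerProductSpace ℂ K] [CompleteSpace K]

open HTensor

/-- Slices along elementary tensors determine an operator. -/
lemma mid_ext' {S T : H ⊗ʰ (L ⊗ʰ K) →L[ℂ] H ⊗ʰ (L ⊗ʰ K)}
    (h : ∀ k h k' h', slice (k ⊗ᵥ h) (k' ⊗ᵥ h') (Ad (perm H L K) S)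
      = slice (k ⊗ᵥ h) (k' ⊗ᵥ h') (Ad (perm H L K) T)) : S = T :=
  Ad_injective (perm H L K) (ext_op3 fun k e g k' e' g' => by
    rw [← inner_slice, ← inner_slice, h])

lemma inner_mid_slice (T : H ⊗ʰ (L ⊗ʰ K) →L[ℂ] H ⊗ʰ (L ⊗ʰ K)) (k k' : K) (h h' : H) (l l' : L) :
    inner ℂ l' (slice (k ⊗ᵥ h) (k' ⊗ᵥ h') (Ad (perm H L K) T) l)
      = inner ℂ (h' ⊗ᵥ (l' ⊗ᵥ k')) (T (h ⊗ᵥ (l ⊗ᵥ k))) := by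
  rw [inner_slice, Ad_apply, perm_symm_htmul, ← perm_htmul, LinearIsometryEquiv.inner_map_map]

/-- `(ω_{v,e} ⊗ ι ⊗ ι)(X)`, regarded as an operator on `ℂ ⊗ (L ⊗ K)`. -/
def redOp (v e : H) (X : H ⊗ʰ (L ⊗ʰ K) →L[ℂ] H ⊗ʰ (L ⊗ʰ K)) :
    ℂ ⊗ʰ (L ⊗ʰ K) →L[ℂ] ℂ ⊗ʰ (L ⊗ʰ K) :=
  Ad (HTensor.lid (L ⊗ʰ K)).symm (slice v e X)

/-- `1_{B(H)} ⊗ X` for an operator `X` on `ℂ ⊗ (L ⊗ K) = L ⊗ K`. -/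
def inflOp (H : Type*) [NormedAddCommGroup H] [InnerProductSpace ℂ H] [CompleteSpace H]
    (X : ℂ ⊗ʰ (L ⊗ʰ K) →L[ℂ] ℂ ⊗ʰ (L ⊗ʰ K)) :
    H ⊗ʰ (L ⊗ʰ K) →L[ℂ] H ⊗ʰ (L ⊗ʰ K) :=
  HTensor.map 1 (Ad (HTensor.lid (L ⊗ʰ K)) X)

lemma slice_redOp (v e : H) (X : H ⊗ʰ (L ⊗ʰ K) →L[ℂ] H ⊗ʰ (L ⊗ʰ K)) (k k' : K) (c c' : ℂ) :
    slice (k ⊗ᵥ c) (k' ⊗ᵥ c') (Ad (perm ℂ L K) (redOp v e X))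
      = (inner ℂ c' c : ℂ) • slice (k ⊗ᵥ v) (k' ⊗ᵥ e) (Ad (perm H L K) X) := by
  refine ContinuousLinearMap.ext fun l => ext_inner_left ℂ fun l' => ?_
  rw [inner_mid_slice, smul_apply, inner_smul_right, inner_mid_slice, redOp, Ad_apply,
    LinearIsometryEquiv.symm_symm, lid_htmul, lid_symm_apply, inner_htmul, map_smul,
    inner_smul_right, inner_slice]
  simp
  ring

lemma slice_inflOp (X : ℂ ⊗ʰ (L ⊗ʰ K) →L[ℂ] ℂ ⊗ʰ (L ⊗ʰ K)) (k k' : K) (h h' : H) :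
    slice (k ⊗ᵥ h) (k' ⊗ᵥ h') (Ad (perm H L K) (inflOp H X))
      = (inner ℂ h' h : ℂ) • slice (k ⊗ᵥ (1 : ℂ)) (k' ⊗ᵥ (1 : ℂ)) (Ad (perm ℂ L K) X) := by
  refine ContinuousLinearMap.ext fun l => ext_inner_left ℂ fun l' => ?_
  rw [inner_mid_slice, smul_apply, inner_smul_right, inner_mid_slice, inflOp, map_htmul,
    inner_htmul, Ad_apply, lid_symm_apply, ← lid_symm_apply (l' ⊗ᵥ k'), one_apply_eq_self]
  congr 1
  rw [← LinearIsometryEquiv.inner_map_map (HTensor.lid (L ⊗ʰ K)) ((HTensor.lid _).symm _),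
    LinearIsometryEquiv.apply_symm_apply]

lemma Ad_lid_symm (B : L →L[ℂ] L) : Ad (HTensor.lid L).symm B = HTensor.map 1 B :=
  ext_clm fun c l => by
    rw [Ad_apply, LinearIsometryEquiv.symm_symm, lid_htmul, lid_symm_apply, map_htmul, map_smul,
      htmul_smul, one_apply_eq_self, ← smul_htmul, smul_eq_mul, mul_one]

lemma Ad_lid_map (B : L →L[ℂ] L) : Ad (HTensor.lid L) (HTensor.map 1 B) = B := by
  rw [← Ad_lid_symm, Ad_Ad_symm]

lemma redOp_mem {R : VonNeumannAlgebra L} (v e : H) {X : H ⊗ʰ (L ⊗ʰ K) →L[ℂ] H ⊗ʰ (L ⊗ʰ K)}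
    (hX : X ∈ midVN H K R) : redOp v e X ∈ midVN ℂ K R := by
  rw [← Ad_perm_mem_iff]
  refine mem_full_tensor_of_slice fun k c k' c' => ?_
  rw [slice_redOp]
  exact SMulMemClass.smul_mem _ (mem_full_tensor_iff_slice.1 (Ad_perm_mem_iff.2 hX) _ _)

lemma inflOp_mem {R : VonNeumannAlgebra L} {X : ℂ ⊗ʰ (L ⊗ʰ K) →L[ℂ] ℂ ⊗ʰ (L ⊗ʰ K)}
    (hX : X ∈ midVN ℂ K R) : inflOp H X ∈ midVN H K R := by
  rw [← Ad_perm_mem_iff]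
  refine mem_full_tensor_of_slice fun k c k' c' => ?_
  rw [slice_inflOp]
  exact SMulMemClass.smul_mem _ (mem_full_tensor_iff_slice.1 (Ad_perm_mem_iff.2 hX) _ _)

lemma midAmp_redOp {R : VonNeumannAlgebra G} (φ : R →⋆ₐ[ℂ] (L →L[ℂ] L)) (v e : H)
    (X : midVN H K R) : midAmp φ ⟨redOp v e X.1, redOp_mem v e X.2⟩ = redOp v e (midAmp φ X) := by
  refine mid_ext' fun k c k' c' => ?_
  rw [slice_redOp, slice_midAmp, slice_midAmp, ← map_smul]
  exact congrArg φ (Subtype.ext (slice_redOp ..))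

lemma midAmp_inflOp {R : VonNeumannAlgebra G} (φ : R →⋆ₐ[ℂ] (L →L[ℂ] L))
    (X : midVN ℂ K R) : midAmp φ ⟨inflOp H X.1, inflOp_mem X.2⟩ = inflOp H (midAmp φ X) := by
  refine mid_ext' fun k c k' c' => ?_
  rw [slice_inflOp, slice_midAmp, slice_midAmp, ← map_smul]
  exact congrArg φ (Subtype.ext (slice_inflOp ..))

lemma leg124_redOp (v e : H) (X : H ⊗ʰ (G ⊗ʰ K) →L[ℂ] H ⊗ʰ (G ⊗ʰ K)) :
    leg124 L (redOp v e X) = redOp v e (leg124 L X) := by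
  refine mid_ext' fun k c k' c' => ?_
  rw [slice_redOp, slice_leg124, slice_leg124, slice_redOp, map_smul_one']

lemma leg124_inflOp (X : ℂ ⊗ʰ (G ⊗ʰ K) →L[ℂ] ℂ ⊗ʰ (G ⊗ʰ K)) :
    leg124 L (inflOp H X) = inflOp H (leg124 L X) := by
  refine mid_ext' fun k c k' c' => ?_
  rw [slice_inflOp, slice_leg124, slice_leg124, slice_inflOp, map_smul_one']

lemma leg34_mul_redOp (U : L ⊗ʰ K →L[ℂ] L ⊗ʰ K) (v e : H)
    (X : H ⊗ʰ ((G ⊗ʰ L) ⊗ʰ K) →L[ℂ] H ⊗ʰ ((G ⊗ʰ L) ⊗ʰ K)) :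
    leg34 ℂ G U * redOp v e X = redOp v e (leg34 H G U * X) := by
  simp only [leg34, redOp, slice_map_mul, Ad_mul, Ad_lid_symm]

lemma leg34_mul_inflOp (U : L ⊗ʰ K →L[ℂ] L ⊗ʰ K)
    (X : ℂ ⊗ʰ ((G ⊗ʰ L) ⊗ʰ K) →L[ℂ] ℂ ⊗ʰ ((G ⊗ʰ L) ⊗ʰ K)) :
    leg34 H G U * inflOp H X = inflOp H (leg34 ℂ G U * X) := by
  simp only [leg34, inflOp, Ad_mul, Ad_lid_map, map_mul_map, mul_one]

/-- The space `P_H = {X ∈ B(H) ⊗ R ⊗ B(K) | (ι ⊗ α ⊗ ι)(X) = U₃₄* X₁₂₄}`. -/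
def carrierP {R : VonNeumannAlgebra G} {S : VonNeumannAlgebra L} (α : NormalHom R (vnTensor R S))
    (U : L ⊗ʰ K →L[ℂ] L ⊗ʰ K) (H : Type*) [NormedAddCommGroup H] [InnerProductSpace ℂ H]
    [CompleteSpace H] : Submodule ℂ (H ⊗ʰ (G ⊗ʰ K) →L[ℂ] H ⊗ʰ (G ⊗ʰ K)) where
  carrier := {X | ∃ h : X ∈ midVN H K R, midAmp α.op ⟨X, h⟩ = star (leg34 H G U) * leg124 L X}
  zero_mem' := ⟨zero_mem _, by
    have h1 := map_zero (midAmp (H := H) (K := K) α.op)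
    have h2 : leg124 L (0 : H ⊗ʰ (G ⊗ʰ K) →L[ℂ] H ⊗ʰ (G ⊗ʰ K)) = 0 := by
      simpa using leg124_smul (L := L) 0 (0 : H ⊗ʰ (G ⊗ʰ K) →L[ℂ] H ⊗ʰ (G ⊗ʰ K))
    rw [h2, mul_zero]
    exact h1⟩
  add_mem' := by
    rintro X Y ⟨hX, hX'⟩ ⟨hY, hY'⟩
    refine ⟨add_mem hX hY, ?_⟩
    have := map_add (midAmp (H := H) (K := K) α.op) ⟨X, hX⟩ ⟨Y, hY⟩
    rw [hX', hY', ← mul_add, ← leg124_add] at this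
    exact this
  smul_mem' := by
    rintro c X ⟨hX, hX'⟩
    refine ⟨SMulMemClass.smul_mem c hX, ?_⟩
    have := map_smul (midAmp (H := H) (K := K) α.op) c ⟨X, hX⟩
    rw [hX', ← mul_smul_comm, ← leg124_smul] at this
    exact this

section

variable {R : VonNeumannAlgebra G} {S : VonNeumannAlgebra L} {α : NormalHom R (vnTensor R S)}
  {U : L ⊗ʰ K →L[ℂ] L ⊗ʰ K}

lemma redOp_mem_carrierP (v e : H) {X : H ⊗ʰ (G ⊗ʰ K) →L[ℂ] H ⊗ʰ (G ⊗ʰ K)}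
    (hX : X ∈ carrierP α U H) : redOp v e X ∈ carrierP α U ℂ := by
  obtain ⟨hX, hX'⟩ := hX
  refine ⟨redOp_mem v e hX, ?_⟩
  rw [midAmp_redOp α.op v e ⟨X, hX⟩, hX', ← leg34_star, ← leg34_star, ← leg34_mul_redOp,
    leg124_redOp]

lemma inflOp_mem_carrierP {X : ℂ ⊗ʰ (G ⊗ʰ K) →L[ℂ] ℂ ⊗ʰ (G ⊗ʰ K)}
    (hX : X ∈ carrierP α U ℂ) : inflOp H X ∈ carrierP α U H := by
  obtain ⟨hX, hX'⟩ := hX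
  refine ⟨inflOp_mem hX, ?_⟩
  rw [midAmp_inflOp α.op ⟨X, hX⟩, hX', ← leg34_star, ← leg34_star, ← leg34_mul_inflOp,
    leg124_inflOp]

lemma midAmp_star_mul (hU : U ∈ unitary (L ⊗ʰ K →L[ℂ] L ⊗ʰ K)) (X Y : midVN H K R)
    (hX : midAmp α.op X = star (leg34 H G U) * leg124 L X.1)
    (hY : midAmp α.op Y = star (leg34 H G U) * leg124 L Y.1) :
    midAmp α.op (star Y * X) = leg124 L (star Y.1 * X.1) := by
  have h1 : leg34 H G U * star (leg34 H G U) = 1 := by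
    rw [← leg34_star, ← leg34_mul, Unitary.mul_star_self_of_mem hU, leg34_one]
  rw [midAmp_mul, midAmp_star, hX, hY, star_mul, star_star, mul_assoc,
    ← mul_assoc (leg34 H G U), h1, one_mul, leg124_mul, leg124_star]

lemma midSlice_mem_fixedVN (T : midVN H K R) (hT : midAmp α.op T = leg124 L T.1) (v w : K ⊗ʰ H) :
    (midSlice v w T).1 ∈ fixedVN α := by
  rw [mem_fixedVN_iff]
  refine ⟨(midSlice v w T).2, ?_⟩
  have h := slice_leg124 (L := L) v w T.1
  rw [← hT, slice_midAmp] at h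
  exact h

lemma mem_mid_fixedVN {T : H ⊗ʰ (G ⊗ʰ K) →L[ℂ] H ⊗ʰ (G ⊗ʰ K)} (h : T ∈ midVN H K R)
    (hT : midAmp α.op ⟨T, h⟩ = leg124 L T) : T ∈ midVN H K (fixedVN α) := by
  rw [← Ad_perm_mem_iff, mem_full_tensor_iff_slice]
  exact fun v w => midSlice_mem_fixedVN ⟨T, h⟩ hT v w

/-- `Y* X ∈ B(H) ⊗ Q ⊗ B(K)` for `X, Y ∈ P_H`. -/
lemma star_mul_mem (hU : U ∈ unitary (L ⊗ʰ K →L[ℂ] L ⊗ʰ K))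
    (X Y : H ⊗ʰ (G ⊗ʰ K) →L[ℂ] H ⊗ʰ (G ⊗ʰ K))
    (hX : X ∈ carrierP α U H) (hY : Y ∈ carrierP α U H) :
    star Y * X ∈ midVN H K (fixedVN α) :=
  mem_mid_fixedVN (mul_mem (star_mem hY.1) hX.1)
    (midAmp_star_mul hU ⟨X, hX.1⟩ ⟨Y, hY.1⟩ hX.2 hY.2)

end

end Carrier

namespace InductionData

open HTensor

variable {HM HN Hθ K : Type*}
  [NormedAddCommGroup HM] [InnerProductSpace ℂ HM] [CompleteSpace HM]
  [NormedAddCommGroup HN] [InnerProductSpace ℂ HN] [CompleteSpace HN]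
  [NormedAddCommGroup Hθ] [InnerProductSpace ℂ Hθ] [CompleteSpace Hθ]
  [NormedAddCommGroup K] [InnerProductSpace ℂ K] [CompleteSpace K]
  (D : InductionData HM HN Hθ K)
  (H : Type*) [NormedAddCommGroup H] [InnerProductSpace ℂ H] [CompleteSpace H]

/-- `P_H = {X ∈ B(H) ⊗ M ⊗ B(K) | (ι ⊗ α ⊗ ι)(X) = U₃₄* X₁₂₄}`. -/
def P : Submodule ℂ (H ⊗ʰ (HM ⊗ʰ K) →L[ℂ] H ⊗ʰ (HM ⊗ʰ K)) := carrierP D.α D.U H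

variable {H}

/-- `Y* X` as an element of `B(H) ⊗ Q ⊗ B(K)`. -/
def gram (Y X : D.P H) : midVN H K (fixedVN D.α) :=
  ⟨star Y.1 * X.1, star_mul_mem D.U_unitary X.1 Y.1 X.2 Y.2⟩

lemma gram_add_left (Y Y' X : D.P H) : D.gram (Y + Y') X = D.gram Y X + D.gram Y' X :=
  Subtype.ext (by
    change star (Y.1 + Y'.1) * X.1 = star Y.1 * X.1 + star Y'.1 * X.1
    rw [star_add, add_mul])

lemma gram_smul_left (c : ℂ) (Y X : D.P H) : D.gram (c • Y) X = starRingEnd ℂ c • D.gram Y X :=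
  Subtype.ext (by
    change star (c • Y.1) * X.1 = starRingEnd ℂ c • (star Y.1 * X.1)
    rw [star_smul, smul_mul_assoc]
    rfl)

lemma gram_add_right (Y X X' : D.P H) : D.gram Y (X + X') = D.gram Y X + D.gram Y X' :=
  Subtype.ext (mul_add _ _ _)

lemma gram_smul_right (c : ℂ) (Y X : D.P H) : D.gram Y (c • X) = c • D.gram Y X :=
  Subtype.ext (mul_smul_comm _ _ _)

lemma star_gram (Y X : D.P H) : star (D.gram Y X) = D.gram X Y :=
  Subtype.ext (by
    change star (star Y.1 * X.1) = star X.1 * Y.1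
    rw [star_mul, star_star])

/-- The operator `(ι ⊗ π_θ ⊗ ι)(Y* X)`. -/
def gramOp (Y X : D.P H) : H ⊗ʰ (Hθ ⊗ʰ K) →L[ℂ] H ⊗ʰ (Hθ ⊗ʰ K) :=
  midAmp D.gns.π.op (D.gram Y X)

lemma inner_gramOp (Y X : D.P H) (w v : H ⊗ʰ (Hθ ⊗ʰ K)) :
    starRingEnd ℂ (inner ℂ w (D.gramOp Y X v)) = inner ℂ v (D.gramOp X Y w) := by
  have h : D.gramOp Y X = ContinuousLinearMap.adjoint (D.gramOp X Y) := by
    rw [gramOp, ← star_gram, midAmp_star, ContinuousLinearMap.star_eq_adjoint]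
    rfl
  rw [inner_conj_symm, h, ContinuousLinearMap.adjoint_inner_left]

variable (H) in
/-- The sesquilinear form on `P_H ⊙ (H ⊗ H_θ ⊗ K)`, conjugate linear in the first variable, that
maps `(Y ⊗ w, X ⊗ v)` to `⟨(ι ⊗ π_θ ⊗ ι)(Y* X) v, w⟩`, for the inner product that is linear in the
first variable. -/
def form : D.P H ⊗[ℂ] (H ⊗ʰ (Hθ ⊗ʰ K)) →ₗ⋆[ℂ] D.P H ⊗[ℂ] (H ⊗ʰ (Hθ ⊗ʰ K)) →ₗ[ℂ] ℂ :=
  have h1 : ∀ Y Y' X : D.P H, D.gramOp (Y + Y') X = D.gramOp Y X + D.gramOp Y' X := fun _ _ _ => by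
    rw [gramOp, gram_add_left, map_add]; rfl
  have h2 : ∀ (c : ℂ) (Y X : D.P H), D.gramOp (c • Y) X = starRingEnd ℂ c • D.gramOp Y X :=
    fun _ _ _ => by rw [gramOp, gram_smul_left, map_smul]; rfl
  have h3 : ∀ Y X X' : D.P H, D.gramOp Y (X + X') = D.gramOp Y X + D.gramOp Y X' := fun _ _ _ => by
    rw [gramOp, gram_add_right, map_add]; rfl
  have h4 : ∀ (c : ℂ) (Y X : D.P H), D.gramOp Y (c • X) = c • D.gramOp Y X :=
    fun _ _ _ => by rw [gramOp, gram_smul_right, map_smul]; rfl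
  TensorProduct.lift (LinearMap.mk₂'ₛₗ (starRingEnd ℂ) (starRingEnd ℂ)
    (fun (Y : D.P H) (w : H ⊗ʰ (Hθ ⊗ʰ K)) => TensorProduct.lift (LinearMap.mk₂ ℂ
      (fun (X : D.P H) (v : H ⊗ʰ (Hθ ⊗ʰ K)) => inner ℂ w (D.gramOp Y X v))
      (fun _ _ _ => by simp [h3])
      (fun _ _ _ => by simp [h4])
      (fun _ _ _ => by simp)
      (fun _ _ _ => by simp)))
    (fun _ _ _ => TensorProduct.ext' fun _ _ => by simp [h1])
    (fun _ _ _ => TensorProduct.ext' fun _ _ => by simp [h2])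
    (fun _ _ _ => TensorProduct.ext' fun _ _ => by simp)
    (fun _ _ _ => TensorProduct.ext' fun _ _ => by simp [mul_comm]))

lemma form_tmul (Y X : D.P H) (w v : H ⊗ʰ (Hθ ⊗ʰ K)) :
    D.form H (Y ⊗ₜ[ℂ] w) (X ⊗ₜ[ℂ] v) = inner ℂ w (D.gramOp Y X v) := rfl

lemma form_conj (y x : D.P H ⊗[ℂ] (H ⊗ʰ (Hθ ⊗ʰ K))) :
    starRingEnd ℂ (D.form H y x) = D.form H x y := by
  induction y using TensorProduct.induction_on with
  | zero => simp
  | add y y' hy hy' => simp [hy, hy']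
  | tmul Y w =>
    induction x using TensorProduct.induction_on with
    | zero => simp
    | add x x' hx hx' => simp [hx, hx']
    | tmul X v => rw [form_tmul, form_tmul, inner_gramOp]

lemma sum_gram_nonneg {n : Type*} [Fintype n] [DecidableEq n] (X : n → D.P H)
    (v : n → H ⊗ʰ (Hθ ⊗ʰ K)) : 0 ≤ ∑ i, ∑ j, inner ℂ (v i) (D.gramOp (X i) (X j) (v j)) := by
  refine cp (midHom H K D.gns.π) (fun i j => D.gram (X i) (X j)) (fun ξ => ?_) v
  have h : ∑ i, ∑ j, inner ℂ (ξ i)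
      ((D.gram (X i) (X j) : H ⊗ʰ (HM ⊗ʰ K) →L[ℂ] H ⊗ʰ (HM ⊗ʰ K)) (ξ j))
      = inner ℂ (∑ i, (X i).1 (ξ i)) (∑ j, (X j).1 (ξ j)) := by
    rw [sum_inner]
    refine Finset.sum_congr rfl fun i _ => ?_
    rw [inner_sum]
    refine Finset.sum_congr rfl fun j _ => ?_
    exact ContinuousLinearMap.adjoint_inner_right (X i).1 (ξ i) ((X j).1 (ξ j))
  rw [h, Complex.nonneg_iff]
  exact ⟨inner_self_nonneg (𝕜 := ℂ), (inner_self_im (𝕜 := ℂ) _).symm⟩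

lemma form_nonneg (x : D.P H ⊗[ℂ] (H ⊗ʰ (Hθ ⊗ʰ K))) : 0 ≤ D.form H x x := by
  classical
  obtain ⟨s, rfl⟩ := TensorProduct.exists_finset (R := ℂ) (M := D.P H) (N := H ⊗ʰ (Hθ ⊗ʰ K)) x
  have h := D.sum_gram_nonneg (fun i : s => i.1.1) (fun i : s => i.1.2)
  rw [← Finset.sum_coe_sort s (fun i => i.1 ⊗ₜ[ℂ] i.2)]
  rw [Finset.sum_comm] at h
  simpa only [map_sum, LinearMap.sum_apply, sum_apply, form_tmul] using h

variable (H) in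
/-- The algebraic tensor product `P_H ⊙ (H ⊗ H_θ ⊗ K)`. -/
def PreCarrier : Type _ := D.P H ⊗[ℂ] (H ⊗ʰ (Hθ ⊗ʰ K))

instance : AddCommGroup (D.PreCarrier H) :=
  inferInstanceAs (AddCommGroup (D.P H ⊗[ℂ] (H ⊗ʰ (Hθ ⊗ʰ K))))

instance : Module ℂ (D.PreCarrier H) :=
  inferInstanceAs (Module ℂ (D.P H ⊗[ℂ] (H ⊗ʰ (Hθ ⊗ʰ K))))

variable (H) in
/-- The positive semidefinite inner product on `P_H ⊙ (H ⊗ H_θ ⊗ K)`. -/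
@[reducible]
def core : PreInnerProductSpace.Core ℂ (D.PreCarrier H) where
  inner y x := D.form H y x
  conj_inner_symm x y := D.form_conj y x
  re_inner_nonneg x := (Complex.nonneg_iff.1 (D.form_nonneg x)).1
  add_left x y z := congrArg (fun f : D.P H ⊗[ℂ] (H ⊗ʰ (Hθ ⊗ʰ K)) →ₗ[ℂ] ℂ => f z)
    (map_add (D.form H) x y)
  smul_left x y c := congrArg (fun f : D.P H ⊗[ℂ] (H ⊗ʰ (Hθ ⊗ʰ K)) →ₗ[ℂ] ℂ => f y)
    (LinearMap.map_smulₛₗ (D.form H) c x)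

instance : SeminormedAddCommGroup (D.PreCarrier H) :=
  @InnerProductSpace.Core.toSeminormedAddCommGroup ℂ (D.PreCarrier H) _ _ _ (D.core H)

instance : InnerProductSpace ℂ (D.PreCarrier H) := InnerProductSpace.ofCore (D.core H)

/-- `X ⊗ v` in `P_H ⊙ (H ⊗ H_θ ⊗ K)`. -/
def preDot (X : D.P H) (v : H ⊗ʰ (Hθ ⊗ʰ K)) : D.PreCarrier H := X ⊗ₜ[ℂ] v

lemma inner_preDot (Y X : D.P H) (w v : H ⊗ʰ (Hθ ⊗ʰ K)) :
    inner ℂ (D.preDot Y w) (D.preDot X v) = inner ℂ w (D.gramOp Y X v) := rfl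

variable (H) in
/-- The Hilbert space `𝒦_H`: the Hausdorff completion of `P_H ⊙ (H ⊗ H_θ ⊗ K)`, i.e. the
completion of its quotient by the vectors of length zero. -/
def Carrier : Type _ := UniformSpace.Completion (D.PreCarrier H)

instance : NormedAddCommGroup (D.Carrier H) :=
  inferInstanceAs (NormedAddCommGroup (UniformSpace.Completion (D.PreCarrier H)))
instance : InnerProductSpace ℂ (D.Carrier H) :=
  inferInstanceAs (InnerProductSpace ℂ (UniformSpace.Completion (D.PreCarrier H)))
instance : CompleteSpace (D.Carrier H) :=
  inferInstanceAs (CompleteSpace (UniformSpace.Completion (D.PreCarrier H)))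

/-- The class `X ⊙ v` of `X ⊗ v` in `𝒦_H`. -/
def dot (X : D.P H) (v : H ⊗ʰ (Hθ ⊗ʰ K)) : D.Carrier H :=
  UniformSpace.Completion.toComplₗᵢ (𝕜 := ℂ) (E := D.PreCarrier H) (D.preDot X v)

lemma inner_dot (Y X : D.P H) (w v : H ⊗ʰ (Hθ ⊗ʰ K)) :
    inner ℂ (D.dot Y w) (D.dot X v) = inner ℂ w (D.gramOp Y X v) :=
  (UniformSpace.Completion.toComplₗᵢ (𝕜 := ℂ) (E := D.PreCarrier H)).inner_map_map _ _

/-- `X ⊙ w ∈ 𝒦 = 𝒦_ℂ` for `X ∈ P = P_ℂ` and `w ∈ H_θ ⊗ K = ℂ ⊗ H_θ ⊗ K`. -/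
def dotC (X : D.P ℂ) (w : Hθ ⊗ʰ K) : D.Carrier ℂ := D.dot X ((HTensor.lid (Hθ ⊗ʰ K)).symm w)

variable (H) in
/-- `1_{B(H)} ⊗ X ∈ P_H` for `X ∈ P`. -/
def oneTensor (X : D.P ℂ) : D.P H := ⟨inflOp H X.1, inflOp_mem_carrierP X.2⟩

/-- `(ω_{v,e} ⊗ ι ⊗ ι)(X) ∈ P` for `X ∈ P_H`, where `ω_{v,e}(x) = ⟨x v, e⟩` for the inner product
that is linear in the first variable. -/
def sliceP (v e : H) (X : D.P H) : D.P ℂ := ⟨redOp v e X.1, redOp_mem_carrierP v e X.2⟩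

end InductionData

end IndCorep

end

noncomputable section

namespace IndCorep

open HTensor

/-! ### Slicing and amplification in the leg `H`. -/

section Operators

set_option linter.unusedSectionVars false

variable {H L K : Type*}
  [NormedAddCommGroup H] [InnerProductSpace ℂ H] [CompleteSpace H]
  [NormedAddCommGroup L] [InnerProductSpace ℂ L] [CompleteSpace L]
  [NormedAddCommGroup K] [InnerProductSpace ℂ K] [CompleteSpace K]

/-! Write `X_{v,e} = (ω_{v,e} ⊗ ι ⊗ ι)(X)`. Everything rests on one adjunction. Slicing in the leg
`H` is linear over operators that do not touch this leg, so slicing `(1 ⊗ Y)* X` gives `Y* X_{v,e}`;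
and `ι ⊗ π_θ ⊗ ι` acts in a different leg, so it commutes with slicing. In terms of inner products,
pairing `X ⊙ (v ⊗ w)` with `(1 ⊗ Y) ⊙ (e ⊗ w')` in `𝒦_H` is the same as pairing `X_{v,e} ⊙ w` with
`Y ⊙ w'` in `𝒦` (`inner_oneTensor_dot`).

For `X = 1 ⊗ X'` the slice is the scalar multiple `⟨v, e⟩ X'`, so the prescribed map multiplies
inner products and extends to an isometry `H ⊗ 𝒦 → 𝒦_H` (`inner_creation`). For general `X` the
adjunction says that the component of `U_H*(X ⊙ (v ⊗ w))` along `e` is `X_{v,e} ⊙ w`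
(`adjoint_leg_adjoint_dot`). The formula for `U_H*` is then the expansion of a vector of `H ⊗ 𝒦`
along an orthonormal basis of `H`, and square summability is Bessel's inequality. Uniqueness holds
because the vectors `v ⊗ (X ⊙ w)` are total.

Surjectivity needs more than algebra. Put `z = X ⊙ (v ⊗ l ⊗ k)` and `y_i = X_{v,b_i} ⊙ (l ⊗ k)` for
an orthonormal basis `(b_i)`. The images of the vectors `b_i ⊗ y_i` are pairwise orthogonal, and
each has inner product `‖y_i‖²` with `z`. Hence the squared distance from `z` to a partial sum of
these images is `‖z‖² - ∑ ‖y_i‖²`, and `z` lies in the closed range as soon as `∑ ‖y_i‖² = ‖z‖²`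
(`dot_mem_closure`). This Parseval identity is the weak identity `∑ X_{v,b_i}* X_{v,b_i} = (X*
X)_{v,v}` seen through `π_θ`. A representation without continuity could lose mass in the limit.
Normality of `π_θ` turns the vector functional at `l` into `∑_n ⟨· ξ_n, ξ'_n⟩` on `Q`; for each `n`
the identity is Parseval in `H`, and dominated convergence exchanges the sum over `n` with the limit
over finite sets of indices `i` (`hasSum_inner_dotC`). -/

lemma star_inflOp (X : ℂ ⊗ʰ (L ⊗ʰ K) →L[ℂ] ℂ ⊗ʰ (L ⊗ʰ K)) :
    star (inflOp H X) = inflOp H (star X) := by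
  rw [inflOp, inflOp, star_map, star_one, Ad_star]

/-- Operators of the form `1 ⊗ Y` pass through a slice in the leg `H`. This is the algebraic source
of the adjunction between slicing and `X ↦ 1 ⊗ X`. -/
lemma redOp_inflOp_mul (v e : H) (Y : ℂ ⊗ʰ (L ⊗ʰ K) →L[ℂ] ℂ ⊗ʰ (L ⊗ʰ K))
    (X : H ⊗ʰ (L ⊗ʰ K) →L[ℂ] H ⊗ʰ (L ⊗ʰ K)) :
    redOp v e (inflOp H Y * X) = Y * redOp v e X := by
  rw [redOp, redOp, inflOp, slice_map_mul, Ad_mul, Ad_symm_Ad]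

lemma redOp_inflOp (v e : H) (Y : ℂ ⊗ʰ (L ⊗ʰ K) →L[ℂ] ℂ ⊗ʰ (L ⊗ʰ K)) :
    redOp v e (inflOp H Y) = (inner ℂ e v : ℂ) • Y := by
  rw [redOp, inflOp, slice_map, one_apply_eq_self, Ad_smul, Ad_symm_Ad]

/-- Removes the auxiliary factor `ℂ` and turns matrix coefficients of a slice into matrix
coefficients of the operator at elementary tensors. -/
lemma inner_redOp (v e : H) (X : H ⊗ʰ (L ⊗ʰ K) →L[ℂ] H ⊗ʰ (L ⊗ʰ K)) (w' w : L ⊗ʰ K) :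
    inner ℂ ((lid (L ⊗ʰ K)).symm w') (redOp v e X ((lid (L ⊗ʰ K)).symm w))
      = inner ℂ (e ⊗ᵥ w') (X (v ⊗ᵥ w)) := by
  rw [redOp, Ad_apply, LinearIsometryEquiv.symm_symm, LinearIsometryEquiv.apply_symm_apply,
    LinearIsometryEquiv.inner_map_map, inner_slice]

lemma norm_htmul (v : H) (w : K) : ‖v ⊗ᵥ w‖ = ‖v‖ * ‖w‖ := by
  rw [← ι_tmul, LinearIsometry.norm_map, TensorProduct.norm_tmul]

end Operators

/-! ### The adjunction between slicing and amplification in `𝒦_H`. -/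

namespace InductionData

variable {HM HN Hθ K H : Type*}
  [NormedAddCommGroup HM] [InnerProductSpace ℂ HM] [CompleteSpace HM]
  [NormedAddCommGroup HN] [InnerProductSpace ℂ HN] [CompleteSpace HN]
  [NormedAddCommGroup Hθ] [InnerProductSpace ℂ Hθ] [CompleteSpace Hθ]
  [NormedAddCommGroup K] [InnerProductSpace ℂ K] [CompleteSpace K]
  [NormedAddCommGroup H] [InnerProductSpace ℂ H] [CompleteSpace H]
  (D : InductionData HM HN Hθ K)

/-- The amplified representation `ι ⊗ π_θ ⊗ ι` is defined by its slices in the middle leg, so it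
commutes with slicing in the leg `H`. What remains is the identity `((1 ⊗ Y)* X)_{v,e} = Y* X_{v,e}`
in `Q ⊗ B(K)`. Normality of `π_θ` plays no role in this step. -/
lemma redOp_gramOp_oneTensor (v e : H) (Y : D.P ℂ) (X : D.P H) :
    redOp v e (D.gramOp (D.oneTensor H Y) X) = D.gramOp Y (D.sliceP v e X) := by
  rw [gramOp, gramOp, ← midAmp_redOp]
  congr 1
  refine Subtype.ext ?_
  change redOp v e (star (inflOp H Y.1) * X.1) = star Y.1 * redOp v e X.1
  rw [star_inflOp, redOp_inflOp_mul]

/-- Slicing is adjoint to amplification. -/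
lemma inner_oneTensor_dot (v e : H) (Y : D.P ℂ) (X : D.P H) (w' w : Hθ ⊗ʰ K) :
    inner ℂ (D.dot (D.oneTensor H Y) (e ⊗ᵥ w')) (D.dot X (v ⊗ᵥ w))
      = inner ℂ (D.dotC Y w') (D.dotC (D.sliceP v e X) w) := by
  rw [dotC, dotC, inner_dot, inner_dot, ← redOp_gramOp_oneTensor, inner_redOp]

/-! ### The vectors `X ⊙ v`: bilinearity, boundedness, totality. -/

variable (H) in
/-- The canonical map from `P_H ⊙ (H ⊗ H_θ ⊗ K)` to `𝒦_H`. -/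
def toCarrier : D.PreCarrier H →ₗᵢ[ℂ] D.Carrier H := UniformSpace.Completion.toComplₗᵢ

lemma denseRange_toCarrier : DenseRange (D.toCarrier H) :=
  UniformSpace.Completion.denseRange_coe

lemma toCarrier_preDot (X : D.P H) (v : H ⊗ʰ (Hθ ⊗ʰ K)) :
    D.toCarrier H (D.preDot X v) = D.dot X v := rfl

lemma dot_add_left (X Y : D.P H) (v : H ⊗ʰ (Hθ ⊗ʰ K)) :
    D.dot (X + Y) v = D.dot X v + D.dot Y v :=
  (congrArg (D.toCarrier H) (TensorProduct.add_tmul X Y v)).trans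
    ((D.toCarrier H).map_add (D.preDot X v) (D.preDot Y v))

lemma dot_smul_left (c : ℂ) (X : D.P H) (v : H ⊗ʰ (Hθ ⊗ʰ K)) :
    D.dot (c • X) v = c • D.dot X v :=
  (congrArg (D.toCarrier H) (TensorProduct.smul_tmul' c X v).symm).trans
    ((D.toCarrier H).map_smul c (D.preDot X v))

lemma dot_add_right (X : D.P H) (v w : H ⊗ʰ (Hθ ⊗ʰ K)) :
    D.dot X (v + w) = D.dot X v + D.dot X w :=
  (congrArg (D.toCarrier H) (TensorProduct.tmul_add X v w)).trans
    ((D.toCarrier H).map_add (D.preDot X v) (D.preDot X w))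

lemma dot_smul_right (c : ℂ) (X : D.P H) (v : H ⊗ʰ (Hθ ⊗ʰ K)) :
    D.dot X (c • v) = c • D.dot X v :=
  (congrArg (D.toCarrier H) (TensorProduct.tmul_smul c X v)).trans
    ((D.toCarrier H).map_smul c (D.preDot X v))

/-- The squared norm of `X ⊙ v` is the quadratic form of `(ι ⊗ π_θ ⊗ ι)(X* X)` at `v`. The bound
makes `v ↦ X ⊙ v` continuous, so that totality arguments may be restricted to elementary tensors `v
⊗ l ⊗ k`. -/
lemma norm_dot_le (X : D.P H) (v : H ⊗ʰ (Hθ ⊗ʰ K)) :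
    ‖D.dot X v‖ ≤ √‖D.gramOp X X‖ * ‖v‖ := by
  -- Compare squares: the right-hand side is nonnegative.
  refine abs_le_of_sq_le_sq' ?_ (by positivity) |>.2
  rw [mul_pow, Real.sq_sqrt (norm_nonneg _), ← inner_self_eq_norm_sq (𝕜 := ℂ), inner_dot]
  refine (re_inner_le_norm _ _).trans ?_
  calc ‖v‖ * ‖D.gramOp X X v‖ ≤ ‖v‖ * (‖D.gramOp X X‖ * ‖v‖) := by
        gcongr
        exact ContinuousLinearMap.le_opNorm _ _
    _ = _ := by ring

/-- The bounded operator `v ↦ X ⊙ v`. -/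
def dotL (X : D.P H) : H ⊗ʰ (Hθ ⊗ʰ K) →L[ℂ] D.Carrier H :=
  LinearMap.mkContinuous
    { toFun := D.dot X
      map_add' := D.dot_add_right X
      map_smul' := fun c v => D.dot_smul_right c X v }
    (√‖D.gramOp X X‖) (D.norm_dot_le X)

lemma dotL_apply (X : D.P H) (v : H ⊗ʰ (Hθ ⊗ʰ K)) : D.dotL X v = D.dot X v := rfl

/-- The elements `X ⊗ v` generate `P_H ⊙ (H ⊗ H_θ ⊗ K)`. -/
lemma preCarrier_induction {p : D.PreCarrier H → Prop} (zero : p 0)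
    (preDot : ∀ X v, p (D.preDot X v)) (add : ∀ x y, p x → p y → p (x + y))
    (x : D.PreCarrier H) : p x :=
  TensorProduct.induction_on (motive := p) x zero preDot add

lemma dotC_smul_left (c : ℂ) (X : D.P ℂ) (w : Hθ ⊗ʰ K) :
    D.dotC (c • X) w = c • D.dotC X w := D.dot_smul_left c X _

/-- Passes between the two models of `𝒦`: it is built from vectors of `ℂ ⊗ (H_θ ⊗ K)`, while the
proposition is phrased with vectors of `H_θ ⊗ K`. -/
lemma dot_eq_dotC (X : D.P ℂ) (x : ℂ ⊗ʰ (Hθ ⊗ʰ K)) : D.dot X x = D.dotC X (lid _ x) := by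
  rw [dotC, LinearIsometryEquiv.symm_apply_apply]

/-- The scalar produced here becomes the factor from `H` in the inner product of `H ⊗ 𝒦`. -/
lemma sliceP_oneTensor (v e : H) (X : D.P ℂ) :
    D.sliceP v e (D.oneTensor H X) = (inner ℂ e v : ℂ) • X :=
  Subtype.ext (redOp_inflOp v e X.1)

lemma oneTensor_add (X Y : D.P ℂ) :
    D.oneTensor H (X + Y) = D.oneTensor H X + D.oneTensor H Y :=
  Subtype.ext (by
    change inflOp H (X.1 + Y.1) = inflOp H X.1 + inflOp H Y.1
    rw [inflOp, Ad_add, map_one_add]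
    rfl)

lemma oneTensor_smul (c : ℂ) (X : D.P ℂ) : D.oneTensor H (c • X) = c • D.oneTensor H X :=
  Subtype.ext (by
    change inflOp H (c • X.1) = c • inflOp H X.1
    rw [inflOp, Ad_smul, map_one_smul]
    rfl)

/-- A continuous linear map on `𝒦_H` is determined by its values on the classes `X ⊙ v`. -/
lemma ext_dot {Y : Type*} [NormedAddCommGroup Y] [NormedSpace ℂ Y] {S T : D.Carrier H →L[ℂ] Y}
    (h : ∀ X v, S (D.dot X v) = T (D.dot X v)) : S = T := by
  refine ContinuousLinearMap.ext fun x => ?_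
  refine congrFun (D.denseRange_toCarrier.equalizer S.continuous T.continuous
    (funext fun y => ?_)) x
  induction y using D.preCarrier_induction with
  | zero => simp
  | preDot X v => exact h X v
  | add y y' hy hy' => simpa using congrArg₂ (· + ·) hy hy'

lemma ext_dotC {Y : Type*} [NormedAddCommGroup Y] [NormedSpace ℂ Y] {S T : D.Carrier ℂ →L[ℂ] Y}
    (h : ∀ X w, S (D.dotC X w) = T (D.dotC X w)) : S = T :=
  D.ext_dot fun X x => by rw [dot_eq_dotC, h]

/-! ### The operators `𝒦 → 𝒦_H` attached to vectors of `H`. -/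

variable (H) in
/-- The map `X ⊗ w ↦ (1 ⊗ X) ⊙ (v ⊗ w)` on `P ⊙ (H_θ ⊗ K)`. -/
def preAmp (v : H) : D.PreCarrier ℂ →ₗ[ℂ] D.Carrier H :=
  TensorProduct.lift (LinearMap.mk₂ ℂ
    (fun (X : D.P ℂ) (x : ℂ ⊗ʰ (Hθ ⊗ʰ K)) => D.dot (D.oneTensor H X) (v ⊗ᵥ lid _ x))
    (fun _ _ _ => by rw [oneTensor_add, dot_add_left])
    (fun _ _ _ => by rw [oneTensor_smul, dot_smul_left])
    (fun _ _ _ => by rw [map_add, htmul_add, dot_add_right])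
    (fun _ _ _ => by rw [map_smul, htmul_smul, dot_smul_right]))

lemma preAmp_preDot (v : H) (X : D.P ℂ) (x : ℂ ⊗ʰ (Hθ ⊗ʰ K)) :
    D.preAmp H v (D.preDot X x) = D.dot (D.oneTensor H X) (v ⊗ᵥ lid _ x) := rfl

/-- The adjunction reduces the left-hand side to an inner product in `𝒦` with the slice of `1 ⊗ X`,
which is a scalar multiple of `X`. This is the reason why `U_H` is isometric. -/
lemma inner_dot_oneTensor (v v' : H) (X Y : D.P ℂ) (w w' : Hθ ⊗ʰ K) :
    inner ℂ (D.dot (D.oneTensor H Y) (v' ⊗ᵥ w')) (D.dot (D.oneTensor H X) (v ⊗ᵥ w))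
      = inner ℂ v' v * inner ℂ (D.dotC Y w') (D.dotC X w) := by
  rw [inner_oneTensor_dot, sliceP_oneTensor, dotC_smul_left, inner_smul_right]

/-- Both sides are sesquilinear, so the identity spreads from the vectors `X ⊗ w` to the whole
algebraic tensor product. -/
lemma inner_preAmp (v v' : H) (y x : D.PreCarrier ℂ) :
    inner ℂ (D.preAmp H v' y) (D.preAmp H v x) = inner ℂ v' v * inner ℂ y x := by
  induction y using D.preCarrier_induction with
  | zero => simp
  | add y y' hy hy' => rw [map_add, inner_add_left, inner_add_left, hy, hy', mul_add]
  | preDot Y w =>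
    induction x using D.preCarrier_induction with
    | zero => simp
    | add x x' hx hx' => rw [map_add, inner_add_right, inner_add_right, hx, hx', mul_add]
    | preDot X u =>
      rw [preAmp_preDot, preAmp_preDot, inner_dot_oneTensor, ← dot_eq_dotC, ← dot_eq_dotC,
        inner_dot, inner_preDot]

/-- Equality holds, by `inner_preAmp` on the diagonal. The inequality does two things at once:
vectors of length zero are sent to `0`, so the map descends to the quotient, and it then extends to
the completion. -/
lemma norm_preAmp (v : H) (x : D.PreCarrier ℂ) : ‖D.preAmp H v x‖ ≤ ‖v‖ * ‖x‖ := by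
  -- The squares of the two sides agree.
  refine abs_le_of_sq_le_sq' (le_of_eq ?_) (by positivity) |>.2
  rw [mul_pow, ← inner_self_eq_norm_sq (𝕜 := ℂ), inner_preAmp, inner_self_eq_norm_sq_to_K,
    inner_self_eq_norm_sq_to_K]
  norm_cast

/-- The map `X ⊙ w ↦ (1 ⊗ X) ⊙ (v ⊗ w)` from `𝒦` to `𝒦_H`. -/
def creation (v : H) : D.Carrier ℂ →L[ℂ] D.Carrier H :=
  ((D.preAmp H v).mkContinuous ‖v‖ (D.norm_preAmp v)).extend (D.toCarrier ℂ).toContinuousLinearMap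

lemma creation_toCarrier (v : H) (x : D.PreCarrier ℂ) :
    D.creation v (D.toCarrier ℂ x) = D.preAmp H v x :=
  ContinuousLinearMap.extend_eq _ (e := (D.toCarrier ℂ).toContinuousLinearMap)
    D.denseRange_toCarrier (D.toCarrier ℂ).isometry.isUniformInducing x

lemma creation_dotC (v : H) (X : D.P ℂ) (w : Hθ ⊗ʰ K) :
    D.creation v (D.dotC X w) = D.dot (D.oneTensor H X) (v ⊗ᵥ w) := by
  rw [dotC, ← toCarrier_preDot, creation_toCarrier, preAmp_preDot,
    LinearIsometryEquiv.apply_symm_apply]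

/-- This multiplicativity is exactly the condition for `(v, x) ↦ creation v x` to factor through an
isometry on the Hilbert space tensor product `H ⊗ 𝒦`. It passes from the algebraic level by density,
both sides being continuous in `y` and `x`. -/
lemma inner_creation (v v' : H) (y x : D.Carrier ℂ) :
    inner ℂ (D.creation v' y) (D.creation v x) = inner ℂ v' v * inner ℂ y x := by
  refine D.denseRange_toCarrier.induction_on₂ (p := fun y x =>
    inner ℂ (D.creation v' y) (D.creation v x) = inner ℂ v' v * inner ℂ y x) ?_ ?_ y x
  · exact isClosed_eq (by fun_prop) (by fun_prop)
  · intro a b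
    rw [creation_toCarrier, creation_toCarrier, inner_preAmp, LinearIsometry.inner_map_map]

variable (H) in
/-- The bilinear map `(v, X ⊙ w) ↦ (1 ⊗ X) ⊙ (v ⊗ w)`. -/
def creationₗ : H →ₗ[ℂ] D.Carrier ℂ →ₗ[ℂ] D.Carrier H :=
  LinearMap.mk₂ ℂ (fun v x => D.creation v x)
    (fun v v' x => by
      -- Linearity in `v` cannot be read off from the extension by continuity; it is tested on the
      -- total set of vectors `X ⊙ w`, where the value is explicit.
      have : D.creation (v + v') = D.creation v + D.creation v' := D.ext_dotC fun X w => by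
        rw [add_apply, creation_dotC, creation_dotC, creation_dotC, add_htmul, dot_add_right]
      rw [this, add_apply])
    (fun c v x => by
      have : D.creation (c • v) = c • D.creation v := D.ext_dotC fun X w => by
        rw [smul_apply, creation_dotC, creation_dotC, smul_htmul, dot_smul_right]
      rw [this, smul_apply])
    (fun v x y => map_add _ x y) (fun c v x => map_smul _ c x)

/-! ### Parseval's identity in `𝒦_H` and total range. -/

/-- Normality of `π_θ`, applied to `∑ᵢ Xᵢ* Xᵢ = (ω_{v,v} ⊗ ι ⊗ ι)(X* X)` for
`Xᵢ = (ω_{v,bᵢ} ⊗ ι ⊗ ι)(X)`. -/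
lemma hasSum_inner_dotC {ι' : Type*} (b : HilbertBasis ι' ℂ H) (v : H) (X : D.P H) (l : Hθ)
    (k : K) :
    HasSum (fun i => (inner ℂ (D.dotC (D.sliceP v (b i) X) (l ⊗ᵥ k))
      (D.dotC (D.sliceP v (b i) X) (l ⊗ᵥ k)) : ℂ))
      (inner ℂ (D.dot X (v ⊗ᵥ (l ⊗ᵥ k))) (D.dot X (v ⊗ᵥ (l ⊗ᵥ k)))) := by
  -- Normality replaces the functional `⟨π_θ(·) l, l⟩` on `Q` by a series of vector functionals on
  -- `H_M`. The sequences `ξ` and `ξ'` need not coincide, so the individual terms need not be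
  -- nonnegative and monotone convergence is not available.
  obtain ⟨ξ, ξ', hξ, hξ', h⟩ := D.gns.π.exists_vec l l
  -- The vector is an elementary tensor in order that its matrix coefficient involves only the slice
  -- of `X* X` in the legs `H` and `K`, which is an element of `Q` to which the series applies.
  have e1 : inner ℂ (D.dot X (v ⊗ᵥ (l ⊗ᵥ k))) (D.dot X (v ⊗ᵥ (l ⊗ᵥ k)))
      = ∑' n, inner ℂ (ξ' n ⊗ᵥ k) (slice v v (star X.1 * X.1) (ξ n ⊗ᵥ k)) := by
    rw [inner_dot, gramOp, ← inner_mid_slice, slice_midAmp, h]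
    refine tsum_congr fun n => ?_
    rw [inner_slice]
    exact inner_mid_slice (star X.1 * X.1) k k v v (ξ n) (ξ' n)
  -- The same series for the operator `X_{v,b_i}* X_{v,b_i}`. The leg `H` is now `ℂ`, with the
  -- vector `1` in it.
  have e2 : ∀ i, (inner ℂ (D.dotC (D.sliceP v (b i) X) (l ⊗ᵥ k))
      (D.dotC (D.sliceP v (b i) X) (l ⊗ᵥ k)) : ℂ)
      = ∑' n, inner ℂ (ξ' n ⊗ᵥ k)
        ((slice (b i) v (star X.1) * slice v (b i) X.1) (ξ n ⊗ᵥ k)) := by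
    intro i
    rw [dotC, lid_symm_apply, inner_dot, gramOp, ← inner_mid_slice, slice_midAmp, h]
    refine tsum_congr fun n => ?_
    refine (inner_mid_slice (star (redOp v (b i) X.1) * redOp v (b i) X.1) k k 1 1 (ξ n)
      (ξ' n)).trans ?_
    -- The adjoint of the slice of `X` along `v, b_i` is the slice of `X*` along `b_i, v`, so the
    -- product has the form of one term of the expansion of `(X* X)_{v,v}` over the basis.
    rw [redOp, ← Ad_star, ← Ad_mul, ← slice_star, Ad_lid_symm, map_htmul, inner_htmul]
    simp
  -- Tensoring with the fixed vector `k` preserves square summability, which is needed for the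
  -- series to converge absolutely and for the dominating bound to be summable.
  have hk : ∀ ζ : ℕ → HM, Summable (fun n => ‖ζ n‖ ^ 2) →
      Summable fun n => ‖ζ n ⊗ᵥ k‖ ^ 2 := fun ζ hζ => by
    simp only [norm_htmul, mul_pow]
    exact hζ.mul_right _
  have hpart : ∀ J : Finset ι', ∑ i ∈ J, (inner ℂ (D.dotC (D.sliceP v (b i) X) (l ⊗ᵥ k))
      (D.dotC (D.sliceP v (b i) X) (l ⊗ᵥ k)) : ℂ)
      = ∑' n, ∑ i ∈ J, inner ℂ (ξ' n ⊗ᵥ k)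
        ((slice (b i) v (star X.1) * slice v (b i) X.1) (ξ n ⊗ᵥ k)) := by
    -- Only a finite sum is interchanged with the series here; the limit over `J` is left to
    -- dominated convergence.
    intro J
    rw [Summable.tsum_finsetSum fun i _ => summable_normal (hk ξ hξ) (hk ξ' hξ') _]
    exact Finset.sum_congr rfl fun i _ => e2 i
  unfold HasSum
  rw [e1]
  simp only [hpart]
  -- The bound does not depend on `J`: it comes from Bessel's inequality applied to `X (v ⊗ ξ_n ⊗
  -- k)` and `X (v ⊗ ξ'_n ⊗ k)`. The dominated series runs over `n`, so the basis may be
  -- uncountable.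
  refine tendsto_tsum_of_dominated_convergence
    (bound := fun n => (‖star X.1‖ * ‖v‖) ^ 2 * ‖ξ' n ⊗ᵥ k‖ ^ 2
      + (‖X.1‖ * ‖v‖) ^ 2 * ‖ξ n ⊗ᵥ k‖ ^ 2)
    (((hk ξ' hξ').mul_left _).add ((hk ξ hξ).mul_left _)) (fun n => ?_)
    (Filter.Eventually.of_forall fun J n =>
      slice_mul_partial_le b v v (star X.1) X.1 (ξ n ⊗ᵥ k) (ξ' n ⊗ᵥ k) J)
  -- For fixed `n`, convergence is Parseval's identity in the leg `H`.
  exact slice_mul_hasSum b v v (star X.1) X.1 (ξ n ⊗ᵥ k) (ξ' n ⊗ᵥ k)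

/-- The candidate approximants are the partial sums of `∑_i (1 ⊗ X_{v,b_i}) ⊙ (b_i ⊗ l ⊗ k)`. Their
summands are pairwise orthogonal and are the orthogonal components of the vector, so the remaining
distance is the defect in Parseval's identity, which tends to zero by `hasSum_inner_dotC`. -/
lemma dot_mem_closure (v : H) (X : D.P H) (l : Hθ) (k : K) :
    D.dot X (v ⊗ᵥ (l ⊗ᵥ k)) ∈ (Submodule.span ℂ
      (Set.range fun p : H × D.Carrier ℂ => D.creationₗ H p.1 p.2)).topologicalClosure := by
  classical
  obtain ⟨s, b, -⟩ := exists_hilbertBasis ℂ H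
  set z := D.dot X (v ⊗ᵥ (l ⊗ᵥ k))
  let y : s → D.Carrier ℂ := fun i => D.dotC (D.sliceP v (b i) X) (l ⊗ᵥ k)
  -- By adjunction, pairing with `z` slices `X` along `v, b_i` once more, and the result is `y_i`
  -- again.
  have hin : ∀ i, inner ℂ (D.creation (b i) (y i)) z = inner ℂ (y i) (y i) := fun i => by
    rw [creation_dotC, inner_oneTensor_dot]
  have hin' : ∀ i, inner ℂ z (D.creation (b i) (y i)) = inner ℂ (y i) (y i) := fun i => by
    rw [← inner_conj_symm, hin, inner_conj_symm]
  -- Orthonormality of the basis passes to orthogonality of the images, because inner products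
  -- multiply.
  have hcr : ∀ i j, inner ℂ (D.creation (b i) (y i)) (D.creation (b j) (y j))
      = if i = j then (inner ℂ (y i) (y i) : ℂ) else 0 := fun i j => by
    rw [inner_creation, orthonormal_iff_ite.1 b.orthonormal i j]
    split_ifs with hij
    · subst hij; rw [one_mul]
    · rw [zero_mul]
  have hdist : ∀ J : Finset s, (inner ℂ (z - ∑ i ∈ J, D.creation (b i) (y i))
      (z - ∑ i ∈ J, D.creation (b i) (y i)) : ℂ)
      = inner ℂ z z - ∑ i ∈ J, inner ℂ (y i) (y i) := by
    intro J
    simp only [inner_sub_left, inner_sub_right, sum_inner, inner_sum, hin, hin', hcr,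
      Finset.sum_ite_eq']
    -- The subtracted expression is the inner product of the partial sum with its difference from
    -- `z`; it vanishes since the partial sum is an orthogonal projection of `z`.
    rw [sub_eq_self]
    exact Finset.sum_eq_zero fun i hi => by rw [if_pos hi, sub_self]
  have h0 : Filter.Tendsto (fun J : Finset s => ‖z - ∑ i ∈ J, D.creation (b i) (y i)‖ ^ 2)
      Filter.atTop (nhds 0) := by
    have h1 := (D.hasSum_inner_dotC b v X l k : Filter.Tendsto _ _ _).const_sub (inner ℂ z z)
    rw [sub_self] at h1
    -- The inner products are complex-valued; their real part is the squared norm.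
    have h2 := (Complex.continuous_re.tendsto 0).comp h1
    refine h2.congr fun J => ?_
    change (inner ℂ z z - ∑ i ∈ J, inner ℂ (y i) (y i)).re = _
    rw [← hdist]
    exact inner_self_eq_norm_sq (𝕜 := ℂ) _
  have h1 : Filter.Tendsto (fun J : Finset s => ∑ i ∈ J, D.creation (b i) (y i))
      Filter.atTop (nhds z) := by
    rw [tendsto_iff_norm_sub_tendsto_zero]
    have := (Real.continuous_sqrt.tendsto 0).comp h0
    rw [Real.sqrt_zero] at this
    refine this.congr fun J => ?_
    rw [Function.comp_apply, Real.sqrt_sq (norm_nonneg _), norm_sub_rev]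
  exact mem_closure_of_tendsto h1 (Filter.Eventually.of_forall fun J =>
    Submodule.sum_mem _ fun i _ => Submodule.subset_span ⟨(b i, y i), rfl⟩)

/-- A vector `u` orthogonal to the range is orthogonal to every `X ⊙ (v ⊗ l ⊗ k)` by
`dot_mem_closure`. Boundedness of `x ↦ X ⊙ x` gives orthogonality to all `X ⊙ x`, and these are
total in `𝒦_H`. -/
lemma closure_span_creation : (Submodule.span ℂ
    (Set.range fun p : H × D.Carrier ℂ => D.creationₗ H p.1 p.2)).topologicalClosure = ⊤ := by
  rw [Submodule.topologicalClosure_eq_top_iff, Submodule.eq_bot_iff]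
  intro u hu
  rw [← Submodule.orthogonal_closure] at hu
  have h : innerSL ℂ u = 0 := D.ext_dot fun X x => by
    have : innerSL ℂ u ∘L D.dotL X = 0 := ext_clm3' fun v l k => by
      rw [ContinuousLinearMap.comp_apply, dotL_apply, innerSL_apply_apply]
      exact Submodule.inner_left_of_mem_orthogonal (D.dot_mem_closure v X l k) hu
    exact congrArg (fun T => T x) this
  -- The functional `⟨u, ·⟩` is zero; evaluating it at `u` itself gives `u = 0`.
  have := congrArg (fun T => T u) h
  simpa using this

/-! ### The unitary, its uniqueness and its adjoint. -/

variable (H) in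
/-- The unitary `U_H : H ⊗ 𝒦 → 𝒦_H`. -/
def ampEquiv : H ⊗ʰ D.Carrier ℂ ≃ₗᵢ[ℂ] D.Carrier H :=
  liftEquiv (D.creationₗ H) (fun _ _ _ _ => D.inner_creation _ _ _ _) D.closure_span_creation

lemma ampEquiv_htmul_dotC (v : H) (X : D.P ℂ) (w : Hθ ⊗ʰ K) :
    D.ampEquiv H (v ⊗ᵥ D.dotC X w) = D.dot (D.oneTensor H X) (v ⊗ᵥ w) :=
  (liftEquiv_htmul ..).trans (D.creation_dotC v X w)

/-- `U_H` is determined by its values on the vectors `v ⊗ (X ⊙ w)`. -/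
lemma eq_ampEquiv {V : H ⊗ʰ D.Carrier ℂ ≃ₗᵢ[ℂ] D.Carrier H}
    (hV : ∀ (v : H) (X : D.P ℂ) (w : Hθ ⊗ʰ K),
      V (v ⊗ᵥ D.dotC X w) = D.dot (D.oneTensor H X) (v ⊗ᵥ w)) : V = D.ampEquiv H := by
  let A : H ⊗ʰ D.Carrier ℂ →L[ℂ] D.Carrier H := V.toContinuousLinearEquiv
  let B : H ⊗ʰ D.Carrier ℂ →L[ℂ] D.Carrier H := (D.ampEquiv H).toContinuousLinearEquiv
  have h : A = B := ext_clm fun v x => by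
    -- For fixed `v` both maps are continuous on `𝒦`, so agreement on the total vectors `X ⊙ w`
    -- suffices.
    have : A ∘L leg v = B ∘L leg v := D.ext_dotC fun X w =>
      (hV v X w).trans (D.ampEquiv_htmul_dotC v X w).symm
    exact congrArg (fun T => T x) this
  exact LinearIsometryEquiv.ext fun x => congrArg (fun T => T x) h

/-- Pairing with `Y ⊙ w'` moves both adjoints to the other side and produces `(1 ⊗ Y) ⊙ (e ⊗ w')`,
where the adjunction applies. Only the formula for `A` on elementary vectors is used, not that `A`
is unitary, and `w` may be any vector of `H_θ ⊗ K`. -/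
lemma adjoint_leg_adjoint_dot {A : H ⊗ʰ D.Carrier ℂ →L[ℂ] D.Carrier H}
    (hA : ∀ (v : H) (X : D.P ℂ) (w : Hθ ⊗ʰ K),
      A (v ⊗ᵥ D.dotC X w) = D.dot (D.oneTensor H X) (v ⊗ᵥ w))
    (v e : H) (X : D.P H) (w : Hθ ⊗ʰ K) :
    ContinuousLinearMap.adjoint (leg e) (ContinuousLinearMap.adjoint A (D.dot X (v ⊗ᵥ w)))
      = D.dotC (D.sliceP v e X) w := by
  set x := ContinuousLinearMap.adjoint (leg e) (ContinuousLinearMap.adjoint A (D.dot X (v ⊗ᵥ w)))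
  -- Two vectors of `𝒦` are equal once they have the same inner products with the total set of
  -- vectors `Y ⊙ w'`.
  refine (innerSL_inj (𝕜 := ℂ)).1 (D.ext_dotC fun Y w' => ?_)
  have h : inner ℂ (D.dotC Y w') x = inner ℂ (D.dotC Y w') (D.dotC (D.sliceP v e X) w) := by
    rw [ContinuousLinearMap.adjoint_inner_right, ContinuousLinearMap.adjoint_inner_right,
      leg_apply, hA, inner_oneTensor_dot]
  rw [innerSL_apply_apply, innerSL_apply_apply, ← inner_conj_symm, h, inner_conj_symm]

end InductionData

end IndCorep

end

/-! ### The proposition. -/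

theorem mainTheorem10 {HM HN Hθ K H : Type*}
    [NormedAddCommGroup HM] [InnerProductSpace ℂ HM] [CompleteSpace HM]
    [NormedAddCommGroup HN] [InnerProductSpace ℂ HN] [CompleteSpace HN]
    [NormedAddCommGroup Hθ] [InnerProductSpace ℂ Hθ] [CompleteSpace Hθ]
    [NormedAddCommGroup K] [InnerProductSpace ℂ K] [CompleteSpace K]
    [NormedAddCommGroup H] [InnerProductSpace ℂ H] [CompleteSpace H]
    (D : IndCorep.InductionData HM HN Hθ K) :
    (∃! V : H ⊗ʰ D.Carrier ℂ ≃ₗᵢ[ℂ] D.Carrier H,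
      ∀ (v : H) (X : D.P ℂ) (w : Hθ ⊗ʰ K),
        V (v ⊗ᵥ D.dotC X w) = D.dot (D.oneTensor H X) (v ⊗ᵥ w)) ∧
    ∀ V : H ⊗ʰ D.Carrier ℂ ≃ₗᵢ[ℂ] D.Carrier H,
      (∀ (v : H) (X : D.P ℂ) (w : Hθ ⊗ʰ K),
        V (v ⊗ᵥ D.dotC X w) = D.dot (D.oneTensor H X) (v ⊗ᵥ w)) →
      ∀ {ι : Type*} (e : HilbertBasis ι ℂ H) (v : H) (X : D.P H) (w : Hθ ⊗ʰ K),
        Summable (fun i => ‖D.dotC (D.sliceP v (e i) X) w‖ ^ 2) ∧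
        HasSum (fun i => e i ⊗ᵥ D.dotC (D.sliceP v (e i) X) w)
          (ContinuousLinearMap.adjoint
            (V.toContinuousLinearEquiv : H ⊗ʰ D.Carrier ℂ →L[ℂ] D.Carrier H)
            (D.dot X (v ⊗ᵥ w))) := by
  refine ⟨⟨D.ampEquiv H, D.ampEquiv_htmul_dotC, fun V hV => D.eq_ampEquiv hV⟩, ?_⟩
  intro V hV ι e v X w
  set z := ContinuousLinearMap.adjoint
    (V.toContinuousLinearEquiv : H ⊗ʰ D.Carrier ℂ →L[ℂ] D.Carrier H) (D.dot X (v ⊗ᵥ w))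
  -- The components of `z = U_H*(X ⊙ (v ⊗ w))` along the basis are the slices, so both claims become
  -- general facts about a vector of `H ⊗ 𝒦`.
  have h : ∀ i, ContinuousLinearMap.adjoint (IndCorep.HTensor.leg (e i)) z
      = D.dotC (D.sliceP v (e i) X) w := fun i => D.adjoint_leg_adjoint_dot hV v (e i) X w
  constructor
  -- Bessel's inequality bounds every finite partial sum by `‖z‖²`.
  · refine summable_of_sum_le (c := ‖z‖ ^ 2) (fun _ => by positivity) fun J => ?_
    simpa only [h] using IndCorep.sum_leg_le e z J
  · simpa only [h, IndCorep.HTensor.leg_apply] using IndCorep.hasSum_leg e z
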